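/- Let $c\in\mathbb{R}\setminus\{0\}$, $m\in[0,1)$ and $V\in\mathbb{R}$. Let $K(m)=\int_0^{\pi/2}\frac{d\theta}{\sqrt{1-m\sin^2\theta}}$ (with $K(1)=\infty$) and let $\mathrm{sn}(\cdot|m)$ be the Jacobi elliptic sine with parameter $m$. Consider the $2\pi$-periodic cnoidal profile $$p(x)=\frac{cK(m)^2}{3\pi^2}\Big[\frac V2-\frac{m+1}{3}+m\,\mathrm{sn}^2\Big(\frac{K(m)}{\pi}x\Big|m\Big)\Big]$$ and its Hill equation $-\frac c6\psi''+p\,\psi=0$ on $\mathbb{R}$. The latter has pairs $\psi=(\psi_1,\psi_2)$ of linearly independent real solutions, and for each such pair there is a unique monodromy matrix $\mathsf M\in SL(2,\mathbb{R})$ such that $\psi(x+2\pi)=\mathsf M\,\psi(x)$ for all $x$. Let $\wp$ and $\zeta$ be the Weierstrass functions with half-periods $K(m)$ and $iK(1-m)$; for $m=0$ they are the degenerate functions given by the same series over the rank-one lattice $2K(0)\mathbb{Z}=\pi\mathbb{Z}$. A value of $\wp^{-1}(V)$ means any $a\in\mathbb{C}$ that is not a lattice point and satisfies $\wp(a)=V$.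 If $(m,V)\neq(0,-\frac13)$, such an $a$ exists with $0\le\mathrm{Re}\,a\le K(m)$ and $0\le\mathrm{Im}\,a\le K(1-m)$. Moreover: 1. For every pair $\psi$ as above and every value $a$ of $\wp^{-1}(V)$, $$\mathrm{Tr}\,\mathsf M=2\cosh\big[2K(m)\zeta(a)-2\zeta(K(m))\,a\big].$$ In particular the right-hand side is real and does not depend on the choice of the value $a$. 2. Suppose that the wave has a rest frame with uniform value $k\in\mathbb{R}$, that is, there is a smooth $f:\mathbb{R}\to\mathbb{R}$ with $f'>0$ and $f(x+2\pi)=f(x)+2\pi$ such that $$p(f(x))=\frac{1}{f'(x)^2}\Big[k+\frac{c}{12}\Big(\frac{f'''(x)}{f'(x)}-\frac32\Big(\frac{f''(x)}{f'(x)}\Big)^2\Big)\Big]\qquad\text{for all }x.$$ Then for every value $a$ of $\wp^{-1}(V)$ in the strip $|\mathrm{Im}\,a|\le K(1-m)$ (no restriction if $m=0$), $$k=\frac{c}{6\pi^2}\big[K(m)\zeta(a)-\zeta(K(m))\,a\big]^2 .$$ 3. For $(m,V)=(0,-\frac13)$ one has $\wp(a)\to V$ as $\mathrm{Im}\,a\to+\infty$,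 and the formulas of 1 and 2 hold in the limit $\mathrm{Im}\,a\to+\infty$: $\mathrm{Tr}\,\mathsf M=-2$, and $k=-\frac{c}{24}$ for every uniform value $k$ as in 2. -/

import Mathlib

open scoped ContDiff

noncomputable section

namespace Cnoidal

/-! ### Elliptic integrals and the Jacobi sine -/

/-- The incomplete elliptic integral of the first kind with parameter `m` (the squared modulus),
`F(θ|m) = ∫₀^θ dt / √(1 - m sin² t)`. -/
def ellipticF (m θ : ℝ) : ℝ :=
  ∫ t in (0 : ℝ)..θ, 1 / Real.sqrt (1 - m * Real.sin t ^ 2)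

/-- The complete elliptic integral of the first kind, `K(m) = F(π/2|m)`, for `m < 1`.
(As `m → 1` it diverges; the value of this function at `m = 1` is never used below.) -/
def ellipticK (m : ℝ) : ℝ := ellipticF m (Real.pi / 2)

/-- The Jacobi amplitude: the inverse function of `θ ↦ F(θ|m)`. -/
def jacobiAm (m u : ℝ) : ℝ := Function.invFun (ellipticF m) u

/-- The Jacobi elliptic sine on the real line, `sn(F(θ|m)|m) = sin θ`. -/
def jacobiSn (m u : ℝ) : ℝ := Real.sin (jacobiAm m u)

theorem one_sub_mul_sin_sq_pos {m : ℝ} (h0 : 0 ≤ m) (h1 : m < 1) (t : ℝ) :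
    0 < 1 - m * Real.sin t ^ 2 := by
  nlinarith [Real.sin_sq_le_one t, sq_nonneg (Real.sin t)]

theorem continuous_ellipticF_integrand {m : ℝ} (h0 : 0 ≤ m) (h1 : m < 1) :
    Continuous fun t : ℝ => 1 / Real.sqrt (1 - m * Real.sin t ^ 2) := by
  refine continuous_const.div (by fun_prop) fun t => ?_
  exact (Real.sqrt_pos.mpr (one_sub_mul_sin_sq_pos h0 h1 t)).ne'

theorem one_le_ellipticF_integrand {m : ℝ} (h0 : 0 ≤ m) (h1 : m < 1) (t : ℝ) :
    1 ≤ 1 / Real.sqrt (1 - m * Real.sin t ^ 2) := by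
  rw [le_div_iff₀ (Real.sqrt_pos.mpr (one_sub_mul_sin_sq_pos h0 h1 t)), one_mul]
  exact Real.sqrt_le_one.mpr (by nlinarith [sq_nonneg (Real.sin t)])

theorem sub_le_ellipticF_sub {m : ℝ} (h0 : 0 ≤ m) (h1 : m < 1) {a b : ℝ} (hab : a ≤ b) :
    b - a ≤ ellipticF m b - ellipticF m a := by
  have hc := continuous_ellipticF_integrand h0 h1
  have h : ellipticF m b - ellipticF m a =
      ∫ t in a..b, 1 / Real.sqrt (1 - m * Real.sin t ^ 2) :=
    intervalIntegral.integral_interval_sub_left (hc.intervalIntegrable _ _)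
      (hc.intervalIntegrable _ _)
  rw [h]
  have := intervalIntegral.integral_mono_on (μ := MeasureTheory.volume) hab
    (continuous_const (y := (1 : ℝ)).intervalIntegrable a b) (hc.intervalIntegrable a b)
    (fun t _ => one_le_ellipticF_integrand h0 h1 t)
  simpa using this

theorem ellipticF_bijective {m : ℝ} (h0 : 0 ≤ m) (h1 : m < 1) :
    Function.Bijective (ellipticF m) := by
  have hc : Continuous (ellipticF m) :=
    intervalIntegral.continuous_primitive
      (fun a b => (continuous_ellipticF_integrand h0 h1).intervalIntegrable a b) 0
  have hz : ellipticF m 0 = 0 := by simp [ellipticF]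
  constructor
  · have hs : StrictMono (ellipticF m) := fun a b hab => by
      have := sub_le_ellipticF_sub h0 h1 hab.le
      linarith
    exact hs.injective
  · refine hc.surjective ?_ ?_
    · refine Filter.tendsto_atTop_mono' _ ?_ Filter.tendsto_id
      filter_upwards [Filter.eventually_ge_atTop 0] with b hb
      have := sub_le_ellipticF_sub h0 h1 hb
      simp only [id]
      linarith
    · refine Filter.tendsto_atBot_mono' _ ?_ Filter.tendsto_id
      filter_upwards [Filter.eventually_le_atBot 0] with b hb
      have := sub_le_ellipticF_sub h0 h1 hb
      simp only [id]
      linarith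

/-- The defining property of the Jacobi sine. -/
theorem jacobiSn_ellipticF {m : ℝ} (h0 : 0 ≤ m) (h1 : m < 1) (θ : ℝ) :
    jacobiSn m (ellipticF m θ) = Real.sin θ := by
  rw [jacobiSn, jacobiAm, Function.leftInverse_invFun (ellipticF_bijective h0 h1).1]

/-! ### Weierstrass functions

The series are written for an arbitrary discrete subgroup `Λ` of `ℂ`, so as to include the
degenerate lattice of rank one that occurs for `m = 0`. The `l = 0` terms are `1 / z ^ 2` and
`1 / z`, because `1 / 0 = 0`. -/

/-- `℘(z) = 1/z² + ∑_{l ≠ 0} (1/(z - l)² - 1/l²)`. -/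
def weierstrassP (Λ : Submodule ℤ ℂ) (z : ℂ) : ℂ :=
  ∑' l : Λ, (1 / (z - l) ^ 2 - 1 / (l : ℂ) ^ 2)

/-- `ζ(z) = 1/z + ∑_{l ≠ 0} (1/(z - l) + 1/l + z/l²)`. -/
def weierstrassZeta (Λ : Submodule ℤ ℂ) (z : ℂ) : ℂ :=
  ∑' l : Λ, (1 / (z - l) + 1 / (l : ℂ) + z / (l : ℂ) ^ 2)

/-- On lattices of rank two, this is Mathlib's Weierstrass function. -/
theorem weierstrassP_lattice (L : PeriodPair) :
    weierstrassP L.lattice = L.weierstrassP := rfl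

/-- The lattice with half-periods `K(m)` and `i K(1 - m)`. For `m = 0` one has `K(1) = ∞`, there is
no second period, and the lattice is `2 K(0) ℤ = π ℤ`. -/
def lattice (m : ℝ) : Submodule ℤ ℂ :=
  if m = 0 then Submodule.span ℤ {((2 * ellipticK 0 : ℝ) : ℂ)}
  else Submodule.span ℤ
    {((2 * ellipticK m : ℝ) : ℂ), ((2 * ellipticK (1 - m) : ℝ) : ℂ) * Complex.I}

/-- `℘(z, K(m), i K(1 - m))`. -/
def wp (m : ℝ) (z : ℂ) : ℂ := weierstrassP (lattice m) z

/-- `ζ(z, K(m), i K(1 - m))`. -/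
def zeta (m : ℝ) (z : ℂ) : ℂ := weierstrassZeta (lattice m) z

/-- `a` is one of the values of the multivalued function `℘⁻¹` at `V`
(lattice points are poles of `℘`). -/
def IsInverseWp (m V : ℝ) (a : ℂ) : Prop := a ∉ lattice m ∧ wp m a = V

/-! ### Cnoidal profiles, Hill's equation and its monodromy -/

/-- The profile of the cnoidal wave with pointedness `m` and rescaled velocity `V`, at central
charge `c`. -/
def profile (c m V x : ℝ) : ℝ :=
  c * ellipticK m ^ 2 / (3 * Real.pi ^ 2) *
    (V / 2 - (m + 1) / 3 + m * jacobiSn m (ellipticK m / Real.pi * x) ^ 2)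

/-- `ψ` solves Hill's equation `-(c/6) ψ'' + p ψ = 0` on the real line. -/
def IsHillSolution (c : ℝ) (p ψ : ℝ → ℝ) : Prop :=
  Differentiable ℝ ψ ∧ Differentiable ℝ (deriv ψ) ∧
    ∀ x, -(c / 6) * deriv (deriv ψ) x + p x * ψ x = 0

/-- `ψ 0` and `ψ 1` are two linearly independent solutions of Hill's equation. -/
def IsFundamentalSystem (c : ℝ) (p : ℝ → ℝ) (ψ : Fin 2 → ℝ → ℝ) : Prop :=
  (∀ i, IsHillSolution c p (ψ i)) ∧ LinearIndependent ℝ ψ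

/-- `M` is the monodromy matrix of the pair `ψ`: `ψ(x + 2π) = M ψ(x)` for all `x`. -/
def IsMonodromy (ψ : Fin 2 → ℝ → ℝ) (M : Matrix.SpecialLinearGroup (Fin 2) ℝ) : Prop :=
  ∀ x, (fun i => ψ i (x + 2 * Real.pi)) = (M : Matrix (Fin 2) (Fin 2) ℝ).mulVec (fun i => ψ i x)

/-! ### Virasoro coadjoint action -/

/-- Lift to the real line of an orientation-preserving diffeomorphism of the circle `ℝ / 2πℤ`. -/
def IsCircleDiffeo (f : ℝ → ℝ) : Prop :=
  ContDiff ℝ ∞ f ∧ (∀ x, 0 < deriv f x) ∧ ∀ x, f (x + 2 * Real.pi) = f x + 2 * Real.pi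

/-- The Schwarzian derivative `f'''/f' - (3/2) (f''/f')²`. -/
def schwarzian (f : ℝ → ℝ) (x : ℝ) : ℝ :=
  iteratedDeriv 3 f x / deriv f x - 3 / 2 * (iteratedDeriv 2 f x / deriv f x) ^ 2

/-- `p = f · q`, the coadjoint action of `f` on the profile `q` at central charge `c`. (A lift `f`
is a bijection of `ℝ`, so that the values `p (f x)` determine `p`.) -/
def IsCoadjointTransform (c : ℝ) (f q p : ℝ → ℝ) : Prop :=
  ∀ x, p (f x) = 1 / deriv f x ^ 2 * (q x + c / 12 * schwarzian f x)

/-- `p` has a rest frame with uniform value `k`: the constant `k` lies on the Virasoro coadjoint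
orbit of `p`. -/
def IsUniformRepresentative (c : ℝ) (p : ℝ → ℝ) (k : ℝ) : Prop :=
  ∃ f, IsCircleDiffeo f ∧ IsCoadjointTransform c f (fun _ => k) p

end Cnoidal

end

noncomputable section

namespace Cnoidal

/-! ### Linear differential equations on the line -/

section LinearODE

open Set

variable {E : Type*} [NormedAddCommGroup E] [NormedSpace ℝ E]

/-! After the substitution `u = K x / π`, Hill's equation is Lamé's equation `y'' = (2 ℘(z) + V) y`
on the horizontal line `z = u + i K(1 - m)`, because there `℘(z) = m sn²(u) - (m + 1)/3`
(`wp_shifted`). If `V = ℘(a)`, Hermite's function `σ(z + a) / σ(z) · exp (-ζ(a) z)` solves it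
(`hasDerivAt_deriv_lameSolution`, via the addition formula `weierstrassZeta_add_sq`).
Quasi-periodicity of `σ` makes it a Floquet solution with multiplier `exp (-2s)`, where `s = K ζ(a)
- ζ(K) a` is `floquetExponent`. The multiplier is an eigenvalue of a matrix of determinant one, so
the trace is `2 cosh 2s` (`IsMonodromy.trace_eq`). Reality and independence of `a` follow, since the
monodromy matrix is real and does not involve `a`.

The trace determines `s` only up to sign and multiples of `πi`, so the uniform value needs winding
information. A diffeomorphism `f` to the rest frame carries a solution `φ` to `φ ∘ f / √f'`, a
solution of `χ'' = (6k/c) χ` with the same multiplier (`SolvesLinear.uniformize`). If `|Im a| < K(1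
- m)`, Hermite's solution has no zero on the line, hence a logarithm, whose increment over a period
is exactly `-2s` and survives the change of frame. For a nonvanishing solution of the
constant-coefficient equation one exponential dominates, so the increment is `±2π √(6k/c)` with no
multiple of `2πi` added (`SolvesLinear.sq_of_exp`). If `|Im a| = K(1 - m)`, there is exactly one
zero per period; this forces `6k/c = -1/4` and multiplier `-1`
(`SolvesLinear.of_one_zero_per_period`), while `legendre_relation` gives `Im s = ±π/2`, so that `s²
= -π²/4`.

The formula for `℘` on the line rests on inverting the modulus. On the sides of the period rectangle
`℘` is real and obeys a real Weierstrass equation. Comparison with `1/sn²` expresses the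
half-periods by complete elliptic integrals (`BlowUpSolution.sqrt_mul_half_period`), and strict
monotonicity of `K` then identifies the roots of the cubic (`wp_half_periods`).

For `m = 0` the series sum to `ζ(z) = cot z + z/3` and `℘(z) = cot² z + 2/3`, the profile is
constant, and its solutions are exponentials, with exponent `s = (π/2) cot a`. The exceptional `V =
-1/3` is the limit `cot a → -i`. -/

/-- The terms of the Picard series of `Y' = A Y`, `Y(0) = v`. -/
def picardTerm (A : ℝ → E →L[ℝ] E) (v : E) : ℕ → ℝ → E
  | 0 => fun _ => v
  | n + 1 => fun x => ∫ s in (0 : ℝ)..x, A s (picardTerm A v n s)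

theorem continuous_picardTerm {A : ℝ → E →L[ℝ] E} (hA : Continuous A) (v : E) (n : ℕ) :
    Continuous (picardTerm A v n) := by
  induction n with
  | zero => exact continuous_const
  | succ n ih =>
    exact intervalIntegral.continuous_primitive
      (fun a b => (hA.clm_apply ih).intervalIntegrable a b) 0

theorem hasDerivAt_picardTerm_succ [CompleteSpace E] {A : ℝ → E →L[ℝ] E} (hA : Continuous A)
    (v : E) (n : ℕ) (x : ℝ) :
    HasDerivAt (picardTerm A v (n + 1)) (A x (picardTerm A v n x)) x :=
  (hA.clm_apply (continuous_picardTerm hA v n)).integral_hasStrictDerivAt 0 x |>.hasDerivAt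

theorem norm_picardTerm_le {A : ℝ → E →L[ℝ] E} {C : ℝ} (hC : ∀ t, ‖A t‖ ≤ C)
    (v : E) (n : ℕ) (x : ℝ) :
    ‖picardTerm A v n x‖ ≤ ‖v‖ * ((C * |x|) ^ n / n.factorial) := by
  have hC0 : 0 ≤ C := (norm_nonneg _).trans (hC 0)
  induction n generalizing x with
  | zero => simp [picardTerm]
  | succ n ih =>
    have h1 : ‖picardTerm A v (n + 1) x‖ ≤
        ∫ s in uIoc 0 x, (C * ‖v‖ * C ^ n / n.factorial) * |s - 0| ^ n := by
      refine (intervalIntegral.norm_integral_le_integral_norm_uIoc).trans ?_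
      refine MeasureTheory.integral_mono_of_nonneg (Filter.Eventually.of_forall fun _ =>
        norm_nonneg _) ?_ (Filter.Eventually.of_forall fun s => ?_)
      · have : Continuous fun s : ℝ => (C * ‖v‖ * C ^ n / n.factorial) * |s - 0| ^ n := by fun_prop
        exact (this.intervalIntegrable 0 x).def'
      · refine (ContinuousLinearMap.le_opNorm _ _).trans ?_
        calc ‖A s‖ * ‖picardTerm A v n s‖ ≤ C * (‖v‖ * ((C * |s|) ^ n / n.factorial)) := by
              gcongr
              · exact hC s
              · exact ih s
          _ = _ := by simp only [sub_zero]; rw [mul_pow]; ring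
    refine h1.trans (le_of_eq ?_)
    rw [MeasureTheory.integral_const_mul, integral_pow_abs_sub_uIoc, Nat.factorial_succ]
    push_cast
    rw [sub_zero, mul_pow]
    field_simp
    ring

/-- The Picard series is dominated by an exponential series, so it converges on the whole line and
can be differentiated term by term on the bounded interval around `x` used below. -/
theorem exists_linear_ode_solution [CompleteSpace E] {A : ℝ → E →L[ℝ] E} (hA : Continuous A)
    {C : ℝ} (hC : ∀ t, ‖A t‖ ≤ C) (v : E) :
    ∃ Y : ℝ → E, Y 0 = v ∧ ∀ x, HasDerivAt Y (A x (Y x)) x := by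
  have hC0 : 0 ≤ C := (norm_nonneg _).trans (hC 0)
  have hs (x : ℝ) : Summable fun n => picardTerm A v n x := by
    refine .of_norm_bounded ((Real.summable_pow_div_factorial (C * |x|)).mul_left ‖v‖)
      fun n => norm_picardTerm_le hC v n x
  refine ⟨fun x => ∑' n, picardTerm A v n x, ?_, fun x => ?_⟩
  · change ∑' n, picardTerm A v n 0 = v
    rw [tsum_eq_single 0]
    · rfl
    · intro n hn
      obtain ⟨k, rfl⟩ := Nat.exists_eq_succ_of_ne_zero hn
      simp [picardTerm]
  · have hsplit : (fun x => ∑' n, picardTerm A v n x) =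
        fun x => v + ∑' n, picardTerm A v (n + 1) x := by
      ext y
      rw [(hs y).tsum_eq_zero_add]
      rfl
    have key : HasDerivAt (fun x => ∑' n, picardTerm A v (n + 1) x)
        (∑' n, A x (picardTerm A v n x)) x := by
      refine hasDerivAt_tsum_of_isPreconnected
        (g := fun n x => picardTerm A v (n + 1) x) (g' := fun n x => A x (picardTerm A v n x))
        (u := fun n => C * (‖v‖ * ((C * (|x| + 1)) ^ n / n.factorial)))
        (t := Ioo (-(|x| + 1)) (|x| + 1)) (y₀ := x)
        (((Real.summable_pow_div_factorial _).mul_left _).mul_left _) isOpen_Ioo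
        isPreconnected_Ioo (fun n y _ => hasDerivAt_picardTerm_succ hA v n y) ?_ ?_ ?_ ?_
      · intro n y hy
        refine (ContinuousLinearMap.le_opNorm _ _).trans ?_
        have hy' : |y| ≤ |x| + 1 := (abs_lt.mpr hy).le
        have h2 := norm_picardTerm_le hC v n y
        calc ‖A y‖ * ‖picardTerm A v n y‖ ≤ C * (‖v‖ * ((C * |y|) ^ n / n.factorial)) := by
              gcongr
              exact hC y
          _ ≤ _ := by gcongr
      · exact abs_lt.mp (by linarith)
      · exact (summable_nat_add_iff 1).mpr (hs x)
      · exact abs_lt.mp (by linarith)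
    rw [← ContinuousLinearMap.map_tsum (A x) (hs x)] at key
    have h2 := key.const_add v
    rwa [← hsplit] at h2

/-- The scalar equation `y'' = q y` with bounded continuous coefficient has global solutions. -/
theorem exists_second_order_solution {q : ℝ → ℝ} (hq : Continuous q) {C : ℝ}
    (hC : ∀ t, |q t| ≤ C) (α β : ℝ) :
    ∃ y y' : ℝ → ℝ, y 0 = α ∧ y' 0 = β ∧ (∀ x, HasDerivAt y (y' x) x) ∧
      ∀ x, HasDerivAt y' (q x * y x) x := by
  -- The companion system `(y, y') ↦ (y', q y)`.
  let A : ℝ → (ℝ × ℝ) →L[ℝ] ℝ × ℝ := fun t =>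
    (ContinuousLinearMap.inl ℝ ℝ ℝ).comp (ContinuousLinearMap.snd ℝ ℝ ℝ) +
      q t • (ContinuousLinearMap.inr ℝ ℝ ℝ).comp (ContinuousLinearMap.fst ℝ ℝ ℝ)
  have hA : Continuous A := by fun_prop
  obtain ⟨Y, h0, hY⟩ := exists_linear_ode_solution hA
    (C := ‖(ContinuousLinearMap.inl ℝ ℝ ℝ).comp (ContinuousLinearMap.snd ℝ ℝ ℝ)‖ +
      C * ‖(ContinuousLinearMap.inr ℝ ℝ ℝ).comp (ContinuousLinearMap.fst ℝ ℝ ℝ)‖) (fun t => by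
        refine (norm_add_le _ _).trans ?_
        rw [norm_smul]
        gcongr
        exact hC t) (α, β)
  refine ⟨fun x => (Y x).1, fun x => (Y x).2, by simp [h0], by simp [h0], fun x => ?_, fun x => ?_⟩
  · simpa [A, Function.comp_def] using hasFDerivAt_fst.comp_hasDerivAt x (hY x)
  · simpa [A, Function.comp_def] using hasFDerivAt_snd.comp_hasDerivAt x (hY x)

/-- Grönwall's inequality for the pair `(y, y')` in the sup norm, with constant `max 1 (sup |q|)`.
-/
theorem linear_ode_eq_zero_right {q : ℝ → ℝ} {y y' : ℝ → E} {a b : ℝ}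
    (hq : ContinuousOn q (Icc a b))
    (hy : ∀ x ∈ Icc a b, HasDerivAt y (y' x) x) (hy' : ∀ x ∈ Icc a b, HasDerivAt y' (q x • y x) x)
    (h0 : y a = 0) (h0' : y' a = 0) : ∀ x ∈ Icc a b, y x = 0 ∧ y' x = 0 := by
  obtain ⟨C, hC⟩ := isCompact_Icc.exists_bound_of_continuousOn hq
  have := eq_zero_of_abs_deriv_le_mul_abs_self_of_eq_zero_right (K := max 1 C)
    (f := fun x => (y x, y' x)) (f' := fun x => (y' x, q x • y x)) (a := a) (b := b)
    (fun x hx => ((hy x hx).prodMk (hy' x hx)).continuousAt.continuousWithinAt)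
    (fun x hx => ((hy x (Ico_subset_Icc_self hx)).prodMk
      (hy' x (Ico_subset_Icc_self hx))).hasDerivWithinAt) (by simp [h0, h0']) (fun x hx => ?_)
  · intro x hx
    simpa using this x hx
  · simp only [Prod.norm_def]
    have h1 := hC x (Ico_subset_Icc_self hx)
    have hm : 0 ≤ max (‖y x‖) (‖y' x‖) := (norm_nonneg _).trans (le_max_left _ _)
    refine max_le ?_ ?_
    · calc ‖y' x‖ ≤ 1 * max (‖y x‖) (‖y' x‖) := by rw [one_mul]; exact le_max_right _ _
        _ ≤ _ := by gcongr; exact le_max_left _ _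
    · rw [norm_smul]
      calc ‖q x‖ * ‖y x‖ ≤ C * max (‖y x‖) (‖y' x‖) := by
            gcongr
            · exact (norm_nonneg _).trans h1
            · exact le_max_left _ _
        _ ≤ _ := by gcongr; exact le_max_right _ _

/-- Uniqueness for `y'' = q y` on an interval. -/
theorem linear_ode_eq_zero {q : ℝ → ℝ} {y y' : ℝ → E} {s : Set ℝ} (hs : s.OrdConnected)
    (hq : ContinuousOn q s)
    (hy : ∀ x ∈ s, HasDerivAt y (y' x) x) (hy' : ∀ x ∈ s, HasDerivAt y' (q x • y x) x) {t : ℝ}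
    (ht : t ∈ s) (h0 : y t = 0) (h0' : y' t = 0) : ∀ x ∈ s, y x = 0 ∧ y' x = 0 := by
  intro x hx
  rcases le_total t x with h | h
  · have hsub : Icc t x ⊆ s := hs.out ht hx
    exact linear_ode_eq_zero_right (hq.mono hsub) (fun z hz => hy z (hsub hz))
      (fun z hz => hy' z (hsub hz)) h0 h0' x ⟨h, le_rfl⟩
  -- To the left of `t`, reflect: `y(-z)` solves the equation with coefficient `q(-z)` and has
  -- derivative `-y'(-z)`.
  · have hsub : ∀ z ∈ Icc (-t) (-x), -z ∈ s := fun z hz =>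
      hs.out hx ht ⟨by linarith [hz.2], by linarith [hz.1]⟩
    have := linear_ode_eq_zero_right (q := fun z => q (-z)) (y := fun z => y (-z))
      (y' := fun z => -y' (-z)) (a := -t) (b := -x)
      (hq.comp continuous_neg.continuousOn hsub)
      (fun z hz => by
        simpa [Function.comp_def] using HasDerivAt.scomp z (hy (-z) (hsub z hz)) (hasDerivAt_neg z))
      (fun z hz => by
        simpa [Function.comp_def] using
          (HasDerivAt.scomp z (hy' (-z) (hsub z hz)) (hasDerivAt_neg z)).fun_neg)
      (by simpa using h0) (by simpa using h0') (-x) ⟨by linarith, le_rfl⟩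
    simpa using this

end LinearODE

/-! ### Second-order linear equations and Wronskians -/

section Wronskian

variable {𝕜 : Type*} [NontriviallyNormedField 𝕜] [NormedAlgebra ℝ 𝕜]

/-- `y'' = q y`, with `y'` the derivative of `y`. -/
structure SolvesLinear (q : ℝ → ℝ) (y y' : ℝ → 𝕜) : Prop where
  hasDerivAt : ∀ x, HasDerivAt y (y' x) x
  hasDerivAt' : ∀ x, HasDerivAt y' (q x • y x) x

variable {q : ℝ → ℝ} {y y' z z' w w' : ℝ → 𝕜}

theorem eq_of_hasDerivAt_zero {E : Type*} [NormedAddCommGroup E] [NormedSpace ℝ E] {f : ℝ → E}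
    (h : ∀ x, HasDerivAt f 0 x) (a b : ℝ) : f a = f b :=
  is_const_of_deriv_eq_zero (fun x => (h x).differentiableAt) (fun x => (h x).deriv) a b

theorem SolvesLinear.wronskian (hy : SolvesLinear q y y') (hz : SolvesLinear q z z') (a b : ℝ) :
    y a * z' a - y' a * z a = y b * z' b - y' b * z b := by
  refine eq_of_hasDerivAt_zero (f := fun x => y x * z' x - y' x * z x) (fun x => ?_) a b
  have := ((hy.hasDerivAt x).mul (hz.hasDerivAt' x)).sub ((hy.hasDerivAt' x).mul (hz.hasDerivAt x))
  refine this.congr_deriv ?_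
  simp only [Algebra.smul_def]
  ring

theorem SolvesLinear.add (hy : SolvesLinear q y y') (hz : SolvesLinear q z z') :
    SolvesLinear q (fun x => y x + z x) (fun x => y' x + z' x) where
  hasDerivAt x := (hy.hasDerivAt x).add (hz.hasDerivAt x)
  hasDerivAt' x := by
    rw [smul_add]
    exact (hy.hasDerivAt' x).add (hz.hasDerivAt' x)

theorem SolvesLinear.const_mul (hy : SolvesLinear q y y') (a : 𝕜) :
    SolvesLinear q (fun x => a * y x) (fun x => a * y' x) where
  hasDerivAt x := (hy.hasDerivAt x).const_mul a
  hasDerivAt' x := by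
    rw [← mul_smul_comm]
    exact (hy.hasDerivAt' x).const_mul a

theorem SolvesLinear.comp_add_const (hy : SolvesLinear q y y') {T : ℝ}
    (hq : ∀ x, q (x + T) = q x) : SolvesLinear q (fun x => y (x + T)) (fun x => y' (x + T)) where
  hasDerivAt x := (hy.hasDerivAt (x + T)).comp_add_const x T
  hasDerivAt' x := by
    rw [← hq]
    exact (hy.hasDerivAt' (x + T)).comp_add_const x T

theorem SolvesLinear.ofReal {y y' : ℝ → ℝ} (hy : SolvesLinear q y y') :
    SolvesLinear q (fun x => (y x : ℂ)) (fun x => (y' x : ℂ)) where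
  hasDerivAt x := (hy.hasDerivAt x).ofReal_comp
  hasDerivAt' x := by simpa using (hy.hasDerivAt' x).ofReal_comp

theorem SolvesLinear.eq_zero (hq : Continuous q) (hy : SolvesLinear q y y') {t : ℝ} (h : y t = 0)
    (h' : y' t = 0) (x : ℝ) : y x = 0 :=
  (linear_ode_eq_zero (s := Set.univ) Set.ordConnected_univ hq.continuousOn
    (fun x _ => hy.hasDerivAt x) (fun x _ => hy.hasDerivAt' x) (Set.mem_univ t) h h' x
    (Set.mem_univ x)).1

/-- Two solutions with nonzero Wronskian span the solution space. -/
theorem SolvesLinear.exists_eq_combination (hy : SolvesLinear q y y') (hz : SolvesLinear q z z')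
    (hw : SolvesLinear q w w') (h : y 0 * z' 0 - y' 0 * z 0 ≠ 0) :
    ∃ a b : 𝕜, ∀ x, w x = a * y x + b * z x := by
  -- Cramer's rule for the Cauchy data at `0`. Wronskians are constant, so all of them can be moved
  -- to `x`, where the claim is an algebraic identity.
  refine ⟨(w 0 * z' 0 - w' 0 * z 0) / (y 0 * z' 0 - y' 0 * z 0),
    (y 0 * w' 0 - y' 0 * w 0) / (y 0 * z' 0 - y' 0 * z 0), fun x => ?_⟩
  have h1 := hy.wronskian hz 0 x
  have h2 := hw.wronskian hz 0 x
  have h3 := hy.wronskian hw 0 x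
  rw [h1] at h ⊢
  rw [h2, h3, div_mul_eq_mul_div, div_mul_eq_mul_div, ← add_div, eq_div_iff h]
  ring

theorem SolvesLinear.combination_eq_zero (hy : SolvesLinear q y y') (hz : SolvesLinear q z z')
    (h : y 0 * z' 0 - y' 0 * z 0 ≠ 0) {a b : 𝕜} (hab : ∀ x, a * y x + b * z x = 0) :
    a = 0 ∧ b = 0 := by
  have h0 := hab 0
  have h1 : a * y' 0 + b * z' 0 = 0 := by
    have := ((hy.const_mul a).add (hz.const_mul b)).hasDerivAt 0
    simp only [hab] at this
    exact this.unique (hasDerivAt_const 0 0)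
  constructor
  · have : a * (y 0 * z' 0 - y' 0 * z 0) = 0 := by linear_combination z' 0 * h0 - z 0 * h1
    exact (mul_eq_zero.mp this).resolve_right h
  · have : b * (y 0 * z' 0 - y' 0 * z 0) = 0 := by linear_combination y 0 * h1 - y' 0 * h0
    exact (mul_eq_zero.mp this).resolve_right h

end Wronskian

/-! ### Hill's equation -/

section Hill

variable {c : ℝ} {p : ℝ → ℝ}

theorem IsHillSolution.solvesLinear (hc : c ≠ 0) {ψ : ℝ → ℝ} (h : IsHillSolution c p ψ) :
    SolvesLinear (fun x => 6 / c * p x) ψ (deriv ψ) where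
  hasDerivAt x := (h.1 x).hasDerivAt
  hasDerivAt' x := by
    have h1 := (h.2.1 x).hasDerivAt
    refine h1.congr_deriv ?_
    have := h.2.2 x
    simp only [smul_eq_mul]
    field_simp at this ⊢
    linear_combination -this

theorem SolvesLinear.isHillSolution (hc : c ≠ 0) {ψ ψ' : ℝ → ℝ}
    (h : SolvesLinear (fun x => 6 / c * p x) ψ ψ') : IsHillSolution c p ψ := by
  have hd : deriv ψ = ψ' := funext fun x => (h.hasDerivAt x).deriv
  refine ⟨fun x => (h.hasDerivAt x).differentiableAt, ?_, fun x => ?_⟩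
  · rw [hd]
    exact fun x => (h.hasDerivAt' x).differentiableAt
  · rw [hd, (h.hasDerivAt' x).deriv, smul_eq_mul]
    field_simp
    ring

/-- A dependence between the Cauchy data at `0` propagates, by uniqueness, to a dependence between
the functions. -/
theorem IsFundamentalSystem.wronskian_ne_zero (hc : c ≠ 0) (hp : Continuous p)
    {ψ : Fin 2 → ℝ → ℝ} (h : IsFundamentalSystem c p ψ) :
    ψ 0 0 * deriv (ψ 1) 0 - deriv (ψ 0) 0 * ψ 1 0 ≠ 0 := by
  intro hW
  have h0 := (h.1 0).solvesLinear hc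
  have h1 := (h.1 1).solvesLinear hc
  have hli : ∀ a b : ℝ, a * ψ 0 0 + b * ψ 1 0 = 0 → a * deriv (ψ 0) 0 + b * deriv (ψ 1) 0 = 0 →
      a = 0 ∧ b = 0 := by
    intro a b ha hb
    have hz := ((h0.const_mul a).add (h1.const_mul b)).eq_zero (by fun_prop) (t := 0) ha hb
    have hl := h.2
    rw [Fintype.linearIndependent_iff] at hl
    have := hl ![a, b] (by
      ext x
      simpa using hz x)
    exact ⟨by simpa using this 0, by simpa using this 1⟩
  -- If the Wronskian vanishes, these two combinations have zero Cauchy data. Independence then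
  -- makes all values and derivatives at `0` vanish, and the combination `1 · ψ 0 + 0 · ψ 1` gives
  -- the contradiction.
  have e1 := hli (ψ 1 0) (-ψ 0 0) (by ring) (by linear_combination -hW)
  have e2 := hli (deriv (ψ 1) 0) (-deriv (ψ 0) 0) (by linear_combination hW) (by ring)
  have := (hli 1 0 (by linarith [e1.2]) (by linarith [e2.2])).1
  exact one_ne_zero this

theorem exists_isFundamentalSystem (hc : c ≠ 0) (hp : Continuous p) {C : ℝ}
    (hC : ∀ x, |p x| ≤ C) : ∃ ψ, IsFundamentalSystem c p ψ := by
  have hq : Continuous fun x => 6 / c * p x := by fun_prop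
  have hb : ∀ x, |6 / c * p x| ≤ |6 / c| * C := fun x => by
    rw [abs_mul]
    gcongr
    exact hC x
  obtain ⟨y, y', hy0, hy0', hy, hy'⟩ := exists_second_order_solution hq hb 1 0
  obtain ⟨z, z', hz0, hz0', hz, hz'⟩ := exists_second_order_solution hq hb 0 1
  have sy : SolvesLinear (fun x => 6 / c * p x) y y' := ⟨hy, hy'⟩
  have sz : SolvesLinear (fun x => 6 / c * p x) z z' := ⟨hz, hz'⟩
  refine ⟨![y, z], fun i => ?_, ?_⟩
  · fin_cases i
    · exact sy.isHillSolution hc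
    · exact sz.isHillSolution hc
  · rw [LinearIndependent.pair_iff]
    intro a b hab
    refine sy.combination_eq_zero sz (by simp [hy0, hy0', hz0, hz0']) fun x => ?_
    simpa using congrFun hab x

/-- Translation by a period preserves the solution space, which gives the matrix. Its determinant is
one because translation preserves the constant nonzero Wronskian. -/
theorem existsUnique_isMonodromy (hc : c ≠ 0) (hp : Continuous p)
    (hper : ∀ x, p (x + 2 * Real.pi) = p x) {ψ : Fin 2 → ℝ → ℝ} (h : IsFundamentalSystem c p ψ) :
    ∃! M, IsMonodromy ψ M := by
  have hW := h.wronskian_ne_zero hc hp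
  have h0 := (h.1 0).solvesLinear hc
  have h1 := (h.1 1).solvesLinear hc
  have hT : ∀ x, (fun x => 6 / c * p x) (x + 2 * Real.pi) = (fun x => 6 / c * p x) x :=
    fun x => by simp only [hper]
  obtain ⟨a, b, hab⟩ := h0.exists_eq_combination h1 (h0.comp_add_const hT) hW
  obtain ⟨d, e, hde⟩ := h0.exists_eq_combination h1 (h1.comp_add_const hT) hW
  have hab' : deriv (ψ 0) (0 + 2 * Real.pi) = a * deriv (ψ 0) 0 + b * deriv (ψ 1) 0 := by
    have := (h0.comp_add_const hT).hasDerivAt 0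
    simp only [hab] at this
    exact this.unique (((h0.const_mul a).add (h1.const_mul b)).hasDerivAt 0)
  have hde' : deriv (ψ 1) (0 + 2 * Real.pi) = d * deriv (ψ 0) 0 + e * deriv (ψ 1) 0 := by
    have := (h1.comp_add_const hT).hasDerivAt 0
    simp only [hde] at this
    exact this.unique (((h0.const_mul d).add (h1.const_mul e)).hasDerivAt 0)
  have hdet : a * e - b * d = 1 := by
    have := h0.wronskian h1 (0 + 2 * Real.pi) 0
    rw [hab', hde', hab, hde] at this
    have h3 : (a * e - b * d - 1) * (ψ 0 0 * deriv (ψ 1) 0 - deriv (ψ 0) 0 * ψ 1 0) = 0 := by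
      linear_combination this
    linarith [(mul_eq_zero.mp h3).resolve_right hW]
  refine ⟨⟨!![a, b; d, e], by rw [Matrix.det_fin_two_of]; linarith⟩, fun x => ?_, fun N hN => ?_⟩
  · ext i
    fin_cases i
    · simpa [Matrix.mulVec, dotProduct, Fin.sum_univ_two] using hab x
    · simpa [Matrix.mulVec, dotProduct, Fin.sum_univ_two] using hde x
  · have r (i : Fin 2) (x : ℝ) : ψ i (x + 2 * Real.pi) = N.1 i 0 * ψ 0 x + N.1 i 1 * ψ 1 x := by
      have := congrFun (hN x) i
      simpa [Matrix.mulVec, dotProduct, Fin.sum_univ_two] using this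
    have e0 := h0.combination_eq_zero h1 hW (a := N.1 0 0 - a) (b := N.1 0 1 - b)
      (fun x => by linear_combination hab x - r 0 x)
    have e1 := h0.combination_eq_zero h1 hW (a := N.1 1 0 - d) (b := N.1 1 1 - e)
      (fun x => by linear_combination hde x - r 1 x)
    ext i j
    fin_cases i <;> fin_cases j
    · exact sub_eq_zero.mp e0.1
    · exact sub_eq_zero.mp e0.2
    · exact sub_eq_zero.mp e1.1
    · exact sub_eq_zero.mp e1.2

/-- A Floquet solution with multiplier `e^{2s}` determines the trace of the monodromy. -/
theorem IsMonodromy.trace_eq (hc : c ≠ 0) (hp : Continuous p) {ψ : Fin 2 → ℝ → ℝ}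
    (h : IsFundamentalSystem c p ψ) {M : Matrix.SpecialLinearGroup (Fin 2) ℝ}
    (hM : IsMonodromy ψ M) {φ φ' : ℝ → ℂ} (hφ : SolvesLinear (fun x => 6 / c * p x) φ φ')
    {t : ℝ} (ht : φ t ≠ 0) {s : ℂ}
    (hs : ∀ x, φ (x + 2 * Real.pi) = Complex.exp (2 * s) * φ x) :
    ((M : Matrix (Fin 2) (Fin 2) ℝ).trace : ℂ) = 2 * Complex.cosh (2 * s) := by
  have hW : (ψ 0 0 : ℂ) * (deriv (ψ 1) 0 : ℝ) - (deriv (ψ 0) 0 : ℝ) * ψ 1 0 ≠ 0 := by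
    exact_mod_cast h.wronskian_ne_zero hc hp
  have h0 := ((h.1 0).solvesLinear hc).ofReal
  have h1 := ((h.1 1).solvesLinear hc).ofReal
  obtain ⟨a, b, hab⟩ := h0.exists_eq_combination h1 hφ hW
  have r (i : Fin 2) (x : ℝ) :
      (ψ i (x + 2 * Real.pi) : ℂ) = (M.1 i 0 : ℂ) * ψ 0 x + (M.1 i 1 : ℂ) * ψ 1 x := by
    have := congrFun (hM x) i
    simp only [Matrix.mulVec, dotProduct, Fin.sum_univ_two] at this
    exact_mod_cast this
  set μ := Complex.exp (2 * s) with hμ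
  -- The coordinates `(a, b)` of the Floquet solution form a left eigenvector of `M` with eigenvalue
  -- `μ`.
  obtain ⟨e0, e1⟩ := h0.combination_eq_zero h1 hW
    (a := a * M.1 0 0 + b * M.1 1 0 - μ * a) (b := a * M.1 0 1 + b * M.1 1 1 - μ * b) (fun x => by
      have := hs x
      rw [hab, hab, r, r] at this
      linear_combination this)
  have hdet : (M.1 0 0 : ℂ) * M.1 1 1 - (M.1 0 1 : ℂ) * M.1 1 0 = 1 := by
    have := M.2
    rw [Matrix.det_fin_two] at this
    exact_mod_cast this
  have hne : a ≠ 0 ∨ b ≠ 0 := by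
    by_contra! hcon
    exact ht (by rw [hab, hcon.1, hcon.2]; ring)
  have hchar : μ ^ 2 - (M.1 0 0 + M.1 1 1 : ℂ) * μ + 1 = 0 := by
    rcases hne with ha | hb
    · refine (mul_eq_zero.mp (?_ : a * _ = 0)).resolve_left ha
      linear_combination (M.1 1 1 - μ : ℂ) * e0 - (M.1 1 0 : ℂ) * e1 - a * hdet
    · refine (mul_eq_zero.mp (?_ : b * _ = 0)).resolve_left hb
      linear_combination (M.1 0 0 - μ : ℂ) * e1 - (M.1 0 1 : ℂ) * e0 - b * hdet
  have hμ0 : μ ≠ 0 := Complex.exp_ne_zero _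
  have hinv : Complex.exp (-(2 * s)) = μ⁻¹ := Complex.exp_neg _
  rw [Complex.cosh, hinv, ← hμ, Matrix.trace_fin_two]
  push_cast
  field_simp
  linear_combination -hchar

end Hill

/-! ### Constant coefficients -/

section ConstCoeff

open Complex

/-- Differentiating gives `D' exp D = 0`. This lets increments of logarithms be compared exactly,
with no ambiguity of `2πi`. -/
theorem eq_of_exp_const {D : ℝ → ℂ} (hD : Differentiable ℝ D) {C : ℂ}
    (h : ∀ x, exp (D x) = C) (a b : ℝ) : D a = D b := by
  refine eq_of_hasDerivAt_zero (fun x => ?_) a b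
  have h1 := (hD x).hasDerivAt
  have h2 := h1.cexp
  simp only [h] at h2
  have h3 := h2.unique (hasDerivAt_const x C)
  have hC : C ≠ 0 := h x ▸ exp_ne_zero _
  rwa [(mul_eq_zero.mp h3).resolve_left hC] at h1

/-- The operator factors as `(∂ - l)(∂ + l)`, so `χ' ± l χ` solve first-order equations. Keeping
these two combinations avoids dividing by `2l`. -/
theorem SolvesLinear.exists_exp_combination {κ : ℝ} {χ χ' : ℝ → ℂ}
    (h : SolvesLinear (fun _ => κ) χ χ') {l : ℂ} (hl : l ^ 2 = κ) :
    ∃ A B : ℂ, (∀ x : ℝ, χ' x + l * χ x = A * exp (l * x)) ∧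
      ∀ x : ℝ, χ' x - l * χ x = B * exp (-l * x) := by
  have he (l : ℂ) (hl : l ^ 2 = κ) :
      ∃ A : ℂ, ∀ x : ℝ, χ' x + l * χ x = A * exp (l * x) := by
    refine ⟨χ' 0 + l * χ 0, fun x => ?_⟩
    have hc := eq_of_hasDerivAt_zero
      (f := fun x : ℝ => (χ' x + l * χ x) * exp (-l * x)) (fun x => by
        have h1 : HasDerivAt (fun x : ℝ => -l * (x : ℂ)) (-l * 1) x :=
          (hasDerivAt_id x).ofReal_comp.const_mul _
        refine (((h.hasDerivAt' x).add ((h.hasDerivAt x).const_mul l)).mul h1.cexp).congr_deriv ?_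
        simp only [real_smul, Pi.add_apply]
        linear_combination (-χ x * exp (-l * x)) * hl) x 0
    simp only [ofReal_zero, mul_zero, exp_zero, mul_one] at hc
    rw [← hc, mul_assoc, ← exp_add]
    simp
  obtain ⟨A, hA⟩ := he l hl
  obtain ⟨B, hB⟩ := he (-l) (by rw [neg_sq, hl])
  exact ⟨A, B, hA, fun x => by rw [← hB]; ring⟩

/-- With `R = (B/A) exp (-2lx)` of modulus less than one, `1 - R` stays in the slit plane. Hence `lx
+ log (1 - R)` is, up to a constant, a continuous logarithm of the solution, and the correction has
the same value at `0` and `T`. The form of `hT` also covers `B = 0`. -/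
theorem log_sub_of_dominant {G : ℝ → ℂ} (hG : Differentiable ℝ G) {l A B : ℂ} (hl : l ≠ 0)
    (h : ∀ x : ℝ, 2 * l * exp (G x) = A * exp (l * x) - B * exp (-l * x)) (hA : A ≠ 0)
    (hlt : ∀ x : ℝ, ‖B / A * exp (-(2 * l) * x)‖ < 1) {T : ℝ}
    (hT : B * exp (-(2 * l) * T) = B) : G T - G 0 = l * T := by
  set R : ℝ → ℂ := fun x => B / A * exp (-(2 * l) * x) with hR
  have hslit (x : ℝ) : 1 - R x ∈ slitPlane := by
    simpa [sub_eq_add_neg] using mem_slitPlane_of_norm_lt_one (z := -R x)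
      (by rw [norm_neg]; exact hlt x)
  have hof : Differentiable ℝ (fun x : ℝ => (x : ℂ)) := ofRealCLM.differentiable
  have hRd : Differentiable ℝ R := by
    have : Differentiable ℝ fun x : ℝ => exp (-(2 * l) * x) := (hof.const_mul _).cexp
    exact this.const_mul _
  have hD : Differentiable ℝ fun x : ℝ => G x - l * x - log (1 - R x) := by
    refine (hG.sub (hof.const_mul l)).sub fun x => ?_
    exact ((hRd x).hasDerivAt.const_sub 1 |>.clog_real (hslit x)).differentiableAt
  have key := eq_of_exp_const hD (C := A / (2 * l)) (fun x => by
    have hne : 1 - R x ≠ 0 := slitPlane_ne_zero (hslit x)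
    have hG' : exp (G x) = A / (2 * l) * exp (l * x) * (1 - R x) := by
      have e : exp (-l * x) = exp (l * x) * exp (-(2 * l) * x) := by
        rw [← exp_add]; ring_nf
      have := h x
      rw [e] at this
      simp only [hR]
      generalize exp (-(2 * l) * x) = E at this ⊢
      field_simp
      linear_combination this
    rw [exp_sub, exp_sub, exp_log hne, hG']
    field_simp [exp_ne_zero]) T 0
  have hRT : R T = R 0 := by
    simp only [hR, ofReal_zero, mul_zero, exp_zero, mul_one]
    rw [div_mul_eq_mul_div, hT]
  simp only [hRT, ofReal_zero, mul_zero] at key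
  linear_combination key

/-- The logarithmic increment over a period of a nonvanishing solution of `χ'' = κ χ`. -/
theorem SolvesLinear.sq_of_exp {κ : ℝ} {G χ' : ℝ → ℂ}
    (h : SolvesLinear (fun _ => κ) (fun x => exp (G x)) χ') (hG : Differentiable ℝ G) {s : ℂ}
    (hs : ∀ x, G (x + 2 * Real.pi) = G x + 2 * s) : s ^ 2 = Real.pi ^ 2 * κ := by
  obtain ⟨l, hl⟩ : ∃ l : ℂ, l ^ 2 = κ := IsAlgClosed.exists_pow_nat_eq (κ : ℂ) two_pos
  set μ := exp (2 * s) with hμ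
  have hshift (x : ℝ) : exp (G (x + 2 * Real.pi)) = μ * exp (G x) := by
    rw [hs, exp_add, mul_comm]
  have hshift' (x : ℝ) : χ' (x + 2 * Real.pi) = μ * χ' x := by
    have h1 := (h.hasDerivAt (x + 2 * Real.pi)).comp_add_const x (2 * Real.pi)
    simp only [hshift] at h1
    exact h1.unique ((h.hasDerivAt x).const_mul μ)
  have hμ0 : μ ≠ 0 := exp_ne_zero _
  have hG' (x : ℝ) : HasDerivAt G (χ' x / exp (G x)) x := by
    have h1 := (hG x).hasDerivAt
    have h2 := h1.cexp.unique (h.hasDerivAt x)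
    rwa [eq_div_of_mul_eq (exp_ne_zero _) ((mul_comm _ _).trans h2)] at h1
  by_cases hl0 : l = 0
  · have hκ : κ = 0 := by
      have : (κ : ℂ) = 0 := by rw [← hl, hl0]; ring
      exact_mod_cast this
    subst hκ
    have hc' (x : ℝ) : χ' x = χ' 0 :=
      eq_of_hasDerivAt_zero (fun x => by simpa using h.hasDerivAt' x) x 0
    have hχ (x : ℝ) : exp (G x) = exp (G 0) + χ' 0 * x := by
      have := eq_of_hasDerivAt_zero (f := fun x : ℝ => exp (G x) - χ' 0 * x) (fun x => by
        have h1 : HasDerivAt (fun x : ℝ => χ' 0 * (x : ℂ)) (χ' 0 * 1) x :=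
          (hasDerivAt_id x).ofReal_comp.const_mul _
        refine ((h.hasDerivAt x).sub h1).congr_deriv ?_
        rw [hc' x]; ring) x 0
      simp only [ofReal_zero, mul_zero, sub_zero] at this
      linear_combination this
    -- A nonconstant affine function is not a Floquet solution: its constant derivative would force
    -- `μ = 1`, that is, periodicity.
    have hzero : χ' 0 = 0 := by
      by_contra hne
      have h1 : μ = 1 := by
        have := hshift' 0
        rw [hc'] at this
        exact mul_right_cancel₀ hne (by linear_combination -this)
      have h2 := hshift 0
      rw [h1, hχ] at h2
      have h3 : χ' 0 * (2 * Real.pi) = 0 := by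
        push_cast at h2
        linear_combination h2
      exact hne ((mul_eq_zero.mp h3).resolve_right (by norm_cast; positivity))
    have := eq_of_hasDerivAt_zero (fun x => by simpa [hc' x, hzero] using hG' x) (0 + 2 * Real.pi) 0
    have h2 := hs 0
    have h3 : s = 0 := by linear_combination (this - h2) / 2
    simp [h3]
  · obtain ⟨A, B, hA, hB⟩ := h.exists_exp_combination hl
    have hAB (x : ℝ) : 2 * l * exp (G x) = A * exp (l * x) - B * exp (-l * x) := by
      rw [← hA, ← hB]; ring
    have hBA (x : ℝ) : 2 * -l * exp (G x) = B * exp (-l * x) - A * exp (- -l * x) := by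
      rw [neg_neg, ← hA, ← hB]; ring
    have hTA : A * exp (2 * Real.pi * l) = μ * A := by
      have h1 := hA (0 + 2 * Real.pi)
      have h2 := hA 0
      rw [hshift, hshift'] at h1
      simp only [zero_add, ofReal_mul, ofReal_ofNat, ofReal_zero, mul_zero, exp_zero, mul_one]
        at h1 h2
      rw [show l * (2 * Real.pi : ℂ) = 2 * Real.pi * l by ring] at h1
      linear_combination μ * h2 - h1
    have hTB : B * exp (-(2 * Real.pi * l)) = μ * B := by
      have h1 := hB (0 + 2 * Real.pi)
      have h2 := hB 0
      rw [hshift, hshift'] at h1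
      simp only [zero_add, ofReal_mul, ofReal_ofNat, ofReal_zero, mul_zero, exp_zero, mul_one]
        at h1 h2
      rw [show -l * (2 * Real.pi : ℂ) = -(2 * Real.pi * l) by ring] at h1
      linear_combination μ * h2 - h1
    suffices hmain : s = Real.pi * l ∨ s = -(Real.pi * l) by
      rcases hmain with h1 | h1 <;> rw [h1, ← hl] <;> ring
    have conc (l' : ℂ) (h1 : G (2 * Real.pi : ℝ) - G 0 = l' * (2 * Real.pi : ℝ)) :
        s = Real.pi * l' := by
      have := hs 0
      rw [zero_add] at this
      push_cast at h1
      linear_combination (h1 - this) / 2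
    have conc₁ := conc l
    have conc₂ : _ → s = -(Real.pi * l) := fun h1 => (conc (-l) h1).trans (by ring)
    by_cases hA0 : A = 0
    · have hB0 : B ≠ 0 := by
        rintro rfl
        have := hAB 0
        simp [hA0, hl0, exp_ne_zero] at this
      exact Or.inr (conc₂ (log_sub_of_dominant hG (neg_ne_zero.mpr hl0) hBA hB0
        (by simp [hA0]) (by simp [hA0])))
    by_cases hB0 : B = 0
    · exact Or.inl (conc₁ (log_sub_of_dominant hG hl0 hAB hA0 (by simp [hB0]) (by simp [hB0])))
    -- With both exponentials present, each has multiplier `μ`, so `exp (2πl) = exp (-2πl)`. Hence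
    -- `l` is imaginary, both exponentials have modulus one, and only `‖A‖` and `‖B‖` decide which
    -- dominates.
    have h4 : exp (-(2 * l) * (2 * Real.pi : ℝ)) = 1 := by
      have e1 : exp (2 * Real.pi * l) = μ := mul_left_cancel₀ hA0 (hTA.trans (mul_comm _ _))
      have e2 : exp (-(2 * Real.pi * l)) = μ := mul_left_cancel₀ hB0 (hTB.trans (mul_comm _ _))
      have e3 : μ * μ = 1 := by
        nth_rewrite 1 [← e1]
        rw [← e2, ← exp_add]; simp
      rw [show -(2 * l) * (2 * Real.pi : ℝ) = -(2 * Real.pi * l) + -(2 * Real.pi * l) by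
        push_cast; ring, exp_add, e2, e3]
    have hre : l.re = 0 := by
      have := congrArg (‖·‖) h4
      simp only [norm_exp, norm_one, Real.exp_eq_one_iff] at this
      simp at this
      exact this
    have hnorm (x : ℝ) : ‖exp (-(2 * l) * x)‖ = 1 := by
      rw [norm_exp]; simp [hre]
    have hnorm' (x : ℝ) : ‖exp (-(2 * -l) * x)‖ = 1 := by
      rw [norm_exp]; simp [hre]
    rcases lt_trichotomy ‖A‖ ‖B‖ with hlt | heq | hlt
    · refine Or.inr (conc₂ (log_sub_of_dominant hG (neg_ne_zero.mpr hl0) hBA hB0 (fun x => ?_) ?_))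
      · rw [norm_mul, hnorm', mul_one, norm_div]
        exact (div_lt_one (norm_pos_iff.mpr hB0)).mpr hlt
      · rw [show -(2 * -l) * (2 * Real.pi : ℝ) = -(-(2 * l) * (2 * Real.pi : ℝ)) by ring, exp_neg,
          h4]
        simp
    -- Equal amplitudes would cancel at `x = arg (B/A) / (2 Im l)`, but an exponential has no zero.
    · exfalso
      have him : l.im ≠ 0 := fun h0 => hl0 (Complex.ext hre h0)
      have hl' : l = l.im * I := by
        apply Complex.ext <;> simp [hre]
      have hBA1 : B / A = exp (arg (B / A) * I) := by
        have := norm_mul_exp_arg_mul_I (B / A)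
        rw [norm_div, heq, div_self (norm_ne_zero_iff.mpr hB0)] at this
        simpa using this.symm
      set x : ℝ := arg (B / A) / (2 * l.im) with hx
      have h5 : exp (2 * l * x) = B / A := by
        rw [hBA1]
        congr 1
        have him' : (l.im : ℂ) ≠ 0 := by exact_mod_cast him
        rw [hx, hl']
        push_cast
        simp only [mul_im, ofReal_re, I_im, mul_one, ofReal_im, I_re, mul_zero, add_zero]
        field_simp
      have h6 := hAB x
      have h7 : A * exp (l * x) - B * exp (-l * x) = 0 := by
        have : exp (l * x) = exp (2 * l * x) * exp (-l * x) := by rw [← exp_add]; ring_nf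
        rw [this, h5]
        field_simp
        ring
      rw [h7] at h6
      simp [hl0, exp_ne_zero] at h6
    · refine Or.inl (conc₁ (log_sub_of_dominant hG hl0 hAB hA0 (fun x => ?_) ?_))
      · rw [norm_mul, hnorm, mul_one, norm_div]
        exact (div_lt_one (norm_pos_iff.mpr hA0)).mpr hlt
      · rw [h4, mul_one]

/-- A nontrivial Floquet solution of `χ'' = κ χ` with exactly one zero per period. -/
theorem SolvesLinear.of_one_zero_per_period {κ : ℝ} {χ χ' : ℝ → ℂ}
    (h : SolvesLinear (fun _ => κ) χ χ') {y₀ t : ℝ} (h0 : χ y₀ = 0) (ht : χ t ≠ 0)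
    (hz : ∀ x, χ x = 0 → ∃ n : ℤ, x = y₀ + n * (2 * Real.pi)) {μ : ℂ}
    (hμ : ∀ x, χ (x + 2 * Real.pi) = μ * χ x) : κ = -1 / 4 ∧ μ = -1 := by
  obtain ⟨l, hl⟩ : ∃ l : ℂ, l ^ 2 = κ := IsAlgClosed.exists_pow_nat_eq (κ : ℂ) two_pos
  have h1 : χ (y₀ + 2 * Real.pi) = 0 := by rw [hμ, h0, mul_zero]
  by_cases hl0 : l = 0
  · exfalso
    have hκ : κ = 0 := by
      have : (κ : ℂ) = 0 := by rw [← hl, hl0]; ring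
      exact_mod_cast this
    subst hκ
    have hc' (x : ℝ) : χ' x = χ' y₀ :=
      eq_of_hasDerivAt_zero (fun x => by simpa using h.hasDerivAt' x) x y₀
    have hχ (x : ℝ) : χ x = χ' y₀ * (x - y₀) := by
      have := eq_of_hasDerivAt_zero (f := fun x : ℝ => χ x - χ' y₀ * x) (fun x => by
        have h1 : HasDerivAt (fun x : ℝ => χ' y₀ * (x : ℂ)) (χ' y₀ * 1) x :=
          (hasDerivAt_id x).ofReal_comp.const_mul _
        refine ((h.hasDerivAt x).sub h1).congr_deriv ?_
        rw [hc' x]; ring) x y₀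
      simp only [h0] at this
      linear_combination this
    rw [hχ] at h1
    have h2 : χ' y₀ = 0 := by
      refine (mul_eq_zero.mp h1).resolve_right ?_
      rw [ofReal_add, add_sub_cancel_left, ofReal_eq_zero]
      positivity
    exact ht (by rw [hχ, h2, zero_mul])
  · obtain ⟨A, B, hA, hB⟩ := h.exists_exp_combination hl
    have hAB (x : ℝ) : 2 * l * χ x = A * exp (l * x) - B * exp (-l * x) := by
      rw [← hA, ← hB]; ring
    set γ := A * exp (l * y₀) with hγ
    have hγ' : B * exp (-l * y₀) = γ := by
      have := hAB y₀
      rw [h0] at this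
      linear_combination this
    have hχ (v : ℝ) : 2 * l * χ (y₀ + v) = γ * (exp (l * v) - exp (-l * v)) := by
      rw [hAB, mul_sub]
      nth_rewrite 2 [← hγ']
      rw [hγ, mul_assoc, mul_assoc, ← exp_add, ← exp_add]
      push_cast
      ring_nf
    have hγ0 : γ ≠ 0 := by
      intro hγ0
      have := hχ (t - y₀)
      rw [hγ0, zero_mul, add_sub_cancel] at this
      simp [hl0, ht] at this
    have hzero (v : ℝ) : χ (y₀ + v) = 0 ↔ exp (2 * l * v) = 1 := by
      have e : exp (l * v) - exp (-l * v) = (exp (2 * l * v) - 1) * exp (-l * v) := by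
        rw [sub_mul, ← exp_add]; ring_nf
      have h2 := hχ v
      rw [e] at h2
      constructor
      · intro hv
        rw [hv, mul_zero, eq_comm] at h2
        simpa [hγ0, exp_ne_zero, sub_eq_zero] using h2
      · intro hv
        rw [hv, sub_self, zero_mul, mul_zero] at h2
        simpa [hl0] using h2
    obtain ⟨n, hn⟩ := exp_eq_one_iff.mp ((hzero _).mp h1)
    have hπ : (Real.pi : ℂ) ≠ 0 := by exact_mod_cast Real.pi_ne_zero
    have hln : l = n * I / 2 := by
      push_cast at hn
      have h2 : (2 * Real.pi : ℂ) * (2 * l - n * I) = 0 := by linear_combination hn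
      have := (mul_eq_zero.mp h2).resolve_left (by simp [hπ])
      linear_combination this / 2
    have hn0 : (n : ℝ) ≠ 0 := by
      rintro hn0
      have : n = 0 := by exact_mod_cast hn0
      exact hl0 (by rw [hln, this]; simp)
    have hn0' : (n : ℂ) ≠ 0 := by exact_mod_cast hn0
    -- The solution is a multiple of `sinh (l (x - y₀))` with `l = in/2`, so its zeros are spaced by
    -- `2π/|n|`. One zero per period leaves `n = ±1`.
    have h3 : χ (y₀ + 2 * Real.pi / n) = 0 := by
      rw [hzero, hln, exp_eq_one_iff]
      refine ⟨1, ?_⟩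
      push_cast
      field_simp
    obtain ⟨j, hj⟩ := hz _ h3
    have hjn : j * n = 1 := by
      have : 2 * Real.pi / n = j * (2 * Real.pi) := by linarith
      rw [div_eq_iff hn0] at this
      have h5 : (2 * Real.pi) * ((j : ℝ) * n - 1) = 0 := by linarith
      have h6 := (mul_eq_zero.mp h5).resolve_left (by positivity)
      exact_mod_cast (sub_eq_zero.mp h6)
    have hn1 : n = 1 ∨ n = -1 := Int.isUnit_iff.mp (.of_mul_eq_one_right j hjn)
    have hκ : κ = -1 / 4 := by
      have : (κ : ℂ) = -1 / 4 := by
        rw [← hl, hln]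
        rcases hn1 with rfl | rfl <;> push_cast <;> ring_nf <;> rw [I_sq] <;> ring
      exact_mod_cast this
    refine ⟨hκ, ?_⟩
    have he : exp (l * (2 * Real.pi)) = -1 ∧ exp (-l * (2 * Real.pi)) = -1 := by
      rw [hln]
      rcases hn1 with rfl | rfl
      · constructor
        · rw [← exp_pi_mul_I]; congr 1; push_cast; ring
        · rw [← exp_neg_pi_mul_I]; congr 1; push_cast; ring
      · constructor
        · rw [← exp_neg_pi_mul_I]; congr 1; push_cast; ring
        · rw [← exp_pi_mul_I]; congr 1; push_cast; ring
    have h7 := hμ t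
    have h8 := hχ (t - y₀)
    have h9 := hχ (t - y₀ + 2 * Real.pi)
    rw [show y₀ + (t - y₀ + 2 * Real.pi) = t + 2 * Real.pi by ring, h7] at h9
    rw [show y₀ + (t - y₀) = t by ring] at h8
    push_cast at h8 h9
    rw [mul_add, mul_add, exp_add, exp_add, he.1, he.2] at h9
    have h10 : 2 * l * χ t * (μ + 1) = 0 := by linear_combination h8 + h9
    have := (mul_eq_zero.mp h10).resolve_left (by simp [hl0, ht])
    linear_combination this

end ConstCoeff

/-! ### The Virasoro action on solutions of Hill's equation -/

section Virasoro

variable {c k : ℝ} {p f : ℝ → ℝ}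

theorem IsCircleDiffeo.hasDerivAt_iteratedDeriv (hf : IsCircleDiffeo f) (n : ℕ) (x : ℝ) :
    HasDerivAt (iteratedDeriv n f) (iteratedDeriv (n + 1) f x) x := by
  rw [iteratedDeriv_succ]
  exact (hf.1.differentiable_iteratedDeriv n (by exact_mod_cast WithTop.coe_lt_top _)
    x).hasDerivAt

theorem IsCircleDiffeo.hasDerivAt (hf : IsCircleDiffeo f) (x : ℝ) :
    HasDerivAt f (deriv f x) x := by
  simpa using hf.hasDerivAt_iteratedDeriv 0 x

theorem IsCircleDiffeo.hasDerivAt_deriv (hf : IsCircleDiffeo f) (x : ℝ) :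
    HasDerivAt (deriv f) (iteratedDeriv 2 f x) x := by
  simpa using hf.hasDerivAt_iteratedDeriv 1 x

theorem IsCircleDiffeo.deriv_add (hf : IsCircleDiffeo f) (x : ℝ) :
    deriv f (x + 2 * Real.pi) = deriv f x := by
  have h := (hf.hasDerivAt (x + 2 * Real.pi)).comp_add_const x (2 * Real.pi)
  simp only [hf.2.2] at h
  exact h.unique ((hf.hasDerivAt x).add_const _)

theorem IsCircleDiffeo.add_int_mul (hf : IsCircleDiffeo f) (x : ℝ) (n : ℤ) :
    f (x + n * (2 * Real.pi)) = f x + n * (2 * Real.pi) := by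
  induction n with
  | zero => simp
  | succ n ih =>
    push_cast at ih ⊢
    rw [show x + (n + 1 : ℝ) * (2 * Real.pi) = x + n * (2 * Real.pi) + 2 * Real.pi by ring,
      hf.2.2, ih]
    ring
  | pred n ih =>
    push_cast at ih ⊢
    have := hf.2.2 (x + (-n - 1 : ℝ) * (2 * Real.pi))
    rw [show x + (-n - 1 : ℝ) * (2 * Real.pi) + 2 * Real.pi = x + -n * (2 * Real.pi) by ring,
      ih] at this
    linarith

theorem IsCircleDiffeo.injective (hf : IsCircleDiffeo f) : Function.Injective f :=
  (strictMono_of_deriv_pos hf.2.1).injective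

theorem IsCircleDiffeo.surjective (hf : IsCircleDiffeo f) : Function.Surjective f := by
  intro y
  have hc : Continuous f := hf.1.continuous
  set N : ℤ := ⌈|y - f 0| / (2 * Real.pi)⌉ with hN
  have h1 : |y - f 0| ≤ N * (2 * Real.pi) := by
    rw [← div_le_iff₀ (by positivity)]
    exact Int.le_ceil _
  have h2 := hf.add_int_mul 0 N
  have h3 := hf.add_int_mul 0 (-N)
  push_cast at h3
  rw [abs_le] at h1
  obtain ⟨x, hx⟩ := mem_range_of_exists_le_of_exists_ge hc (c := y)
    ⟨_, (h3.trans_le (by linarith : _ ≤ y))⟩ ⟨_, (by linarith : y ≤ _).trans_eq h2.symm⟩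
  exact ⟨x, hx⟩

/-- `φ ↦ φ ∘ f / √f'` maps solutions of Hill's equation of `p` to those of the uniform equation. -/
theorem SolvesLinear.uniformize (hc : c ≠ 0) (hf : IsCircleDiffeo f)
    (hp : IsCoadjointTransform c f (fun _ => k) p) {φ φ' : ℝ → ℂ}
    (h : SolvesLinear (fun x => 6 / c * p x) φ φ') :
    ∃ χ', SolvesLinear (fun _ => 6 / c * k) (fun x => φ (f x) / (Real.sqrt (deriv f x) : ℂ)) χ' := by
  set r : ℝ → ℝ := fun x => Real.sqrt (deriv f x) with hr
  have hr0 (x : ℝ) : 0 < r x := Real.sqrt_pos.mpr (hf.2.1 x)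
  have hr0' (x : ℝ) : (r x : ℂ) ≠ 0 := by exact_mod_cast (hr0 x).ne'
  have hr2 (x : ℝ) : deriv f x = r x ^ 2 := (Real.sq_sqrt (hf.2.1 x).le).symm
  set f2 := iteratedDeriv 2 f with hf2
  set f3 := iteratedDeriv 3 f with hf3
  have dr (x : ℝ) : HasDerivAt (fun x => (r x : ℂ)) ((f2 x / (2 * r x) : ℝ) : ℂ) x :=
    ((hf.hasDerivAt_deriv x).sqrt (hf.2.1 x).ne').ofReal_comp
  have df2 (x : ℝ) : HasDerivAt (fun x => (f2 x : ℂ)) (f3 x) x :=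
    (hf.hasDerivAt_iteratedDeriv 2 x).ofReal_comp
  have dφ (x : ℝ) : HasDerivAt (fun x => φ (f x)) (r x ^ 2 * φ' (f x)) x := by
    have := HasDerivAt.scomp x (h.hasDerivAt (f x)) (hf.hasDerivAt x)
    refine this.congr_deriv ?_
    rw [hr2, Complex.real_smul]
    push_cast
    rfl
  have dφ' (x : ℝ) : HasDerivAt (fun x => φ' (f x))
      (r x ^ 2 * (6 / c * (1 / r x ^ 4 * (k + c / 12 * (f3 x / r x ^ 2 -
        3 / 2 * (f2 x / r x ^ 2) ^ 2))) * φ (f x))) x := by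
    have := HasDerivAt.scomp x (h.hasDerivAt' (f x)) (hf.hasDerivAt x)
    refine this.congr_deriv ?_
    have h2 := hp x
    rw [hr2, schwarzian, hr2, ← hf2, ← hf3] at h2
    rw [h2, hr2, Complex.real_smul, Complex.real_smul]
    push_cast
    ring
  refine ⟨fun x => φ' (f x) * r x - φ (f x) * f2 x / (2 * r x ^ 3), fun x => ?_, fun x => ?_⟩
  · refine ((dφ x).div (dr x) (hr0' x)).congr_deriv ?_
    have := hr0' x
    push_cast
    field_simp
  -- In the second derivative the `φ'` terms cancel. The weight `-1/2` produces exactly the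
  -- Schwarzian that cancels the one in the transformation law of `p`.
  · have hne : (2 * r x ^ 3 : ℂ) ≠ 0 := by simp [hr0' x]
    refine (((dφ' x).mul (dr x)).sub (((dφ x).mul (df2 x)).div
      (((dr x).pow 3).const_mul 2) hne)).congr_deriv ?_
    have := hr0' x
    have hc' : (c : ℂ) ≠ 0 := by exact_mod_cast hc
    rw [show Real.sqrt (deriv f x) = r x from rfl]
    simp only [Pi.mul_apply, Pi.pow_apply, Complex.real_smul]
    push_cast
    field_simp
    ring

/-- The new logarithm `g ∘ f - (1/2) log f'` has the same increment `2s`, because `f` commutes with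
translation by `2π` and `f'` is periodic. Thus `s` itself, and not just `exp (2s)`, is visible in
the rest frame. -/
theorem uniform_value_of_exp (hc : c ≠ 0) (hk : IsUniformRepresentative c p k) {g φ' : ℝ → ℂ}
    (hφ : SolvesLinear (fun x => 6 / c * p x) (fun x => Complex.exp (g x)) φ')
    (hg : Differentiable ℝ g) {s : ℂ} (hs : ∀ x, g (x + 2 * Real.pi) = g x + 2 * s) :
    (k : ℂ) = c / (6 * Real.pi ^ 2) * s ^ 2 := by
  obtain ⟨f, hf, hp⟩ := hk
  obtain ⟨χ', hχ⟩ := hφ.uniformize hc hf hp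
  have hpos := hf.2.1
  have he (x : ℝ) : Complex.exp (g (f x)) / (Real.sqrt (deriv f x) : ℂ) =
      Complex.exp (g (f x) - (Real.log (deriv f x) / 2 : ℝ)) := by
    rw [Complex.exp_sub, ← Complex.ofReal_exp, Real.sqrt_eq_rpow, Real.rpow_def_of_pos (hpos x)]
    ring_nf
  simp only [he] at hχ
  have hlog : Differentiable ℝ fun x => ((Real.log (deriv f x) / 2 : ℝ) : ℂ) := fun x =>
    (((hf.hasDerivAt_deriv x).log (hpos x).ne').div_const 2).ofReal_comp.differentiableAt
  have hG : Differentiable ℝ fun x => g (f x) - ((Real.log (deriv f x) / 2 : ℝ) : ℂ) :=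
    (hg.comp fun x => (hf.hasDerivAt x).differentiableAt).sub hlog
  have hfin := hχ.sq_of_exp hG (s := s) (fun x => by rw [hf.2.2, hs, hf.deriv_add]; ring)
  have hc' : (c : ℂ) ≠ 0 := by exact_mod_cast hc
  have hπ : (Real.pi : ℂ) ≠ 0 := by exact_mod_cast Real.pi_ne_zero
  rw [hfin]
  push_cast
  field_simp

/-- Zeros rule out a logarithm, but `f` preserves their number per period, so the multiplier is
`-1`. Among the solutions of `exp (2s) = -1`, the condition `him` selects those with `s² = -π²/4`.
-/
theorem uniform_value_of_one_zero (hc : c ≠ 0) (hk : IsUniformRepresentative c p k)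
    {φ φ' : ℝ → ℂ} (hφ : SolvesLinear (fun x => 6 / c * p x) φ φ') {x₀ t : ℝ} (h0 : φ x₀ = 0)
    (ht : φ t ≠ 0) (hz : ∀ x, φ x = 0 → ∃ n : ℤ, x = x₀ + n * (2 * Real.pi)) {s : ℂ}
    (hs : ∀ x, φ (x + 2 * Real.pi) = Complex.exp (2 * s) * φ x)
    (him : s.im = Real.pi / 2 ∨ s.im = -(Real.pi / 2)) :
    (k : ℂ) = c / (6 * Real.pi ^ 2) * s ^ 2 := by
  obtain ⟨f, hf, hp⟩ := hk
  obtain ⟨χ', hχ⟩ := hφ.uniformize hc hf hp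
  obtain ⟨y₀, hy₀⟩ := hf.surjective x₀
  obtain ⟨y, hy⟩ := hf.surjective t
  have hr (x : ℝ) : (Real.sqrt (deriv f x) : ℂ) ≠ 0 := by
    exact_mod_cast (Real.sqrt_pos.mpr (hf.2.1 x)).ne'
  obtain ⟨hκ, hμ⟩ := hχ.of_one_zero_per_period (y₀ := y₀) (t := y) (μ := Complex.exp (2 * s))
    (by simp [hy₀, h0]) (by simp [hy, ht, hr y]) (fun x hx => by
      rw [div_eq_zero_iff, or_iff_left (hr x)] at hx
      obtain ⟨n, hn⟩ := hz _ hx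
      exact ⟨n, hf.injective (by rw [hn, hf.add_int_mul, hy₀])⟩)
    (fun x => by rw [hf.2.2, hf.deriv_add, hs]; ring)
  have hre : s.re = 0 := by
    have := congrArg (‖·‖) hμ
    simp only [Complex.norm_exp, norm_neg, norm_one, Real.exp_eq_one_iff] at this
    simpa using this
  have hs2 : s ^ 2 = -(Real.pi ^ 2 / 4) := by
    have : s = s.im * Complex.I := by apply Complex.ext <;> simp [hre]
    rw [this, mul_pow, Complex.I_sq]
    rcases him with h | h <;> rw [h] <;> push_cast <;> ring
  have hk' : k = -c / 24 := by
    field_simp at hκ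
    linarith
  have hπ : (Real.pi : ℂ) ≠ 0 := by exact_mod_cast Real.pi_ne_zero
  rw [hs2, hk']
  push_cast
  field_simp
  ring

end Virasoro

/-! ### The Weierstrass zeta function -/

section Zeta

open Complex Filter Topology PeriodPair

variable (L : PeriodPair)

/-- The three terms combine into `s² / ((s - l) l²)`, of order `‖l‖⁻³`, which is summable over a
lattice of rank two. -/
theorem zetaSummand_bound {r : ℝ} (hr : 0 < r) {s : ℂ} (hs : ‖s‖ < r) {l : ℂ}
    (h : 2 * r ≤ ‖l‖) :
    ‖1 / (s - l) + 1 / l + s / l ^ 2‖ ≤ 2 * r ^ 2 * ‖l‖ ^ (-3 : ℝ) := by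
  have hl : 0 < ‖l‖ := by linarith
  have hl0 : l ≠ 0 := norm_pos_iff.mp hl
  have hsl : s - l ≠ 0 := by
    rw [sub_ne_zero]; rintro rfl; linarith
  have h1 : ‖l‖ / 2 ≤ ‖s - l‖ := by
    rw [norm_sub_rev]
    exact le_trans (by linarith) (norm_sub_norm_le l s)
  have h2 : 1 / (s - l) + 1 / l + s / l ^ 2 = s ^ 2 / ((s - l) * l ^ 2) := by
    field_simp; ring
  rw [h2, norm_div, norm_mul, norm_pow, norm_pow]
  calc ‖s‖ ^ 2 / (‖s - l‖ * ‖l‖ ^ 2) ≤ r ^ 2 / (‖l‖ / 2 * ‖l‖ ^ 2) := by gcongr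
    _ = 2 * r ^ 2 / ‖l‖ ^ 3 := by field_simp
    _ = _ := by rw [show (-3 : ℝ) = -(3 : ℕ) by norm_num, Real.rpow_neg hl.le, Real.rpow_natCast]; rfl

/-- The Weierstrass zeta function without its pole at the origin. -/
def zetaExcept (z : ℂ) : ℂ :=
  ∑' l : L.lattice, if l.1 = 0 then 0 else 1 / (z - l) + 1 / (l : ℂ) + z / (l : ℂ) ^ 2

theorem hasSumLocallyUniformly_zetaExcept :
    HasSumLocallyUniformly (fun (l : L.lattice) (z : ℂ) ↦
      if l.1 = 0 then 0 else 1 / (z - l) + 1 / (l : ℂ) + z / (l : ℂ) ^ 2) (zetaExcept L) := by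
  refine L.hasSumLocallyUniformly_aux (u := (2 * · ^ 2 * ‖·‖ ^ (-3 : ℝ))) _
    (fun _ _ ↦ (ZLattice.summable_norm_rpow _ _ (by simp; norm_num)).mul_left _) fun r hr ↦
    Filter.eventually_atTop.mpr ⟨2 * r, ?_⟩
  rintro _ h s hs l rfl
  split_ifs
  · rw [norm_zero]; positivity
  · exact zetaSummand_bound hr hs h

theorem hasDerivAt_zetaSummand {z l : ℂ} (h : z ≠ l) :
    HasDerivAt (fun z => 1 / (z - l) + 1 / l + z / l ^ 2) (-(1 / (z - l) ^ 2 - 1 / l ^ 2)) z := by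
  have h1 : z - l ≠ 0 := sub_ne_zero.mpr h
  have h2 : HasDerivAt (fun z : ℂ => (z - l)⁻¹) (-1 / (z - l) ^ 2) z :=
    ((hasDerivAt_id z).sub_const l).inv h1
  simp only [one_div]
  refine ((h2.add_const l⁻¹).add ((hasDerivAt_id z).div_const (l ^ 2))).congr_deriv ?_
  ring

theorem isOpen_compl_lattice_sdiff_zero : IsOpen (L.lattice \ {0} : Set ℂ)ᶜ :=
  L.isOpen_compl_lattice_sdiff

theorem differentiableOn_zetaExcept :
    DifferentiableOn ℂ (zetaExcept L) (L.lattice \ {0})ᶜ := by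
  refine (hasSumLocallyUniformly_zetaExcept L).hasSumLocallyUniformlyOn.differentiableOn
    (.of_forall fun s ↦ .fun_sum fun i hi ↦ ?_) (isOpen_compl_lattice_sdiff_zero L)
  split_ifs with h
  · simp
  · intro z hz
    refine (hasDerivAt_zetaSummand ?_).differentiableAt.differentiableWithinAt
    rintro rfl
    exact hz ⟨i.2, h⟩

theorem hasDerivAt_zetaExcept {z : ℂ} (hz : z ∉ (L.lattice \ {0} : Set ℂ)) :
    HasDerivAt (zetaExcept L) (-L.weierstrassPExcept 0 z) z := by
  have hU := isOpen_compl_lattice_sdiff_zero L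
  have hne {x : ℂ} (hx : x ∉ (L.lattice \ {0} : Set ℂ)) {l : L.lattice} (hl : l.1 ≠ 0) :
      x ≠ l := by
    rintro rfl
    exact hx ⟨l.2, hl⟩
  have h := ((differentiableOn_zetaExcept L).differentiableAt (hU.mem_nhds hz)).hasDerivAt
  have : Set.EqOn (deriv (zetaExcept L)) (fun z => -L.weierstrassPExcept 0 z)
      (L.lattice \ {0} : Set ℂ)ᶜ := by
    refine ((hasSumLocallyUniformly_zetaExcept L).tendstoLocallyUniformlyOn.deriv
      (.of_forall fun s ↦ ?_) hU).unique ?_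
    · refine .fun_sum fun i hi ↦ ?_
      split_ifs with h
      · simp
      · exact fun x hx =>
          (hasDerivAt_zetaSummand (hne hx h)).differentiableAt.differentiableWithinAt
    · refine (L.hasSumLocallyUniformly_weierstrassPExcept 0).tendstoLocallyUniformlyOn.neg.congr ?_
      intro s x hx
      simp only [Function.comp_apply]
      have hd : ∀ i ∈ s, HasDerivAt (fun z => if i.1 = 0 then 0 else
          1 / (z - i) + 1 / (i : ℂ) + z / (i : ℂ) ^ 2)
          (-if i.1 = 0 then 0 else (1 / (x - i) ^ 2 - 1 / (i : ℂ) ^ 2)) x := by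
        intro i _
        split_ifs with hi
        · simpa using hasDerivAt_const x (0 : ℂ)
        · exact hasDerivAt_zetaSummand (hne hx hi)
      rw [(HasDerivAt.fun_sum hd).deriv]
      simp
  rwa [this hz] at h

theorem weierstrassZeta_eq (z : ℂ) :
    weierstrassZeta L.lattice z = 1 / z + zetaExcept L z := by
  classical
  have h0 := (hasSumLocallyUniformly_zetaExcept L).hasSum (x := z)
  have h1 : HasSum (fun l : L.lattice => if l = 0 then 1 / z else 0) (1 / z) :=
    hasSum_ite_eq 0 (1 / z)
  rw [weierstrassZeta, ← (h1.add h0).tsum_eq]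
  congr with l
  by_cases hl : l = 0
  · simp [hl]
  · have : (l : ℂ) ≠ 0 := by simpa using hl
    simp [hl]

theorem hasDerivAt_weierstrassZeta {z : ℂ} (hz : z ∉ L.lattice) :
    HasDerivAt (weierstrassZeta L.lattice) (-L.weierstrassP z) z := by
  have hz0 : z ≠ 0 := by rintro rfl; exact hz (zero_mem _)
  have h1 := hasDerivAt_zetaExcept L (z := z) (fun h => hz h.1)
  have h2 := (hasDerivAt_inv hz0).add h1
  have h3 : weierstrassZeta L.lattice = fun z => z⁻¹ + zetaExcept L z := by
    ext z; rw [weierstrassZeta_eq, one_div]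
  rw [h3]
  refine h2.congr_deriv ?_
  have := L.weierstrassPExcept_add 0 z
  simp only [ZeroMemClass.coe_zero, sub_zero] at this
  rw [← this]
  simp [one_div]

theorem weierstrassZeta_neg (Λ : Submodule ℤ ℂ) (z : ℂ) :
    weierstrassZeta Λ (-z) = -weierstrassZeta Λ z := by
  rw [weierstrassZeta, weierstrassZeta, ← (Equiv.neg Λ).tsum_eq, ← tsum_neg]
  congr with l
  simp only [Equiv.neg_apply, NegMemClass.coe_neg, div_eq_mul_inv, even_two, Even.neg_pow]
  rw [show -z - -(l : ℂ) = -(z - l) by ring, inv_neg, inv_neg]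
  ring

theorem zetaExcept_neg (z : ℂ) : zetaExcept L (-z) = -zetaExcept L z := by
  have h := weierstrassZeta_neg L.lattice z
  rw [weierstrassZeta_eq, weierstrassZeta_eq] at h
  rw [div_neg] at h
  linear_combination h

theorem zetaExcept_zero : zetaExcept L 0 = 0 := by
  have := zetaExcept_neg L 0
  rw [neg_zero] at this
  linear_combination this / 2

theorem isPreconnected_compl_lattice : IsPreconnected (L.lattice : Set ℂ)ᶜ := by
  refine (Set.Countable.isConnected_compl_of_one_lt_rank (by simp) ?_).2
  exact Set.countable_coe_iff.mp (inferInstanceAs (Countable L.lattice))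

theorem isOpen_compl_lattice : IsOpen (L.lattice : Set ℂ)ᶜ := L.isClosed_lattice.isOpen_compl

theorem add_notMem_lattice {z l : ℂ} (hz : z ∉ L.lattice) (hl : l ∈ L.lattice) :
    z + l ∉ L.lattice := fun h => hz (by simpa using sub_mem h hl)

theorem weierstrassP_add_mem {l : ℂ} (hl : l ∈ L.lattice) (z : ℂ) :
    L.weierstrassP (z + l) = L.weierstrassP z := L.weierstrassP_add_coe z ⟨l, hl⟩

/-- The increment has zero derivative on the connected complement of the lattice. Its value is read
off at `-(l/2)` by oddness, so `l/2` must not be a pole. -/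
theorem weierstrassZeta_add {l : ℂ} (hl : l ∈ L.lattice) (hl2 : l / 2 ∉ L.lattice) {z : ℂ}
    (hz : z ∉ L.lattice) :
    weierstrassZeta L.lattice (z + l) =
      weierstrassZeta L.lattice z + 2 * weierstrassZeta L.lattice (l / 2) := by
  have hd {x : ℂ} (hx : x ∈ (L.lattice : Set ℂ)ᶜ) : HasDerivAt (fun x =>
      weierstrassZeta L.lattice (x + l) - weierstrassZeta L.lattice x) 0 x := by
    have h1 := (hasDerivAt_weierstrassZeta L (add_notMem_lattice L hx hl)).comp_add_const x l
    refine (h1.sub (hasDerivAt_weierstrassZeta L hx)).congr_deriv ?_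
    rw [weierstrassP_add_mem L hl]
    ring
  have h := (isOpen_compl_lattice L).is_const_of_deriv_eq_zero (isPreconnected_compl_lattice L)
    (fun x hx => (hd hx).differentiableAt.differentiableWithinAt) (fun x hx => (hd hx).deriv)
    (x := z) (y := -(l / 2)) hz (fun h => hl2 (by simpa using neg_mem h))
  rw [show -(l / 2) + l = l / 2 by ring, weierstrassZeta_neg] at h
  linear_combination h

/-- The increment is constant for every lattice vector, including those with `l/2` in the lattice;
the periodicity check in the addition formula needs all of them. -/
theorem weierstrassZeta_add_sub {l : ℂ} (hl : l ∈ L.lattice) {z w : ℂ}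
    (hz : z ∉ L.lattice) (hw : w ∉ L.lattice) :
    weierstrassZeta L.lattice (z + l) - weierstrassZeta L.lattice z =
      weierstrassZeta L.lattice (w + l) - weierstrassZeta L.lattice w := by
  have hd {x : ℂ} (hx : x ∈ (L.lattice : Set ℂ)ᶜ) : HasDerivAt (fun x =>
      weierstrassZeta L.lattice (x + l) - weierstrassZeta L.lattice x) 0 x := by
    have h1 := (hasDerivAt_weierstrassZeta L (add_notMem_lattice L hx hl)).comp_add_const x l
    refine (h1.sub (hasDerivAt_weierstrassZeta L hx)).congr_deriv ?_
    rw [weierstrassP_add_mem L hl]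
    ring
  exact (isOpen_compl_lattice L).is_const_of_deriv_eq_zero (isPreconnected_compl_lattice L)
    (fun x hx => (hd hx).differentiableAt.differentiableWithinAt) (fun x hx => (hd hx).deriv) hz hw

/-- Entire functions with the periods of a lattice are constant. -/
theorem apply_eq_apply_of_periodic {F : ℂ → ℂ} (hF : Differentiable ℂ F)
    (hper : ∀ z, ∀ l ∈ L.lattice, F (z + l) = F z) (z w : ℂ) : F z = F w :=
  hF.apply_eq_apply_of_bounded (IsZLattice.isCompact_range_of_periodic L.lattice _
    hF.continuous hper).isBounded z w

/-- Near `0` the bracket is `D(z) - 1/z` with `D(0) = 0` and `D'(0) = -℘(a)`. Its square contributes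
`1/z²`, which cancels the pole of `℘(z)`, and `-2D(z)/z → 2℘(a)`, which cancels the two remaining
terms. -/
theorem tendsto_zeta_sq_sub {a : ℂ} (ha : a ∉ L.lattice) :
    Tendsto (fun z => (weierstrassZeta L.lattice (z + a) - weierstrassZeta L.lattice z -
        weierstrassZeta L.lattice a) ^ 2 - L.weierstrassP (z + a) - L.weierstrassP z -
        L.weierstrassP a) (𝓝[≠] 0) (𝓝 0) := by
  have hE : (0 : ℂ) ∉ (L.lattice \ {0} : Set ℂ) := fun h => h.2 rfl
  set D : ℂ → ℂ := fun z =>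
    weierstrassZeta L.lattice (z + a) - weierstrassZeta L.lattice a - zetaExcept L z with hD
  have hD0 : D 0 = 0 := by simp [hD, zetaExcept_zero]
  have hDd : HasDerivAt D (-L.weierstrassP a) 0 := by
    have h1 : HasDerivAt (fun z => weierstrassZeta L.lattice (z + a)) (-L.weierstrassP a) 0 := by
      have := (hasDerivAt_weierstrassZeta L (z := 0 + a) (by rwa [zero_add])).comp_add_const 0 a
      rwa [zero_add] at this
    refine ((h1.sub_const _).sub (hasDerivAt_zetaExcept L hE)).congr_deriv ?_
    simp
  have hslope : Tendsto (fun z => D z / z) (𝓝[≠] 0) (𝓝 (-L.weierstrassP a)) := by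
    have := hDd.tendsto_slope
    refine this.congr fun z => ?_
    simp [slope_def_field, hD0]
  have hDlim : Tendsto D (𝓝[≠] 0) (𝓝 0) := by
    have := hDd.continuousAt.tendsto.mono_left (nhdsWithin_le_nhds (s := {0}ᶜ))
    rwa [hD0] at this
  have hP : Tendsto (fun z => L.weierstrassP (z + a)) (𝓝[≠] 0) (𝓝 (L.weierstrassP a)) := by
    have h1 : ContinuousAt L.weierstrassP (0 + a) := by
      rw [zero_add]
      exact (L.differentiableOn_weierstrassP.differentiableAt
        ((isOpen_compl_lattice L).mem_nhds ha)).continuousAt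
    have h2 : ContinuousAt (fun z => L.weierstrassP (z + a)) 0 :=
      h1.comp (f := fun z => z + a) (by fun_prop)
    have := h2.tendsto.mono_left (nhdsWithin_le_nhds (s := {0}ᶜ))
    rwa [zero_add] at this
  have hPE : Tendsto (L.weierstrassPExcept 0) (𝓝[≠] 0) (𝓝 0) := by
    have := ((L.differentiableOn_weierstrassPExcept 0).differentiableAt
      ((isOpen_compl_lattice_sdiff_zero L).mem_nhds hE)).continuousAt.tendsto.mono_left
        (nhdsWithin_le_nhds (s := {0}ᶜ))
    rwa [L.weierstrassPExcept_zero] at this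
  have hlim := ((((hDlim.pow 2).sub (hslope.const_mul 2)).sub hP).sub hPE).sub
    (tendsto_const_nhds (x := L.weierstrassP a))
  refine (hlim.congr' ?_).trans (le_of_eq (congrArg 𝓝 (by ring)))
  filter_upwards [self_mem_nhdsWithin] with z hz
  have hz0 : z ≠ 0 := hz
  have h1 := L.weierstrassPExcept_add 0 z
  simp only [ZeroMemClass.coe_zero, sub_zero] at h1
  rw [weierstrassZeta_eq L z, ← h1]
  simp only [hD]
  field_simp
  ring

/-- The addition formula for the zeta function. -/
theorem weierstrassZeta_add_sq {a z : ℂ} (ha : a ∉ L.lattice) (hz : z ∉ L.lattice)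
    (hza : z + a ∉ L.lattice) :
    (weierstrassZeta L.lattice (z + a) - weierstrassZeta L.lattice z -
      weierstrassZeta L.lattice a) ^ 2 =
      L.weierstrassP (z + a) + L.weierstrassP z + L.weierstrassP a := by
  classical
  set H : ℂ → ℂ := fun z => (weierstrassZeta L.lattice (z + a) - weierstrassZeta L.lattice z -
    weierstrassZeta L.lattice a) ^ 2 - L.weierstrassP (z + a) - L.weierstrassP z -
    L.weierstrassP a with hH
  -- The value `0` at the possible poles is the right one: it is the limit found in
  -- `tendsto_zeta_sq_sub`. The extended function is therefore entire and periodic, hence constant.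
  set F : ℂ → ℂ := fun z => if z ∈ L.lattice ∨ z + a ∈ L.lattice then 0 else H z with hF
  have hper (z l : ℂ) (hl : l ∈ L.lattice) : F (z + l) = F z := by
    have e1 : z + l ∈ L.lattice ↔ z ∈ L.lattice := L.lattice.add_mem_iff_left hl
    have e2 : z + l + a ∈ L.lattice ↔ z + a ∈ L.lattice := by
      rw [show z + l + a = z + a + l by ring]; exact L.lattice.add_mem_iff_left hl
    simp only [hF, e1, e2]
    split_ifs with h
    · rfl
    · push Not at h
      simp only [hH]
      rw [show z + l + a = z + a + l by ring, weierstrassP_add_mem L hl, weierstrassP_add_mem L hl]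
      have := weierstrassZeta_add_sub L hl h.1 h.2
      rw [show weierstrassZeta L.lattice (z + a + l) - weierstrassZeta L.lattice (z + l) =
        weierstrassZeta L.lattice (z + a) - weierstrassZeta L.lattice z by linear_combination -this]
  -- This symmetry exchanges the two classes of poles, `0` and `-a`, so only the pole at `0` needs a
  -- local analysis.
  have hsym (z : ℂ) : F (-a - z) = F z := by
    have e1 : -a - z ∈ L.lattice ↔ z + a ∈ L.lattice := by
      rw [show -a - z = -(z + a) by ring]; exact L.lattice.neg_mem_iff
    have e2 : -a - z + a ∈ L.lattice ↔ z ∈ L.lattice := by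
      rw [show -a - z + a = -z by ring]; exact L.lattice.neg_mem_iff
    simp only [hF, e1, e2, or_comm (a := z + a ∈ L.lattice)]
    split_ifs with h
    · rfl
    · simp only [hH]
      rw [show -a - z + a = -z by ring, show -a - z = -(z + a) by ring, weierstrassZeta_neg,
        weierstrassZeta_neg, L.weierstrassP_neg, L.weierstrassP_neg]
      ring
  have hreg {z : ℂ} (h1 : z ∉ L.lattice) (h2 : z + a ∉ L.lattice) : DifferentiableAt ℂ F z := by
    have hopen : ∀ᶠ x in 𝓝 z, F x = H x := by
      have e1 := (isOpen_compl_lattice L).mem_nhds h1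
      have e2 : ∀ᶠ x in 𝓝 z, x + a ∈ (L.lattice : Set ℂ)ᶜ :=
        (continuous_add_const a).continuousAt.eventually_mem ((isOpen_compl_lattice L).mem_nhds h2)
      filter_upwards [e1, e2] with x hx1 hx2
      exact if_neg (by rintro (h | h); exacts [hx1 h, hx2 h])
    have dP {w : ℂ} (hw : w ∉ L.lattice) : DifferentiableAt ℂ L.weierstrassP w :=
      L.differentiableOn_weierstrassP.differentiableAt ((isOpen_compl_lattice L).mem_nhds hw)
    have dZ {w : ℂ} (hw : w ∉ L.lattice) : DifferentiableAt ℂ (weierstrassZeta L.lattice) w :=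
      (hasDerivAt_weierstrassZeta L hw).differentiableAt
    refine DifferentiableAt.congr_of_eventuallyEq ?_ hopen
    have hadd : DifferentiableAt ℂ (fun z : ℂ => z + a) z := by fun_prop
    have e3 : DifferentiableAt ℂ (fun z => weierstrassZeta L.lattice (z + a)) z :=
      DifferentiableAt.comp z (g := weierstrassZeta L.lattice) (f := fun z => z + a) (dZ h2) hadd
    have e4 : DifferentiableAt ℂ (fun z => L.weierstrassP (z + a)) z :=
      DifferentiableAt.comp z (g := L.weierstrassP) (f := fun z => z + a) (dP h2) hadd
    exact (((((e3.sub (dZ h1)).sub_const _).pow 2).sub e4).sub (dP h1)).sub_const _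
  have hzero : DifferentiableAt ℂ F 0 := by
    have hpunct : ∀ᶠ x in 𝓝[≠] (0 : ℂ), x ∉ L.lattice ∧ x + a ∉ L.lattice := by
      have e1 : ∀ᶠ x in 𝓝[≠] (0 : ℂ), x ∈ (L.lattice \ {0} : Set ℂ)ᶜ :=
        nhdsWithin_le_nhds (L.compl_lattice_sdiff_singleton_mem_nhds 0)
      have e2 : ∀ᶠ x in 𝓝[≠] (0 : ℂ), x + a ∈ (L.lattice : Set ℂ)ᶜ :=
        nhdsWithin_le_nhds ((continuous_add_const a).continuousAt.eventually_mem
          ((isOpen_compl_lattice L).mem_nhds (by simpa using ha)))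
      filter_upwards [e1, e2, self_mem_nhdsWithin] with x h1 h2 h3
      exact ⟨fun h => h1 ⟨h, h3⟩, h2⟩
    refine (Complex.analyticAt_of_differentiable_on_punctured_nhds_of_continuousAt
      (hpunct.mono fun x hx => hreg hx.1 hx.2) ?_).differentiableAt
    rw [continuousAt_iff_punctured_nhds]
    have hF0 : F 0 = 0 := if_pos (Or.inl (zero_mem _))
    rw [hF0]
    refine (tendsto_zeta_sq_sub L ha).congr' ?_
    filter_upwards [hpunct] with x hx
    exact (if_neg (by rintro (h | h); exacts [hx.1 h, hx.2 h])).symm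
  have hlat {z : ℂ} (hz : z ∈ L.lattice) : DifferentiableAt ℂ F z := by
    have h1 : DifferentiableAt ℂ (fun x => F (x - z)) z := by
      refine DifferentiableAt.comp z (g := F) (f := fun x => x - z) ?_ (by fun_prop)
      rwa [sub_self]
    refine h1.congr_of_eventuallyEq (.of_forall fun x => ?_)
    simpa using hper (x - z) z hz
  have hdiff : Differentiable ℂ F := by
    intro z
    by_cases h1 : z ∈ L.lattice
    · exact hlat h1
    by_cases h2 : z + a ∈ L.lattice
    · have h3 : DifferentiableAt ℂ (fun x => F (-a - x)) z := by
        refine DifferentiableAt.comp z (g := F) (f := fun x => -a - x) (hlat ?_) (by fun_prop)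
        rw [show -a - z = -(z + a) by ring]
        exact neg_mem h2
      simpa only [hsym] using h3
    · exact hreg h1 h2
  have h0 := apply_eq_apply_of_periodic L hdiff hper z 0
  have h1 : F 0 = 0 := if_pos (Or.inl (zero_mem _))
  have h2 : F z = H z := if_neg (by rintro (h | h); exacts [hz h, hza h])
  rw [h1, h2] at h0
  linear_combination h0

end Zeta

/-! ### The Weierstrass sigma function -/

section Sigma

open Complex Filter Topology PeriodPair

variable (L : PeriodPair)

/-- The elementary factor `(1 - w) exp (w + w² / 2)`. -/
def elementaryFactorTwo (w : ℂ) : ℂ := (1 - w) * exp (w + w ^ 2 / 2)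

theorem hasDerivAt_elementaryFactorTwo (w : ℂ) :
    HasDerivAt elementaryFactorTwo (-w ^ 2 * exp (w + w ^ 2 / 2)) w := by
  have h1 : HasDerivAt (fun w : ℂ => w + w ^ 2 / 2) (1 + w) w := by
    refine ((hasDerivAt_id w).add ((hasDerivAt_pow 2 w).div_const 2)).congr_deriv ?_
    simp
  refine (((hasDerivAt_id w).const_sub 1).mul h1.cexp).congr_deriv ?_
  simp only [id]
  ring

/-- The derivative `-w² exp (w + w²/2)` vanishes to second order at `0`, and the exponent has norm
at most `1` on this disc. The mean value inequality does the rest. -/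
theorem norm_elementaryFactorTwo_sub_one_le {w : ℂ} (hw : ‖w‖ ≤ 1 / 2) :
    ‖elementaryFactorTwo w - 1‖ ≤ Real.exp 1 * ‖w‖ ^ 3 := by
  have h := (convex_closedBall (0 : ℂ) ‖w‖).norm_image_sub_le_of_norm_hasDerivWithin_le
    (f := elementaryFactorTwo) (C := Real.exp 1 * ‖w‖ ^ 2) (x := 0) (y := w)
    (fun x _ => (hasDerivAt_elementaryFactorTwo x).hasDerivWithinAt) (fun x hx => ?_)
    (by simp) (by simp)
  · have h1 : elementaryFactorTwo 0 = 1 := by simp [elementaryFactorTwo]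
    rw [h1, sub_zero] at h
    exact h.trans (le_of_eq (by ring))
  · have hx' : ‖x‖ ≤ ‖w‖ := by simpa using hx
    rw [norm_mul, norm_neg, norm_pow, mul_comm]
    gcongr
    rw [norm_exp]
    gcongr
    refine (re_le_norm _).trans ((norm_add_le _ _).trans ?_)
    rw [norm_div, norm_pow, norm_ofNat]
    nlinarith [norm_nonneg x]

/-- `σ(z) = z ∏_{l ≠ 0} (1 - z/l) exp (z/l + z²/(2l²))`; the factor at `l = 0` is one. -/
def sigma (z : ℂ) : ℂ := z * ∏' l : L.lattice, (1 + (elementaryFactorTwo (z / l) - 1))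

theorem summable_sigma_bound (R : ℝ) :
    Summable fun l : L.lattice => Real.exp 1 * R ^ 3 * ‖(l : ℂ)‖ ^ (-3 : ℝ) :=
  (ZLattice.summable_norm_rpow L.lattice _ (by simp; norm_num)).mul_left _

theorem sigma_factor_bound {R : ℝ} (hR : 0 < R) :
    ∀ᶠ l : L.lattice in cofinite, ∀ z ∈ Metric.ball (0 : ℂ) R,
      ‖elementaryFactorTwo (z / l) - 1‖ ≤ Real.exp 1 * R ^ 3 * ‖(l : ℂ)‖ ^ (-3 : ℝ) := by
  have hfin : ∀ᶠ l : L.lattice in cofinite, 2 * R ≤ ‖(l : ℂ)‖ := by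
    rw [Filter.eventually_cofinite]
    refine (isCompact_iff_finite.mp (isCompact_closedBall (0 : L.lattice) (2 * R))).subset ?_
    intro l hl
    have hl' : ‖(l : ℂ)‖ < 2 * R := lt_of_not_ge hl
    simpa using hl'.le
  filter_upwards [hfin] with l hl' z hz
  have hl0 : 0 < ‖(l : ℂ)‖ := by linarith
  have hz' : ‖z‖ ≤ R := by simpa using (mem_ball_zero_iff.mp hz).le
  have h1 : ‖z / l‖ ≤ R / ‖(l : ℂ)‖ := by rw [norm_div]; gcongr
  refine (norm_elementaryFactorTwo_sub_one_le (h1.trans ?_)).trans ?_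
  · rw [div_le_iff₀ hl0]; linarith
  · calc Real.exp 1 * ‖z / l‖ ^ 3 ≤ Real.exp 1 * (R / ‖(l : ℂ)‖) ^ 3 := by gcongr
      _ = _ := by
        rw [show (-3 : ℝ) = -(3 : ℕ) by norm_num, Real.rpow_neg hl0.le, Real.rpow_natCast]
        field_simp

theorem differentiable_sigma_factor (l : ℂ) :
    Differentiable ℂ fun z => 1 + (elementaryFactorTwo (z / l) - 1) := fun z =>
  (((hasDerivAt_elementaryFactorTwo _).differentiableAt.comp z
    (f := fun z => z / l) (by fun_prop)).sub_const 1).const_add 1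

theorem hasProdLocallyUniformlyOn_sigma {R : ℝ} (hR : 0 < R) :
    HasProdLocallyUniformlyOn
      (fun (l : L.lattice) (z : ℂ) => 1 + (elementaryFactorTwo (z / l) - 1))
      (fun z => ∏' l : L.lattice, (1 + (elementaryFactorTwo (z / l) - 1))) (Metric.ball 0 R) :=
  Summable.hasProdLocallyUniformlyOn_one_add Metric.isOpen_ball (summable_sigma_bound L R)
    (sigma_factor_bound L hR) fun l => by
      have := (differentiable_sigma_factor (l : ℂ)).continuous
      exact ((this.sub (continuous_const (y := (1 : ℂ)))).congr fun z => by simp).continuousOn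

theorem summable_sigma_factor (z : ℂ) :
    Summable fun l : L.lattice => ‖elementaryFactorTwo (z / l) - 1‖ := by
  refine (summable_sigma_bound L (‖z‖ + 1)).of_norm_bounded_eventually ?_
  filter_upwards [sigma_factor_bound L (R := ‖z‖ + 1) (by positivity)] with l hl
  rw [norm_norm]
  exact hl z (by simp)

theorem sigma_factor_ne_zero {z : ℂ} (hz : z ∉ L.lattice) (l : L.lattice) :
    1 + (elementaryFactorTwo (z / l) - 1) ≠ 0 := by
  rw [add_sub_cancel, elementaryFactorTwo]
  refine mul_ne_zero ?_ (exp_ne_zero _)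
  intro h
  by_cases hl : (l : ℂ) = 0
  · simp [hl] at h
  · have : z = l := by
      field_simp at h
      linear_combination -h
    exact hz (this ▸ l.2)

theorem sigma_ne_zero {z : ℂ} (hz : z ∉ L.lattice) : sigma L z ≠ 0 :=
  mul_ne_zero (by rintro rfl; exact hz (zero_mem _))
    (tprod_one_add_ne_zero_of_summable (sigma_factor_ne_zero L hz) (summable_sigma_factor L z))

theorem sigma_eq_zero {z : ℂ} (hz : z ∈ L.lattice) : sigma L z = 0 := by
  by_cases h0 : z = 0
  · simp [sigma, h0]
  · refine mul_eq_zero_of_right _ (tprod_of_exists_eq_zero ⟨⟨z, hz⟩, ?_⟩)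
    simp [elementaryFactorTwo, h0]

theorem differentiable_sigmaProd :
    Differentiable ℂ fun z => ∏' l : L.lattice, (1 + (elementaryFactorTwo (z / l) - 1)) := by
  intro z
  have hR : 0 < ‖z‖ + 1 := by positivity
  refine ((hasProdLocallyUniformlyOn_sigma L hR).differentiableOn (.of_forall fun s => ?_)
    Metric.isOpen_ball).differentiableAt (Metric.isOpen_ball.mem_nhds (by simp))
  simpa [Finset.prod_fn] using DifferentiableOn.finsetProd
    (fun (l : L.lattice) _ => (differentiable_sigma_factor (l : ℂ)).differentiableOn)

theorem differentiable_sigma : Differentiable ℂ (sigma L) :=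
  differentiable_id.mul (differentiable_sigmaProd L)

theorem logDeriv_sigma_factor {z l : ℂ} (h : z ≠ l) :
    logDeriv (fun z => 1 + (elementaryFactorTwo (z / l) - 1)) z =
      if l = 0 then 0 else 1 / (z - l) + 1 / l + z / l ^ 2 := by
  split_ifs with hl
  · simp [hl, logDeriv]
  · have hd := HasDerivAt.comp z (h := fun z => z / l) (hasDerivAt_elementaryFactorTwo (z / l))
      ((hasDerivAt_id z).div_const l)
    have hd' : HasDerivAt (fun z => 1 + (elementaryFactorTwo (z / l) - 1)) _ z :=
      (hd.sub_const 1).const_add 1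
    have hzl : z - l ≠ 0 := sub_ne_zero.mpr h
    have hlz : l - z ≠ 0 := sub_ne_zero.mpr h.symm
    rw [logDeriv_apply, hd'.deriv]
    simp only [add_sub_cancel, elementaryFactorTwo]
    generalize hE : exp (z / l + (z / l) ^ 2 / 2) = E
    have hE0 : E ≠ 0 := hE ▸ exp_ne_zero _
    rw [show 1 - z / l = (l - z) / l by field_simp]
    field_simp
    ring

/-- Termwise logarithmic differentiation of the product gives `zetaExcept`, and the factor `z`
contributes the missing `1/z`. -/
theorem hasDerivAt_sigma {z : ℂ} (hz : z ∉ L.lattice) :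
    HasDerivAt (sigma L) (weierstrassZeta L.lattice z * sigma L z) z := by
  have hz0 : z ≠ 0 := by rintro rfl; exact hz (zero_mem _)
  have hR : 0 < ‖z‖ + 1 := by positivity
  have hne : ∏' l : L.lattice, (1 + (elementaryFactorTwo (z / l) - 1)) ≠ 0 :=
    tprod_one_add_ne_zero_of_summable (sigma_factor_ne_zero L hz) (summable_sigma_factor L z)
  have hfac (l : L.lattice) := logDeriv_sigma_factor (z := z) (l := l)
    (by rintro rfl; exact hz l.2)
  have hsum := (hasSumLocallyUniformly_zetaExcept L).hasSum (x := z)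
  have h := logDeriv_tprod_eq_tsum (s := Metric.ball 0 (‖z‖ + 1)) Metric.isOpen_ball (x := z)
    (by simp) (f := fun (l : L.lattice) z => 1 + (elementaryFactorTwo (z / l) - 1))
    (sigma_factor_ne_zero L hz) (fun l => (differentiable_sigma_factor (l : ℂ)).differentiableOn)
    (by simpa only [hfac] using hsum.summable)
    (hasProdLocallyUniformlyOn_sigma L hR).multipliableLocallyUniformlyOn hne
  simp only [hfac] at h
  rw [hsum.tsum_eq, logDeriv_apply, div_eq_iff hne] at h
  have hd := ((hasDerivAt_id z).mul (differentiable_sigmaProd L z).hasDerivAt)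
  rw [h] at hd
  refine hd.congr_deriv ?_
  rw [weierstrassZeta_eq, sigma]
  simp only [id]
  field_simp

/-- Quasi-periodicity of the sigma function. -/
theorem exists_sigma_add {l : ℂ} (hl : l ∈ L.lattice) (hl2 : l / 2 ∉ L.lattice) :
    ∃ C : ℂ, ∀ z, sigma L (z + l) =
      C * exp (2 * weierstrassZeta L.lattice (l / 2) * z) * sigma L z := by
  set η := weierstrassZeta L.lattice (l / 2)
  -- The logarithmic derivatives of `σ(x + l)` and `σ(x)` differ by the constant `2η`.
  have hd {x : ℂ} (hx : x ∈ (L.lattice : Set ℂ)ᶜ) :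
      HasDerivAt (fun x => sigma L (x + l) / (exp (2 * η * x) * sigma L x)) 0 x := by
    have h1 := (hasDerivAt_sigma L (add_notMem_lattice L hx hl)).comp_add_const x l
    have h2 := ((hasDerivAt_id x).const_mul (2 * η)).cexp
    have h3 := sigma_ne_zero L hx
    refine (h1.div (h2.mul (hasDerivAt_sigma L hx)) (mul_ne_zero (exp_ne_zero _) h3)).congr_deriv ?_
    rw [weierstrassZeta_add L hl hl2 hx]
    simp only [id, Pi.mul_apply]
    rw [div_eq_zero_iff]
    left
    ring
  refine ⟨sigma L (-(l / 2) + l) / (exp (2 * η * -(l / 2)) * sigma L (-(l / 2))), fun z => ?_⟩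
  by_cases hz : z ∈ L.lattice
  · rw [sigma_eq_zero L hz, sigma_eq_zero L (add_mem hz hl), mul_zero]
  · have h := (isOpen_compl_lattice L).is_const_of_deriv_eq_zero (isPreconnected_compl_lattice L)
      (fun x hx => (hd hx).differentiableAt.differentiableWithinAt) (fun x hx => (hd hx).deriv)
      (x := z) (y := -(l / 2)) hz (fun h => hl2 (by simpa using neg_mem h))
    have h3 := sigma_ne_zero L hz
    rw [← h]
    field_simp [exp_ne_zero]

/-! ### Lamé's equation -/

/-- Hermite's solution `σ(z + a) / σ(z) · exp (-ζ(a) z)` of Lamé's equation. -/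
def lameSolution (a z : ℂ) : ℂ :=
  sigma L (z + a) / sigma L z * exp (-weierstrassZeta L.lattice a * z)

theorem lameSolution_eq_zero_iff {a z : ℂ} (hz : z ∉ L.lattice) :
    lameSolution L a z = 0 ↔ z + a ∈ L.lattice := by
  have h3 := sigma_ne_zero L hz
  simp only [lameSolution, mul_eq_zero, div_eq_zero_iff, h3, exp_ne_zero, or_false]
  exact ⟨fun h => by by_contra hc; exact sigma_ne_zero L hc h, sigma_eq_zero L⟩

/-- The constant of quasi-periodicity cancels in `σ(z + a) / σ(z)`; the arguments `z + a` and `z`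
leave the factor `exp (2ηa)`. -/
theorem lameSolution_add {l a z : ℂ} (hl : l ∈ L.lattice) (hl2 : l / 2 ∉ L.lattice)
    (hz : z ∉ L.lattice) :
    lameSolution L a (z + l) = exp (2 * weierstrassZeta L.lattice (l / 2) * a -
      l * weierstrassZeta L.lattice a) * lameSolution L a z := by
  obtain ⟨C, hC⟩ := exists_sigma_add L hl hl2
  have h1 := sigma_ne_zero L hz
  have h2 := sigma_ne_zero L (add_notMem_lattice L hz hl)
  rw [hC] at h2
  have hC0 : C ≠ 0 := by rintro rfl; simp at h2
  rw [lameSolution, lameSolution, show z + l + a = z + a + l by ring, hC, hC]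
  set η := weierstrassZeta L.lattice (l / 2)
  set ζ := weierstrassZeta L.lattice a
  rw [show exp (2 * η * (z + a)) = exp (2 * η * z) * exp (2 * η * a) by rw [← exp_add]; ring_nf,
    show exp (-ζ * (z + l)) = exp (-ζ * z) * exp (-(l * ζ)) by rw [← exp_add]; ring_nf,
    sub_eq_add_neg, exp_add]
  field_simp [exp_ne_zero]

theorem differentiableAt_lameSolution {a z : ℂ} (hz : z ∉ L.lattice) :
    DifferentiableAt ℂ (lameSolution L a) z := by
  have h1 : DifferentiableAt ℂ (fun z => sigma L (z + a)) z :=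
    DifferentiableAt.comp z (g := sigma L) (f := fun z => z + a) (differentiable_sigma L _)
      (by fun_prop)
  exact (h1.div (differentiable_sigma L z) (sigma_ne_zero L hz)).mul (by fun_prop)

theorem analyticAt_lameSolution {a z : ℂ} (hz : z ∉ L.lattice) :
    AnalyticAt ℂ (lameSolution L a) z :=
  DifferentiableOn.analyticAt (s := (L.lattice : Set ℂ)ᶜ)
    (fun _ hx => (differentiableAt_lameSolution L hx).differentiableWithinAt)
    ((isOpen_compl_lattice L).mem_nhds hz)

theorem hasDerivAt_lameSolution {a z : ℂ} (hz : z ∉ L.lattice) (hza : z + a ∉ L.lattice) :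
    HasDerivAt (lameSolution L a) ((weierstrassZeta L.lattice (z + a) -
      weierstrassZeta L.lattice z - weierstrassZeta L.lattice a) * lameSolution L a z) z := by
  have h1 := (hasDerivAt_sigma L hza).comp_add_const z a
  have h2 := ((hasDerivAt_id z).const_mul (-weierstrassZeta L.lattice a)).cexp
  have h3 := sigma_ne_zero L hz
  refine ((h1.div (hasDerivAt_sigma L hz) h3).mul h2).congr_deriv ?_
  rw [lameSolution]
  simp only [id, Pi.div_apply]
  field_simp
  ring

/-- The logarithmic derivative `v = ζ(z + a) - ζ(z) - ζ(a)` satisfies `v' + v² = 2℘(z) + ℘(a)`, by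
the addition formula. -/
theorem hasDerivAt_deriv_lameSolution {a z : ℂ} (ha : a ∉ L.lattice) (hz : z ∉ L.lattice) :
    HasDerivAt (deriv (lameSolution L a))
      ((2 * L.weierstrassP z + L.weierstrassP a) * lameSolution L a z) z := by
  have hgen {x : ℂ} (hx : x ∉ L.lattice) (hxa : x + a ∉ L.lattice) :
      deriv (deriv (lameSolution L a)) x =
        (2 * L.weierstrassP x + L.weierstrassP a) * lameSolution L a x := by
    have hev : deriv (lameSolution L a) =ᶠ[𝓝 x] fun z => (weierstrassZeta L.lattice (z + a) -
        weierstrassZeta L.lattice z - weierstrassZeta L.lattice a) * lameSolution L a z := by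
      have e1 := (isOpen_compl_lattice L).mem_nhds hx
      have e2 : ∀ᶠ y in 𝓝 x, y + a ∈ (L.lattice : Set ℂ)ᶜ :=
        (continuous_add_const a).continuousAt.eventually_mem ((isOpen_compl_lattice L).mem_nhds hxa)
      filter_upwards [e1, e2] with y hy1 hy2
      exact (hasDerivAt_lameSolution L hy1 hy2).deriv
    have h1 := (hasDerivAt_weierstrassZeta L hxa).comp_add_const x a
    have h2 := hasDerivAt_weierstrassZeta L hx
    have h3 : HasDerivAt (fun z => (weierstrassZeta L.lattice (z + a) -
        weierstrassZeta L.lattice z - weierstrassZeta L.lattice a) * lameSolution L a z) _ x :=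
      ((h1.sub h2).sub_const _).mul (hasDerivAt_lameSolution L hx hxa)
    rw [hev.deriv_eq, h3.deriv]
    have := weierstrassZeta_add_sq L ha hx hxa
    simp only [Pi.sub_apply]
    linear_combination lameSolution L a x * this
  have han := (analyticAt_lameSolution L (a := a) hz).deriv
  -- At the zeros of Hermite's solution `v` has a pole, but both sides are continuous there and
  -- agree on a punctured neighbourhood.
  have key : deriv (deriv (lameSolution L a)) z =
      (2 * L.weierstrassP z + L.weierstrassP a) * lameSolution L a z := by
    have c1 : Tendsto (deriv (deriv (lameSolution L a))) (𝓝[≠] z)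
        (𝓝 (deriv (deriv (lameSolution L a)) z)) :=
      han.deriv.continuousAt.tendsto.mono_left nhdsWithin_le_nhds
    have c2 : ContinuousAt (fun z => (2 * L.weierstrassP z + L.weierstrassP a) *
        lameSolution L a z) z := by
      have := (L.differentiableOn_weierstrassP.differentiableAt
        ((isOpen_compl_lattice L).mem_nhds hz)).continuousAt
      exact ((this.const_mul 2).add_const _).mul (differentiableAt_lameSolution L hz).continuousAt
    have c3 := c2.tendsto.mono_left (nhdsWithin_le_nhds (s := {z}ᶜ))
    refine tendsto_nhds_unique c1 (c3.congr' ?_)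
    have e1 := nhdsWithin_le_nhds (s := {z}ᶜ) ((isOpen_compl_lattice L).mem_nhds hz)
    have e2 : ∀ᶠ y in 𝓝[≠] z, y + a ∉ L.lattice := by
      have e3 : ∀ᶠ y in 𝓝 z, y + a ∈ (L.lattice \ {z + a} : Set ℂ)ᶜ :=
        (continuous_add_const a).continuousAt.eventually_mem
          (L.compl_lattice_sdiff_singleton_mem_nhds (z + a))
      filter_upwards [nhdsWithin_le_nhds e3, self_mem_nhdsWithin] with y hy1 hy2 hy3
      exact hy1 ⟨hy3, fun h => hy2 (by simpa using h)⟩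
    filter_upwards [e1, e2] with y hy1 hy2
    exact (hgen hy1 hy2).symm
  rw [← key]
  exact han.differentiableAt.hasDerivAt

end Sigma

/-! ### Rectangular lattices -/

section Rect

open Complex Filter Topology PeriodPair MeasureTheory
open scoped ComplexConjugate

/-- The rectangular lattice with half-periods `w` and `i w'`. -/
def rectPair (w w' : ℝ) (hw : 0 < w) (hw' : 0 < w') : PeriodPair where
  ω₁ := ((2 * w : ℝ) : ℂ)
  ω₂ := ((2 * w' : ℝ) : ℂ) * I
  indep := by
    rw [LinearIndependent.pair_iff]
    intro s t h
    have h1 := congrArg re h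
    have h2 := congrArg im h
    simp at h1 h2
    exact ⟨h1.resolve_right hw.ne', h2.resolve_right hw'.ne'⟩

variable {w w' : ℝ} (hw : 0 < w) (hw' : 0 < w')

local notation "Λ" => PeriodPair.lattice (rectPair w w' hw hw')
local notation "𝔭" => PeriodPair.weierstrassP (rectPair w w' hw hw')
local notation "ζ" => weierstrassZeta (PeriodPair.lattice (rectPair w w' hw hw'))

theorem mem_rectPair_lattice {z : ℂ} :
    z ∈ Λ ↔ ∃ j k : ℤ, z.re = 2 * w * j ∧ z.im = 2 * w' * k := by
  rw [mem_lattice]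
  refine exists₂_congr fun j k => ?_
  rw [Complex.ext_iff]
  simp [rectPair, eq_comm, mul_comm]

theorem two_mul_half_period_mem : ((2 * w : ℝ) : ℂ) ∈ Λ := (rectPair w w' hw hw').ω₁_mem_lattice

theorem two_mul_half_period_I_mem : ((2 * w' : ℝ) : ℂ) * I ∈ Λ :=
  (rectPair w w' hw hw').ω₂_mem_lattice

theorem notMem_of_im {z : ℂ} (h0 : 0 < z.im) (h1 : z.im < 2 * w') : z ∉ Λ := by
  rw [mem_rectPair_lattice]
  rintro ⟨j, k, -, hk⟩
  rw [hk] at h0 h1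
  have e1 : (0 : ℝ) < k := by
    by_contra! h; nlinarith
  have e2 : (k : ℝ) < 1 := by
    by_contra! h; nlinarith
  have e1' : 0 < k := by exact_mod_cast e1
  have e2' : k < 1 := by exact_mod_cast e2
  omega

theorem notMem_of_re {z : ℂ} (h0 : 0 < z.re) (h1 : z.re < 2 * w) : z ∉ Λ := by
  rw [mem_rectPair_lattice]
  rintro ⟨j, k, hk, -⟩
  rw [hk] at h0 h1
  have e1 : (0 : ℝ) < j := by
    by_contra! h; nlinarith
  have e2 : (j : ℝ) < 1 := by
    by_contra! h; nlinarith
  have e1' : 0 < j := by exact_mod_cast e1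
  have e2' : j < 1 := by exact_mod_cast e2
  omega

theorem half_period_notMem : (w : ℂ) ∉ Λ :=
  notMem_of_re hw hw' (by simpa) (by simp; linarith)

theorem half_period_I_notMem : (w' : ℂ) * I ∉ Λ :=
  notMem_of_im hw hw' (by simpa) (by simp; linarith)

theorem conj_mem {z : ℂ} (hz : z ∈ Λ) : conj z ∈ Λ := by
  rw [mem_rectPair_lattice] at hz ⊢
  obtain ⟨j, k, h1, h2⟩ := hz
  exact ⟨j, -k, by simpa using h1, by simp [h2]⟩

theorem conj_mem_iff {z : ℂ} : conj z ∈ Λ ↔ z ∈ Λ :=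
  ⟨fun h => by simpa using conj_mem hw hw' h, conj_mem hw hw'⟩

/-- Complex conjugation of the lattice. -/
def conjLattice : Λ ≃ Λ where
  toFun l := ⟨conj l.1, conj_mem hw hw' l.2⟩
  invFun l := ⟨conj l.1, conj_mem hw hw' l.2⟩
  left_inv l := by simp
  right_inv l := by simp

theorem conj_weierstrassP (z : ℂ) : conj (𝔭 z) = 𝔭 (conj z) := by
  rw [PeriodPair.weierstrassP, PeriodPair.weierstrassP, conj_tsum,
    ← (conjLattice hw hw').tsum_eq]
  congr with l
  simp [conjLattice]

theorem conj_weierstrassZeta (z : ℂ) : conj (ζ z) = ζ (conj z) := by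
  rw [weierstrassZeta, weierstrassZeta, conj_tsum, ← (conjLattice hw hw').tsum_eq]
  congr with l
  simp [conjLattice]

theorem zeta_add_period {z : ℂ} (hz : z ∉ Λ) : ζ (z + (2 * w : ℝ)) = ζ z + 2 * ζ w := by
  have := weierstrassZeta_add _ (two_mul_half_period_mem hw hw')
    (by simpa using half_period_notMem hw hw') hz
  simpa using this

theorem zeta_add_period_I {z : ℂ} (hz : z ∉ Λ) :
    ζ (z + (2 * w' : ℝ) * I) = ζ z + 2 * ζ (w' * I) := by
  have e : ((2 * w' : ℝ) : ℂ) * I / 2 = w' * I := by push_cast; ring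
  have := weierstrassZeta_add _ (two_mul_half_period_I_mem hw hw')
    (by rw [e]; exact half_period_I_notMem hw hw') hz
  rwa [e] at this

theorem wp_add_period (z : ℂ) : 𝔭 (z + (2 * w : ℝ)) = 𝔭 z :=
  weierstrassP_add_mem _ (two_mul_half_period_mem hw hw') z

theorem wp_add_period_I (z : ℂ) : 𝔭 (z + (2 * w' : ℝ) * I) = 𝔭 z :=
  weierstrassP_add_mem _ (two_mul_half_period_I_mem hw hw') z

theorem continuousAt_wp {z : ℂ} (hz : z ∉ Λ) : ContinuousAt 𝔭 z :=
  ((PeriodPair.differentiableOn_weierstrassP _).differentiableAt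
    ((isOpen_compl_lattice _).mem_nhds hz)).continuousAt

theorem continuousAt_zeta {z : ℂ} (hz : z ∉ Λ) : ContinuousAt ζ z :=
  (hasDerivAt_weierstrassZeta _ hz).continuousAt

theorem continuous_zeta_line {z : ℂ} (h0 : 0 < z.im) (h1 : z.im < 2 * w') :
    Continuous fun u : ℝ => ζ (u + z) := by
  rw [continuous_iff_continuousAt]
  intro u
  have hu : (u : ℂ) + z ∉ Λ := notMem_of_im hw hw' (by simpa) (by simpa)
  exact ContinuousAt.comp (f := fun u : ℝ => (u : ℂ) + z) (continuousAt_zeta hw hw' hu)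
    (by fun_prop)

theorem hasDerivAt_zeta_line {z : ℂ} (h0 : 0 < z.im) (h1 : z.im < 2 * w') (u : ℝ) :
    HasDerivAt (fun u : ℝ => ζ (u + z)) (-𝔭 (u + z)) u := by
  have hu : (u : ℂ) + z ∉ Λ := notMem_of_im hw hw' (by simpa) (by simpa)
  exact ((hasDerivAt_weierstrassZeta _ hu).comp_add_const (u : ℂ) z).comp_ofReal

theorem integral_wp_line {z : ℂ} (h0 : 0 < z.im) (h1 : z.im < 2 * w') :
    ∫ u in (0 : ℝ)..2 * w, -𝔭 (u + z) = 2 * ζ w := by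
  have hc : Continuous fun u : ℝ => -𝔭 (u + z) := by
    rw [continuous_iff_continuousAt]
    intro u
    have hu : (u : ℂ) + z ∉ Λ := notMem_of_im hw hw' (by simpa) (by simpa)
    exact (ContinuousAt.comp (f := fun u : ℝ => (u : ℂ) + z) (continuousAt_wp hw hw' hu)
      (by fun_prop)).neg
  rw [intervalIntegral.integral_eq_sub_of_hasDerivAt
    (fun u _ => hasDerivAt_zeta_line hw hw' h0 h1 u) (hc.intervalIntegrable _ _)]
  have hz : z ∉ Λ := notMem_of_im hw hw' h0 h1
  have := zeta_add_period hw hw' hz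
  rw [add_comm z] at this
  rw [this, ofReal_zero, zero_add]
  ring

/-- The increment of the integral of `ζ` over a horizontal period. -/
theorem integral_zeta_line_sub {z₁ z₂ : ℂ} (h10 : 0 < z₁.im) (h11 : z₁.im < 2 * w')
    (h20 : 0 < z₂.im) (h21 : z₂.im < 2 * w') :
    (∫ u in (0 : ℝ)..2 * w, ζ (u + z₂)) - ∫ u in (0 : ℝ)..2 * w, ζ (u + z₁) =
      2 * ζ w * (z₂ - z₁) := by
  have him {s : ℝ} (hs : s ∈ Set.Icc (0 : ℝ) 1) :
      0 < (z₁ + s * (z₂ - z₁)).im ∧ (z₁ + s * (z₂ - z₁)).im < 2 * w' := by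
    have e : (z₁ + s * (z₂ - z₁)).im = (1 - s) * z₁.im + s * z₂.im := by simp; ring
    rw [e]
    obtain ⟨hs0, hs1⟩ := hs
    rcases hs0.eq_or_lt with rfl | hs0
    · simp [h10, h11]
    · constructor <;> nlinarith
  have hnot {s : ℝ} (hs : s ∈ Set.Icc (0 : ℝ) 1) (u : ℝ) : (u : ℂ) + (z₁ + s * (z₂ - z₁)) ∉ Λ := by
    have := him hs
    exact notMem_of_im hw hw' (by rw [add_im, ofReal_im, zero_add]; exact this.1)
      (by rw [add_im, ofReal_im, zero_add]; exact this.2)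
  have hcont : ContinuousOn (Function.uncurry fun u s : ℝ =>
      -𝔭 (u + (z₁ + s * (z₂ - z₁))) * (z₂ - z₁)) (Set.uIcc 0 (2 * w) ×ˢ Set.uIcc 0 1) := by
    rintro ⟨u, s⟩ ⟨-, hs⟩
    rw [Set.uIcc_of_le zero_le_one] at hs
    refine ContinuousAt.continuousWithinAt ?_
    have h1 := ContinuousAt.comp (f := fun p : ℝ × ℝ => (p.1 : ℂ) + (z₁ + p.2 * (z₂ - z₁)))
      (x := (u, s)) (continuousAt_wp hw hw' (hnot hs u)) (by fun_prop)
    exact h1.neg.mul continuousAt_const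
  have hint : IntegrableOn (Function.uncurry fun u s : ℝ =>
      -𝔭 (u + (z₁ + s * (z₂ - z₁))) * (z₂ - z₁)) (Set.uIoc 0 (2 * w) ×ˢ Set.uIoc 0 1) :=
    (hcont.integrableOn_compact (isCompact_uIcc.prod isCompact_uIcc)).mono_set
      (Set.prod_mono Set.uIoc_subset_uIcc Set.uIoc_subset_uIcc)
  -- Fubini for `-℘` over the parallelogram. Integrating first across gives the difference of the
  -- `ζ` integrals; integrating first along a period gives `2ζ(w)(z₂ - z₁)` for every `s`.
  have hswap := intervalIntegral_intervalIntegral_swap hint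
  have hleft (u : ℝ) : ∫ s in (0 : ℝ)..1, -𝔭 (u + (z₁ + s * (z₂ - z₁))) * (z₂ - z₁) =
      ζ (u + z₂) - ζ (u + z₁) := by
    rw [intervalIntegral.integral_eq_sub_of_hasDerivAt
      (f := fun s : ℝ => ζ (u + (z₁ + s * (z₂ - z₁))))]
    · simp
    · intro s hs
      rw [Set.uIcc_of_le zero_le_one] at hs
      have h1 : HasDerivAt (fun s : ℝ => (u : ℂ) + (z₁ + s * (z₂ - z₁))) (z₂ - z₁) s := by
        have := (((hasDerivAt_id s).ofReal_comp.mul_const (z₂ - z₁)).const_add z₁).const_add (u : ℂ)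
        simpa using this
      exact (hasDerivAt_weierstrassZeta _ (hnot hs u)).comp s h1
    · refine ContinuousOn.intervalIntegrable fun s hs => ContinuousAt.continuousWithinAt ?_
      rw [Set.uIcc_of_le zero_le_one] at hs
      have h1 := ContinuousAt.comp (f := fun s : ℝ => (u : ℂ) + (z₁ + s * (z₂ - z₁)))
        (x := s) (continuousAt_wp hw hw' (hnot hs u)) (by fun_prop)
      exact h1.neg.mul continuousAt_const
  have hright : ∫ s in (0 : ℝ)..1, ∫ u in (0 : ℝ)..2 * w,
      -𝔭 (u + (z₁ + s * (z₂ - z₁))) * (z₂ - z₁) = 2 * ζ w * (z₂ - z₁) := by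
    rw [intervalIntegral.integral_congr (g := fun _ => 2 * ζ w * (z₂ - z₁))]
    · simp
    · intro s hs
      rw [Set.uIcc_of_le zero_le_one] at hs
      simp only
      rw [intervalIntegral.integral_mul_const, integral_wp_line hw hw' (him hs).1 (him hs).2]
  rw [hright] at hswap
  simp only [hleft] at hswap
  rwa [intervalIntegral.integral_sub
    ((continuous_zeta_line hw hw' h20 h21).intervalIntegrable _ _)
    ((continuous_zeta_line hw hw' h10 h11).intervalIntegrable _ _)] at hswap

theorem integral_symm_eq {f : ℝ → ℂ} {b : ℝ} {C : ℂ} (hf : Continuous f)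
    (h : ∀ u, f (-u) + f u = C) : ∫ u in -b..b, f u = b * C := by
  have h1 : ∫ u in -b..b, f (-u) = ∫ u in -b..b, f u := by
    rw [intervalIntegral.integral_comp_neg, neg_neg]
  have h2 : (∫ u in -b..b, f (-u)) + ∫ u in -b..b, f u = ∫ u in -b..b, C := by
    have hn : Continuous fun u => f (-u) := hf.comp continuous_neg
    rw [← intervalIntegral.integral_add (hn.intervalIntegrable _ _) (hf.intervalIntegrable _ _)]
    simp only [h]
  rw [h1, intervalIntegral.integral_const, real_smul] at h2
  push_cast at h2
  linear_combination h2 / 2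

/-- At height `w'`, oddness and quasi-periodicity give `ζ(-u + iw') + ζ(u + iw') = 2ζ(iw')`, so the
integral there is explicit. The previous increment formula moves it to height `y`. -/
theorem integral_zeta_shifted_line {y : ℝ} (h0 : 0 < y) (h1 : y < 2 * w') :
    ∫ u in -w..w, ζ (u + y * I) = 2 * w * ζ (w' * I) + 2 * ζ w * ((y - w') * I) := by
  have hshift (y : ℝ) : ∫ u in (0 : ℝ)..2 * w, ζ (u + (-w + y * I)) =
      ∫ u in -w..w, ζ (u + y * I) := by
    have := intervalIntegral.integral_comp_add_right (a := 0) (b := 2 * w)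
      (fun u : ℝ => ζ (u + y * I)) (-w)
    rw [show 0 + -w = -w by ring, show 2 * w + -w = w by ring] at this
    rw [← this]
    congr 1
    ext u
    congr 1
    push_cast
    ring
  have hJ := integral_zeta_line_sub hw hw' (z₁ := -w + w' * I) (z₂ := -w + y * I) (by simpa)
    (by simp; linarith) (by simpa) (by simpa)
  rw [hshift, hshift] at hJ
  have hsym : ∫ u in -w..w, ζ (u + w' * I) = w * (2 * ζ (w' * I)) := by
    refine integral_symm_eq (continuous_zeta_line hw hw' (by simpa) (by simp; linarith)) fun u => ?_
    have hu : (u : ℂ) - w' * I ∉ Λ := by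
      intro h
      have := add_mem h (two_mul_half_period_I_mem hw hw')
      refine notMem_of_im hw hw' ?_ ?_ this <;> simp <;> linarith
    have h2 := zeta_add_period_I hw hw' hu
    rw [show (u : ℂ) - w' * I + (2 * w' : ℝ) * I = u + w' * I by push_cast; ring] at h2
    have h3 := weierstrassZeta_neg Λ (u - w' * I)
    rw [show -((u : ℂ) - w' * I) = (-u : ℝ) + w' * I by push_cast; ring] at h3
    rw [h2, h3]
    ring
  rw [hsym] at hJ
  linear_combination hJ

/-- Half the residue at `0`: along a line just above the real axis the argument falls from `π` to
`0`. -/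
theorem tendsto_integral_inv_line {w : ℝ} (hw : 0 < w) :
    Tendsto (fun y : ℝ => ∫ u in -w..w, 1 / ((u : ℂ) + y * I)) (𝓝[>] 0) (𝓝 (-(Real.pi * I))) := by
  have h1 : ∀ y : ℝ, 0 < y → ∫ u in -w..w, 1 / ((u : ℂ) + y * I) =
      log ((w : ℂ) + y * I) - log ((-w : ℝ) + y * I) := by
    intro y hy
    have hne (u : ℝ) : (u : ℂ) + y * I ∈ slitPlane := Or.inr (by simp [hy.ne'])
    rw [intervalIntegral.integral_eq_sub_of_hasDerivAt (f := fun u : ℝ => log ((u : ℂ) + y * I))]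
    · intro u _
      have : HasDerivAt (fun u : ℝ => (u : ℂ) + y * I) 1 u := by
        simpa using (hasDerivAt_id u).ofReal_comp.add_const (y * I)
      exact this.clog_real (hne u)
    · refine Continuous.intervalIntegrable ?_ _ _
      exact continuous_const.div (by fun_prop) fun u => slitPlane_ne_zero (hne u)
  have h2 : Tendsto (fun y : ℝ => log ((w : ℂ) + y * I)) (𝓝[>] 0) (𝓝 (Real.log w)) := by
    have hc : ContinuousAt (fun y : ℝ => log ((w : ℂ) + y * I)) 0 := by
      refine ContinuousAt.clog (by fun_prop) ?_
      left
      simpa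
    have := hc.tendsto.mono_left (nhdsWithin_le_nhds (s := Set.Ioi 0))
    simpa [ofReal_log hw.le] using this
  have h3 : Tendsto (fun y : ℝ => log ((-w : ℝ) + y * I)) (𝓝[>] 0)
      (𝓝 (Real.log w + Real.pi * I)) := by
    have := tendsto_log_nhdsWithin_im_nonneg_of_re_neg_of_im_zero (z := ((-w : ℝ) : ℂ))
      (by simpa) (by simp)
    rw [norm_real, norm_neg, Real.norm_of_nonneg hw.le] at this
    refine this.comp (tendsto_nhdsWithin_iff.mpr ⟨?_, ?_⟩)
    · have hc : Continuous fun y : ℝ => ((-w : ℝ) : ℂ) + y * I := by fun_prop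
      have := hc.continuousAt (x := 0) |>.tendsto.mono_left (nhdsWithin_le_nhds (s := Set.Ioi 0))
      simpa using this
    · filter_upwards [self_mem_nhdsWithin] with y hy
      have : 0 < y := hy
      simp [this.le]
  refine ((h2.sub h3).congr' ?_).trans (le_of_eq (congrArg 𝓝 (by ring)))
  filter_upwards [self_mem_nhdsWithin] with y hy
  exact (h1 y hy).symm

theorem notMem_sdiff_zero {z : ℂ} (h1 : |z.re| < 2 * w) (h2 : |z.im| < 2 * w') :
    z ∉ (Λ \ {0} : Set ℂ) := by
  rintro ⟨hz, h0⟩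
  obtain ⟨j, k, hj, hk⟩ := (mem_rectPair_lattice hw hw').mp hz
  have aux {b : ℝ} (hb : 0 < b) {n : ℤ} (h : |2 * b * n| < 2 * b) : n = 0 := by
    rw [abs_mul, abs_of_pos (by linarith : 0 < 2 * b)] at h
    have h3 : |(n : ℝ)| < 1 := by
      by_contra! h4
      nlinarith
    have h5 : |n| < 1 := by exact_mod_cast h3
    exact Int.abs_lt_one_iff.mp h5
  rw [hj] at h1
  rw [hk] at h2
  refine h0 (Complex.ext ?_ ?_)
  · rw [hj, aux hw h1]; simp
  · rw [hk, aux hw' h2]; simp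

theorem continuousAt_zetaExcept {z : ℂ} (h1 : |z.re| < 2 * w) (h2 : |z.im| < 2 * w') :
    ContinuousAt (zetaExcept (rectPair w w' hw hw')) z :=
  (hasDerivAt_zetaExcept _ (notMem_sdiff_zero hw hw' h1 h2)).continuousAt

/-- Dominated convergence on a compact rectangle; the limit is the integral of an odd function over
a symmetric interval. -/
theorem tendsto_integral_zetaExcept :
    Tendsto (fun y : ℝ => ∫ u in -w..w, zetaExcept (rectPair w w' hw hw') (u + y * I)) (𝓝[>] 0)
      (𝓝 0) := by
  have hcont {u y : ℝ} (hu : u ∈ Set.uIcc (-w) w) (hy : y ∈ Set.Icc 0 w') :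
      ContinuousAt (zetaExcept (rectPair w w' hw hw')) (u + y * I) := by
    rw [Set.uIcc_of_le (by linarith)] at hu
    refine continuousAt_zetaExcept hw hw' ?_ ?_
    · simp only [add_re, ofReal_re, mul_re, I_re, mul_zero, ofReal_im, I_im, mul_one, sub_self,
        add_zero]
      exact abs_lt.mpr ⟨by linarith [hu.1], by linarith [hu.2]⟩
    · simp only [add_im, ofReal_re, mul_im, I_re, mul_zero, ofReal_im, I_im, mul_one,
        add_zero, zero_add]
      exact abs_lt.mpr ⟨by linarith [hy.1], by linarith [hy.2]⟩
  have hline {y : ℝ} (hy : y ∈ Set.Icc 0 w') : ContinuousOn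
      (fun u : ℝ => zetaExcept (rectPair w w' hw hw') (u + y * I)) (Set.uIcc (-w) w) :=
    fun u hu => (ContinuousAt.comp (f := fun u : ℝ => (u : ℂ) + y * I) (hcont hu hy)
      (by fun_prop)).continuousWithinAt
  have hbd : ContinuousOn (fun p : ℝ × ℝ => zetaExcept (rectPair w w' hw hw') (p.1 + p.2 * I))
      (Set.uIcc (-w) w ×ˢ Set.Icc 0 w') := by
    rintro ⟨u, y⟩ ⟨hu, hy⟩
    exact (ContinuousAt.comp (f := fun p : ℝ × ℝ => (p.1 : ℂ) + p.2 * I) (x := (u, y)) (hcont hu hy)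
      (by fun_prop)).continuousWithinAt
  obtain ⟨C, hC⟩ := (isCompact_uIcc.prod isCompact_Icc).exists_bound_of_continuousOn hbd
  have hev : ∀ᶠ y : ℝ in 𝓝[>] 0, y ∈ Set.Icc 0 w' := by
    filter_upwards [Ioo_mem_nhdsGT hw'] with y hy
    exact ⟨hy.1.le, hy.2.le⟩
  have key := intervalIntegral.tendsto_integral_filter_of_dominated_convergence
    (μ := volume) (a := -w) (b := w) (l := 𝓝[>] (0 : ℝ))
    (F := fun y u => zetaExcept (rectPair w w' hw hw') (u + y * I))
    (f := fun u => zetaExcept (rectPair w w' hw hw') (u + (0 : ℝ) * I)) (fun _ => C)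
    (hev.mono fun y hy => ((hline hy).mono Set.uIoc_subset_uIcc).aestronglyMeasurable
      measurableSet_uIoc)
    (hev.mono fun y hy => .of_forall fun u hu => hC (u, y) ⟨Set.uIoc_subset_uIcc hu, hy⟩)
    intervalIntegrable_const (.of_forall fun u hu => by
      have h1 := ContinuousAt.comp (f := fun y : ℝ => (u : ℂ) + y * I) (x := 0)
        (hcont (Set.uIoc_subset_uIcc hu) ⟨le_rfl, hw'.le⟩) (by fun_prop)
      exact h1.tendsto.mono_left nhdsWithin_le_nhds)
  refine key.trans (le_of_eq (congrArg 𝓝 ?_))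
  have h1 : ∫ u in -w..w, zetaExcept (rectPair w w' hw hw') ((-u : ℝ) + (0 : ℝ) * I) =
      ∫ u in -w..w, zetaExcept (rectPair w w' hw hw') (u + (0 : ℝ) * I) := by
    rw [intervalIntegral.integral_comp_neg
      (fun u : ℝ => zetaExcept (rectPair w w' hw hw') (u + (0 : ℝ) * I)), neg_neg]
  simp only [ofReal_zero, zero_mul, add_zero, ofReal_neg, zetaExcept_neg,
    intervalIntegral.integral_neg] at h1 ⊢
  linear_combination -h1 / 2

/-- Legendre's relation. -/
theorem legendre_relation : w * ζ (w' * I) - ζ w * (w' * I) = -(Real.pi / 2 * I) := by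
  -- The integral of `ζ` at height `y` is known exactly for `0 < y < 2w'`. Splitting off `1/z` and
  -- letting `y → 0` evaluates it a second time.
  have h1 := (tendsto_integral_inv_line hw).add (tendsto_integral_zetaExcept hw hw')
  have h2 : Tendsto (fun y : ℝ => 2 * w * ζ (w' * I) + 2 * ζ w * ((y - w') * I)) (𝓝[>] 0)
      (𝓝 (2 * w * ζ (w' * I) + 2 * ζ w * (((0 : ℝ) - w') * I))) := by
    have hc : Continuous fun y : ℝ => 2 * w * ζ (w' * I) + 2 * ζ w * ((y - w') * I) := by fun_prop
    exact (hc.continuousAt (x := 0)).tendsto.mono_left nhdsWithin_le_nhds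
  have h3 := tendsto_nhds_unique h2 (h1.congr' ?_)
  · push_cast at h3
    linear_combination h3 / 2
  · filter_upwards [Ioo_mem_nhdsGT hw'] with y hy
    rw [← integral_zeta_shifted_line hw hw' hy.1 (by linarith [hy.2])]
    have e : (fun u : ℝ => ζ (u + y * I)) = fun u : ℝ =>
        1 / ((u : ℂ) + y * I) + zetaExcept (rectPair w w' hw hw') (u + y * I) :=
      funext fun u => weierstrassZeta_eq _ _
    have c1 : Continuous fun u : ℝ => 1 / ((u : ℂ) + y * I) :=
      continuous_const.div (by fun_prop) fun u h => by
        have := congrArg im h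
        simp at this
        exact hy.1.ne' this
    have c2 : Continuous fun u : ℝ => zetaExcept (rectPair w w' hw hw') (u + y * I) := by
      have := continuous_zeta_line hw hw' (z := y * I) (by simpa using hy.1)
        (by simp; linarith [hy.2])
      refine (this.sub c1).congr fun u => ?_
      rw [Pi.sub_apply, weierstrassZeta_eq]
      ring
    rw [e, intervalIntegral.integral_add (c1.intervalIntegrable _ _) (c2.intervalIntegrable _ _)]

/-- The Floquet exponent `w ζ(a) - ζ(w) a`. -/
def floquetExponent (w : ℝ) (M : Submodule ℤ ℂ) (a : ℂ) : ℂ :=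
  w * weierstrassZeta M a - weierstrassZeta M w * a

/-- Here `a` and its conjugate differ by the imaginary period, so the exponent and its conjugate
differ by a constant that Legendre's relation evaluates as `-πi`. -/
theorem floquetExponent_im_of_im_eq {a : ℂ} (ha : a ∉ Λ) (h : a.im = w') :
    (floquetExponent w Λ a).im = -(Real.pi / 2) := by
  have hconj : conj (floquetExponent w Λ a) = floquetExponent w Λ (conj a) := by
    simp only [floquetExponent, map_sub, map_mul, conj_ofReal, conj_weierstrassZeta]
  have ha' : conj a ∉ Λ := fun h => ha ((conj_mem_iff hw hw').mp h)
  have hshift : conj a + (2 * w' : ℝ) * I = a := by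
    apply Complex.ext <;> simp [h]
    ring
  have h1 := zeta_add_period_I hw hw' ha'
  rw [hshift] at h1
  have h2 : floquetExponent w Λ a = conj (floquetExponent w Λ a) - Real.pi * I := by
    rw [hconj, floquetExponent, floquetExponent, h1]
    have := legendre_relation hw hw'
    push_cast at hshift
    linear_combination 2 * this + ζ w * hshift
  have h3 := congrArg im h2
  simp at h3
  linarith

theorem floquetExponent_neg (w : ℝ) (M : Submodule ℤ ℂ) (a : ℂ) :
    floquetExponent w M (-a) = -floquetExponent w M a := by
  rw [floquetExponent, floquetExponent, weierstrassZeta_neg]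
  ring

theorem floquetExponent_im_of_abs_im_eq {a : ℂ} (ha : a ∉ Λ) (h : |a.im| = w') :
    (floquetExponent w Λ a).im = Real.pi / 2 ∨ (floquetExponent w Λ a).im = -(Real.pi / 2) := by
  rcases eq_or_eq_neg_of_abs_eq h with h | h
  · exact Or.inr (floquetExponent_im_of_im_eq hw hw' ha h)
  · left
    have := floquetExponent_im_of_im_eq hw hw' (a := -a) (fun h => ha (by simpa using neg_mem h))
      (by simp [h])
    rw [floquetExponent_neg, neg_im] at this
    linarith

/-- On the line `Im z = w'`, Hermite's solution with `|Im a| < w'` has a logarithm whose increment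
over a period is `-2 (w ζ(a) - ζ(w) a)`. -/
theorem exists_log_lameSolution {a : ℂ} (h : |a.im| < w') :
    ∃ g : ℝ → ℂ, Differentiable ℝ g ∧
      (∀ u : ℝ, exp (g u) = lameSolution (rectPair w w' hw hw') a (u + w' * I)) ∧
      ∀ u, g (u + 2 * w) = g u - 2 * floquetExponent w Λ a := by
  rw [abs_lt] at h
  set φ : ℝ → ℂ := fun u => lameSolution (rectPair w w' hw hw') a (u + w' * I) with hφ
  have hz (u : ℝ) : (u : ℂ) + w' * I ∉ Λ :=
    notMem_of_im hw hw' (by simpa) (by simp; linarith)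
  have hza (u : ℝ) : (u : ℂ) + w' * I + a ∉ Λ :=
    notMem_of_im hw hw' (by simp; linarith) (by simp; linarith)
  have hφ0 (u : ℝ) : φ u ≠ 0 := fun h0 => hza u ((lameSolution_eq_zero_iff _ (hz u)).mp h0)
  -- The logarithmic derivative of `φ`. Since `|Im a| < w'`, both lines of integration lie strictly
  -- between the rows of poles at heights `0` and `2w'`. This is what fixes the increment of the
  -- logarithm without multiples of `2πi`.
  set v : ℝ → ℂ := fun u => ζ (u + (w' * I + a)) - ζ (u + w' * I) - ζ a with hv
  have hv1 := continuous_zeta_line hw hw' (z := w' * I + a) (by simp; linarith) (by simp; linarith)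
  have hv2 := continuous_zeta_line hw hw' (z := w' * I) (by simpa) (by simp; linarith)
  have hvc : Continuous v := (hv1.sub hv2).sub continuous_const
  have hφd (u : ℝ) : HasDerivAt φ (v u * φ u) u := by
    have h1 := (hasDerivAt_lameSolution _ (hz u) (hza u)).comp_add_const (u : ℂ) (w' * I)
      |>.comp_ofReal
    refine h1.congr_deriv ?_
    rw [hv, add_assoc]
  set g : ℝ → ℂ := fun u => (∫ t in (0 : ℝ)..u, v t) + log (φ 0) with hg
  have hgd (u : ℝ) : HasDerivAt g (v u) u :=
    (hvc.integral_hasStrictDerivAt 0 u).hasDerivAt.add_const _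
  refine ⟨g, fun u => (hgd u).differentiableAt, fun u => ?_, fun u => ?_⟩
  · have hconst := eq_of_hasDerivAt_zero (f := fun u => exp (g u) / φ u) (fun u => by
      refine ((hgd u).cexp.div (hφd u) (hφ0 u)).congr_deriv ?_
      rw [div_eq_zero_iff]
      left
      ring) u 0
    have h0 : exp (g 0) / φ 0 = 1 := by
      simp only [hg, intervalIntegral.integral_same, zero_add]
      rw [exp_log (hφ0 0), div_self (hφ0 0)]
    rw [h0, div_eq_one_iff_eq (hφ0 u)] at hconst
    exact hconst
  · have hper : Function.Periodic v (2 * w) := by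
      intro u
      simp only [hv]
      have h1 := zeta_add_period hw hw' (hz u)
      have h2 := zeta_add_period hw hw' (hza u)
      rw [show (u : ℂ) + w' * I + (2 * w : ℝ) = (u + 2 * w : ℝ) + w' * I by push_cast; ring] at h1
      rw [show (u : ℂ) + w' * I + a + (2 * w : ℝ) = (u + 2 * w : ℝ) + (w' * I + a) by
        push_cast; ring, add_assoc] at h2
      rw [h1, h2]
      ring
    have h1 : ∫ t in u..u + 2 * w, v t = 2 * ζ w * a - 2 * w * ζ a := by
      rw [hper.intervalIntegral_add_eq u 0, zero_add]
      simp only [hv]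
      have hv3 : Continuous fun u : ℝ => ζ (u + (w' * I + a)) - ζ (u + w' * I) := hv1.sub hv2
      rw [intervalIntegral.integral_sub (hv3.intervalIntegrable _ _)
        (continuous_const.intervalIntegrable _ _), intervalIntegral.integral_sub
        (hv1.intervalIntegrable _ _) (hv2.intervalIntegrable _ _),
        integral_zeta_line_sub hw hw' (by simpa) (by simp; linarith) (by simp; linarith)
          (by simp; linarith), intervalIntegral.integral_const, real_smul]
      push_cast
      ring
    have h2 : g (u + 2 * w) - g u = ∫ t in u..u + 2 * w, v t := by
      simp only [hg]
      rw [← intervalIntegral.integral_add_adjacent_intervals (b := u)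
        (hvc.intervalIntegrable 0 u) (hvc.intervalIntegrable u (u + 2 * w))]
      ring
    rw [h1] at h2
    rw [floquetExponent]
    linear_combination h2

end Rect

/-! ### The Jacobi functions on the real line -/

section Jacobi

open Set

variable {m : ℝ}

theorem ellipticF_zero (m : ℝ) : ellipticF m 0 = 0 := by simp [ellipticF]

theorem hasDerivAt_ellipticF (h0 : 0 ≤ m) (h1 : m < 1) (θ : ℝ) :
    HasDerivAt (ellipticF m) (1 / Real.sqrt (1 - m * Real.sin θ ^ 2)) θ :=
  ((continuous_ellipticF_integrand h0 h1).integral_hasStrictDerivAt 0 θ).hasDerivAt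

theorem strictMono_ellipticF (h0 : 0 ≤ m) (h1 : m < 1) : StrictMono (ellipticF m) := fun a b hab => by
  have := sub_le_ellipticF_sub h0 h1 hab.le
  linarith

theorem ellipticK_pos (h0 : 0 ≤ m) (h1 : m < 1) : 0 < ellipticK m := by
  have := strictMono_ellipticF h0 h1 (half_pos Real.pi_pos)
  rwa [ellipticF_zero] at this

theorem jacobiAm_ellipticF (h0 : 0 ≤ m) (h1 : m < 1) (θ : ℝ) : jacobiAm m (ellipticF m θ) = θ :=
  Function.leftInverse_invFun (ellipticF_bijective h0 h1).1 θ

theorem ellipticF_jacobiAm (h0 : 0 ≤ m) (h1 : m < 1) (u : ℝ) : ellipticF m (jacobiAm m u) = u :=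
  Function.rightInverse_invFun (ellipticF_bijective h0 h1).2 u

theorem strictMono_jacobiAm (h0 : 0 ≤ m) (h1 : m < 1) : StrictMono (jacobiAm m) := fun a b hab => by
  rw [← (strictMono_ellipticF h0 h1).lt_iff_lt]
  rwa [ellipticF_jacobiAm h0 h1, ellipticF_jacobiAm h0 h1]

theorem continuous_jacobiAm (h0 : 0 ≤ m) (h1 : m < 1) : Continuous (jacobiAm m) :=
  (strictMono_jacobiAm h0 h1).monotone.continuous_of_surjective fun θ =>
    ⟨_, jacobiAm_ellipticF h0 h1 θ⟩

/-- The Jacobi function `dn = √(1 - m sn²)`. -/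
def jacobiDn (m u : ℝ) : ℝ := Real.sqrt (1 - m * jacobiSn m u ^ 2)

/-- The Jacobi function `cn = cos am`. -/
def jacobiCn (m u : ℝ) : ℝ := Real.cos (jacobiAm m u)

theorem jacobiDn_sq (h0 : 0 ≤ m) (h1 : m < 1) (u : ℝ) :
    jacobiDn m u ^ 2 = 1 - m * jacobiSn m u ^ 2 :=
  Real.sq_sqrt (one_sub_mul_sin_sq_pos h0 h1 _).le

theorem jacobiDn_pos (h0 : 0 ≤ m) (h1 : m < 1) (u : ℝ) : 0 < jacobiDn m u :=
  Real.sqrt_pos.mpr (one_sub_mul_sin_sq_pos h0 h1 _)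

theorem jacobiCn_sq (m u : ℝ) : jacobiCn m u ^ 2 = 1 - jacobiSn m u ^ 2 :=
  Real.cos_sq' _

theorem hasDerivAt_jacobiAm (h0 : 0 ≤ m) (h1 : m < 1) (u : ℝ) :
    HasDerivAt (jacobiAm m) (jacobiDn m u) u := by
  have h := (hasDerivAt_ellipticF h0 h1 (jacobiAm m u)).of_local_left_inverse
    (continuous_jacobiAm h0 h1).continuousAt
    (by have := jacobiDn_pos h0 h1 u; exact (one_div_pos.mpr this).ne')
    (.of_forall (ellipticF_jacobiAm h0 h1))
  rw [one_div, inv_inv] at h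
  exact h

theorem hasDerivAt_jacobiSn (h0 : 0 ≤ m) (h1 : m < 1) (u : ℝ) :
    HasDerivAt (jacobiSn m) (jacobiCn m u * jacobiDn m u) u :=
  (hasDerivAt_jacobiAm h0 h1 u).sin

theorem hasDerivAt_jacobiCn (h0 : 0 ≤ m) (h1 : m < 1) (u : ℝ) :
    HasDerivAt (jacobiCn m) (-jacobiSn m u * jacobiDn m u) u :=
  (hasDerivAt_jacobiAm h0 h1 u).cos

theorem hasDerivAt_jacobiDn (h0 : 0 ≤ m) (h1 : m < 1) (u : ℝ) :
    HasDerivAt (jacobiDn m) (-m * jacobiSn m u * jacobiCn m u) u := by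
  have h2 := (((hasDerivAt_jacobiSn h0 h1 u).pow 2).const_mul m).const_sub 1
  have h3 := h2.sqrt (one_sub_mul_sin_sq_pos h0 h1 _).ne'
  refine h3.congr_deriv ?_
  have hd := (jacobiDn_pos h0 h1 u).ne'
  rw [show Real.sqrt (1 - m * (jacobiSn m ^ 2) u) = jacobiDn m u from rfl]
  field_simp
  push_cast
  ring

theorem jacobiAm_zero (h0 : 0 ≤ m) (h1 : m < 1) : jacobiAm m 0 = 0 := by
  have := jacobiAm_ellipticF h0 h1 0
  rwa [ellipticF_zero] at this

theorem jacobiSn_zero (h0 : 0 ≤ m) (h1 : m < 1) : jacobiSn m 0 = 0 := by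
  rw [jacobiSn, jacobiAm_zero h0 h1, Real.sin_zero]

theorem jacobiSn_ellipticK (h0 : 0 ≤ m) (h1 : m < 1) : jacobiSn m (ellipticK m) = 1 := by
  rw [ellipticK, jacobiSn_ellipticF h0 h1, Real.sin_pi_div_two]

theorem jacobiCn_ellipticK (h0 : 0 ≤ m) (h1 : m < 1) : jacobiCn m (ellipticK m) = 0 := by
  rw [jacobiCn, ellipticK, jacobiAm_ellipticF h0 h1, Real.cos_pi_div_two]

theorem ellipticF_add_pi (h0 : 0 ≤ m) (h1 : m < 1) (θ : ℝ) :
    ellipticF m (θ + Real.pi) = ellipticF m θ + 2 * ellipticK m := by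
  have hc := continuous_ellipticF_integrand h0 h1
  have hper : Function.Periodic (fun t => 1 / Real.sqrt (1 - m * Real.sin t ^ 2)) Real.pi := fun t => by
    simp [Real.sin_add_pi]
  have e1 : ellipticF m (θ + Real.pi) = ellipticF m θ +
      ∫ t in θ..θ + Real.pi, 1 / Real.sqrt (1 - m * Real.sin t ^ 2) :=
    (intervalIntegral.integral_add_adjacent_intervals (hc.intervalIntegrable _ _)
      (hc.intervalIntegrable _ _)).symm
  have e2 : ∫ t in Real.pi / 2..Real.pi, 1 / Real.sqrt (1 - m * Real.sin t ^ 2) = ellipticK m := by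
    have := intervalIntegral.integral_comp_sub_left (a := 0) (b := Real.pi / 2)
      (fun t => 1 / Real.sqrt (1 - m * Real.sin t ^ 2)) Real.pi
    simp only [Real.sin_pi_sub] at this
    rw [show Real.pi - Real.pi / 2 = Real.pi / 2 by ring, sub_zero] at this
    exact this.symm
  rw [e1, hper.intervalIntegral_add_eq θ 0, zero_add,
    ← intervalIntegral.integral_add_adjacent_intervals (b := Real.pi / 2)
      (hc.intervalIntegrable _ _) (hc.intervalIntegrable _ _), e2]
  change ellipticF m θ + (ellipticK m + ellipticK m) = _
  ring

theorem jacobiAm_add_two_mul_ellipticK (h0 : 0 ≤ m) (h1 : m < 1) (u : ℝ) :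
    jacobiAm m (u + 2 * ellipticK m) = jacobiAm m u + Real.pi := by
  apply (ellipticF_bijective h0 h1).1
  rw [ellipticF_jacobiAm h0 h1, ellipticF_add_pi h0 h1, ellipticF_jacobiAm h0 h1]

theorem jacobiSn_sq_add_two_mul_ellipticK (h0 : 0 ≤ m) (h1 : m < 1) (u : ℝ) :
    jacobiSn m (u + 2 * ellipticK m) ^ 2 = jacobiSn m u ^ 2 := by
  rw [jacobiSn, jacobiAm_add_two_mul_ellipticK h0 h1, Real.sin_add_pi, neg_sq, jacobiSn]

theorem jacobiSn_pos (h0 : 0 ≤ m) (h1 : m < 1) {u : ℝ} (hu : 0 < u) (hu' : u < 2 * ellipticK m) :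
    0 < jacobiSn m u := by
  refine Real.sin_pos_of_pos_of_lt_pi ?_ ?_
  · rw [← jacobiAm_zero h0 h1]
    exact strictMono_jacobiAm h0 h1 hu
  · have := jacobiAm_add_two_mul_ellipticK h0 h1 0
    rw [zero_add, jacobiAm_zero h0 h1, zero_add] at this
    rw [← this]
    exact strictMono_jacobiAm h0 h1 hu'

theorem continuous_jacobiSn (h0 : 0 ≤ m) (h1 : m < 1) : Continuous (jacobiSn m) :=
  Real.continuous_sin.comp (continuous_jacobiAm h0 h1)

theorem ellipticK_lt_ellipticK {m' : ℝ} (h0 : 0 ≤ m) (h : m < m') (h1 : m' < 1) :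
    ellipticK m < ellipticK m' := by
  refine intervalIntegral.integral_lt_integral_of_continuousOn_of_le_of_exists_lt
    (half_pos Real.pi_pos) (continuous_ellipticF_integrand h0 (h.trans h1)).continuousOn
    (continuous_ellipticF_integrand (h0.trans h.le) h1).continuousOn (fun t _ => ?_)
    ⟨Real.pi / 2, right_mem_Icc.mpr (half_pos Real.pi_pos).le, ?_⟩
  · refine one_div_le_one_div_of_le (Real.sqrt_pos.mpr
      (one_sub_mul_sin_sq_pos (h0.trans h.le) h1 t)) (Real.sqrt_le_sqrt ?_)
    nlinarith [sq_nonneg (Real.sin t)]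
  · refine one_div_lt_one_div_of_lt (Real.sqrt_pos.mpr
      (one_sub_mul_sin_sq_pos (h0.trans h.le) h1 _)) (Real.sqrt_lt_sqrt
      (one_sub_mul_sin_sq_pos (h0.trans h.le) h1 _).le ?_)
    simp only [Real.sin_pi_div_two]
    linarith

/-- `m sn² - (m + 1)/3` solves the Weierstrass equation. -/
theorem hasDerivAt_jacobiSn_sq (h0 : 0 ≤ m) (h1 : m < 1) (u : ℝ) :
    HasDerivAt (fun u => m * jacobiSn m u ^ 2 - (m + 1) / 3)
      (2 * m * jacobiSn m u * jacobiCn m u * jacobiDn m u) u := by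
  refine (((hasDerivAt_jacobiSn h0 h1 u).pow 2).const_mul m |>.sub_const _).congr_deriv ?_
  push_cast
  ring

theorem hasDerivAt_jacobiSn_sq' (h0 : 0 ≤ m) (h1 : m < 1) (u : ℝ) :
    HasDerivAt (fun u => 2 * m * jacobiSn m u * jacobiCn m u * jacobiDn m u)
      (6 * (m * jacobiSn m u ^ 2 - (m + 1) / 3) ^ 2 - 2 * (m ^ 2 - m + 1) / 3) u := by
  refine ((((hasDerivAt_jacobiSn h0 h1 u).const_mul (2 * m)).mul
    (hasDerivAt_jacobiCn h0 h1 u)).mul (hasDerivAt_jacobiDn h0 h1 u)).congr_deriv ?_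
  have hd := jacobiDn_sq h0 h1 u
  have hc := jacobiCn_sq m u
  simp only [Pi.mul_apply]
  generalize jacobiSn m u = s at *
  generalize jacobiCn m u = c at *
  generalize jacobiDn m u = d at *
  linear_combination (2 * m * (c ^ 2 - s ^ 2)) * hd +
    (2 * m * (1 - m * s ^ 2) - 2 * m ^ 2 * s ^ 2) * hc

end Jacobi

/-! ### The Weierstrass equation on the real line -/

section RealWeierstrass

open Set Filter Topology

/-- The difference of two solutions satisfies the linear equation `y'' = 6 (f + g) y`. -/
theorem weierstrass_ode_unique {s : Set ℝ} (hs : s.OrdConnected) {f f' g g' : ℝ → ℝ} {γ : ℝ}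
    (hf : ∀ x ∈ s, HasDerivAt f (f' x) x) (hf' : ∀ x ∈ s, HasDerivAt f' (6 * f x ^ 2 - γ) x)
    (hg : ∀ x ∈ s, HasDerivAt g (g' x) x) (hg' : ∀ x ∈ s, HasDerivAt g' (6 * g x ^ 2 - γ) x)
    {t : ℝ} (ht : t ∈ s) (h0 : f t = g t) (h1 : f' t = g' t) : ∀ x ∈ s, f x = g x := by
  intro x hx
  have := linear_ode_eq_zero (q := fun x => 6 * (f x + g x)) (y := fun x => f x - g x)
    (y' := fun x => f' x - g' x) hs
    (fun x hx => (((hf x hx).continuousAt.add (hg x hx).continuousAt).const_mul 6).continuousWithinAt)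
    (fun x hx => (hf x hx).sub (hg x hx))
    (fun x hx => ((hf' x hx).sub (hg' x hx)).congr_deriv (by simp only [smul_eq_mul]; ring))
    ht (sub_eq_zero.mpr h0) (sub_eq_zero.mpr h1) x hx
  exact sub_eq_zero.mp this.1

/-- A solution of `f'² = 4 f³ - g₂ f - g₃` on `(0, 2b)`, symmetric about `b` and blowing up at the
ends. -/
structure BlowUpSolution (f f' : ℝ → ℝ) (b g₂ g₃ : ℝ) : Prop where
  pos : 0 < b
  hasDerivAt : ∀ x ∈ Ioo 0 (2 * b), HasDerivAt f (f' x) x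
  hasDerivAt' : ∀ x ∈ Ioo 0 (2 * b), HasDerivAt f' (6 * f x ^ 2 - g₂ / 2) x
  deriv_sq : ∀ x ∈ Ioo 0 (2 * b), f' x ^ 2 = 4 * f x ^ 3 - g₂ * f x - g₃
  symm : ∀ x, f (2 * b - x) = f x
  tendsto : Tendsto f (𝓝[>] 0) atTop

namespace BlowUpSolution

variable {f f' : ℝ → ℝ} {b g₂ g₃ : ℝ}

theorem mid_mem (h : BlowUpSolution f f' b g₂ g₃) : b ∈ Ioo 0 (2 * b) := ⟨h.pos, by linarith [h.pos]⟩

theorem deriv_symm (h : BlowUpSolution f f' b g₂ g₃) {x : ℝ} (hx : x ∈ Ioo 0 (2 * b)) : f' (2 * b - x) = -f' x := by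
  have h1 := (h.hasDerivAt (2 * b - x) ⟨by linarith [hx.2], by linarith [hx.1]⟩).comp_const_sub
    (2 * b) x
  have e : (fun x => f (2 * b - x)) = f := funext h.symm
  rw [e] at h1
  linarith [h1.unique (h.hasDerivAt x hx)]

theorem deriv_mid (h : BlowUpSolution f f' b g₂ g₃) : f' b = 0 := by
  have := h.deriv_symm h.mid_mem
  rw [show 2 * b - b = b by ring] at this
  linarith

theorem false_of_tendsto (h : BlowUpSolution f f' b g₂ g₃) {g : ℝ → ℝ} (hg : ContinuousAt g 0) (he : ∀ᶠ x in 𝓝[>] 0, f x = g x) :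
    False := by
  have h1 : Tendsto g (𝓝[>] 0) (𝓝 (g 0)) := hg.tendsto.mono_left nhdsWithin_le_nhds
  exact not_tendsto_nhds_of_tendsto_atTop h.tendsto _ (h1.congr' (he.mono fun x hx => hx.symm))

theorem deriv_ne_zero (h : BlowUpSolution f f' b g₂ g₃) {t : ℝ} (ht : t ∈ Ioo 0 b) : f' t ≠ 0 := by
  intro h0
  have hsub {x : ℝ} (hx : x ∈ Ioo 0 (2 * t)) : x ∈ Ioo 0 (2 * b) :=
    ⟨hx.1, by linarith [hx.2, ht.2]⟩
  have hsub' {x : ℝ} (hx : x ∈ Ioo 0 (2 * t)) : 2 * t - x ∈ Ioo 0 (2 * b) :=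
    hsub ⟨by linarith [hx.2], by linarith [hx.1]⟩
  have key := weierstrass_ode_unique (s := Ioo 0 (2 * t)) ordConnected_Ioo
    (f := f) (f' := f') (g := fun x => f (2 * t - x)) (g' := fun x => -f' (2 * t - x))
    (fun x hx => h.hasDerivAt x (hsub hx)) (fun x hx => h.hasDerivAt' x (hsub hx))
    (fun x hx => (h.hasDerivAt _ (hsub' hx)).comp_const_sub _ _)
    (fun x hx => by simpa using ((h.hasDerivAt' _ (hsub' hx)).comp_const_sub (2 * t) x).fun_neg)
    (t := t) ⟨ht.1, by linarith [ht.1]⟩ (by ring_nf) (by ring_nf; simp [h0])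
  refine h.false_of_tendsto (g := fun x => f (2 * t - x)) ?_ ?_
  · have h1 : ContinuousAt f (2 * t - 0) := (h.hasDerivAt _ (by
      rw [sub_zero]; exact ⟨by linarith [ht.1], by linarith [ht.2]⟩)).continuousAt
    exact ContinuousAt.comp (f := fun x => 2 * t - x) h1 (by fun_prop)
  · filter_upwards [Ioo_mem_nhdsGT (by linarith [ht.1] : 0 < 2 * t)] with x hx using key x hx

theorem exists_eq (h : BlowUpSolution f f' b g₂ g₃) {y : ℝ} (hy : f b ≤ y) : ∃ t ∈ Ioc 0 b, f t = y := by
  have hev : ∀ᶠ t in 𝓝[>] 0, y ≤ f t ∧ t ∈ Ioo 0 b :=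
    (h.tendsto.eventually_ge_atTop y).and (Ioo_mem_nhdsGT h.pos)
  obtain ⟨t, hty, ht⟩ := hev.exists
  have hc : ContinuousOn f (Icc t b) := fun x hx => (h.hasDerivAt x
    ⟨by linarith [hx.1, ht.1], by linarith [hx.2, h.pos]⟩).continuousAt.continuousWithinAt
  obtain ⟨x, hx, hxy⟩ := intermediate_value_Icc' ht.2.le hc ⟨hy, hty⟩
  exact ⟨x, ⟨by linarith [hx.1, ht.1], hx.2⟩, hxy⟩

/-- Every value above `f b` is attained in `(0, b)`, where the cubic equals `f'² > 0`. -/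
theorem cubic_pos (h : BlowUpSolution f f' b g₂ g₃) {y : ℝ} (hy : f b < y) : 0 < 4 * y ^ 3 - g₂ * y - g₃ := by
  obtain ⟨t, ht, rfl⟩ := h.exists_eq hy.le
  have ht' : t ∈ Ioo 0 b := ⟨ht.1, ht.2.lt_of_ne (by rintro rfl; exact lt_irrefl _ hy)⟩
  rw [← h.deriv_sq t ⟨ht.1, by linarith [ht.2, h.pos]⟩]
  have := h.deriv_ne_zero ht'
  positivity

theorem cubic_eq_zero (h : BlowUpSolution f f' b g₂ g₃) : 4 * f b ^ 3 - g₂ * f b - g₃ = 0 := by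
  rw [← h.deriv_sq b h.mid_mem, h.deriv_mid]
  ring

/-- At a double root the constant `f b` would solve the equation with the same Cauchy data at `b`,
contradicting the blow-up. -/
theorem cubic_simple (h : BlowUpSolution f f' b g₂ g₃) : 12 * f b ^ 2 - g₂ ≠ 0 := by
  intro h0
  have key := weierstrass_ode_unique (s := Ioo 0 (2 * b)) ordConnected_Ioo (γ := g₂ / 2)
    (f := f) (f' := f') (g := fun _ => f b) (g' := fun _ => 0) h.hasDerivAt h.hasDerivAt'
    (fun x _ => hasDerivAt_const _ _)
    (fun x _ => (hasDerivAt_const _ _).congr_deriv (by linarith)) h.mid_mem rfl h.deriv_mid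
  refine h.false_of_tendsto (g := fun _ => f b) continuousAt_const ?_
  filter_upwards [Ioo_mem_nhdsGT (by linarith [h.pos] : 0 < 2 * b)] with x hx using key x hx

/-- The half-period is a complete elliptic integral. -/
theorem sqrt_mul_half_period (h : BlowUpSolution f f' b g₂ g₃) {e₂ e₃ : ℝ} (h32 : e₃ < e₂) (h21 : e₂ < f b)
    (hsum : f b + e₂ + e₃ = 0) (hg : g₂ = -4 * (f b * e₂ + e₂ * e₃ + e₃ * f b)) :
    Real.sqrt (f b - e₃) * b = ellipticK ((e₂ - e₃) / (f b - e₃)) := by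
  set E := Real.sqrt (f b - e₃) with hE
  set m := (e₂ - e₃) / (f b - e₃) with hm
  set K := ellipticK m with hK
  have hpos : 0 < f b - e₃ := by linarith
  have hE0 : 0 < E := Real.sqrt_pos.mpr hpos
  have hE2 : E ^ 2 = f b - e₃ := Real.sq_sqrt hpos.le
  have hm0 : 0 ≤ m := div_nonneg (by linarith) hpos.le
  have hm1 : m < 1 := (div_lt_one hpos).mpr (by linarith)
  have hK0 : 0 < K := ellipticK_pos hm0 hm1
  have hmE : m * E ^ 2 = e₂ - e₃ := by rw [hE2, hm]; field_simp
  have he3 : e₃ = -(1 + m) * E ^ 2 / 3 := by linarith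
  have hg2 : g₂ / 2 = 6 * e₃ ^ 2 - 2 * m * E ^ 4 := by
    have e1 : f b = e₃ + E ^ 2 := by linarith
    have e2 : e₂ = e₃ + m * E ^ 2 := by linarith
    rw [hg, e1, e2, he3]
    ring
  -- The phase puts `t = b` at the quarter period `K`, where `sn = 1` and `cn = 0`, so that the
  -- comparison function takes the value `f b` with zero derivative.
  set z : ℝ → ℝ := fun t => E * (t - b) + K with hz
  have hzd (t : ℝ) : HasDerivAt z E t := by
    have h1 := (((hasDerivAt_id t).sub_const b).const_mul E).add_const K
    exact h1.congr_deriv (by ring)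
  have hzmem {t : ℝ} (ht : t ∈ Ioo (b - K / E) (b + K / E)) : 0 < jacobiSn m (z t) := by
    have h1 : E * (K / E) = K := by field_simp
    refine jacobiSn_pos hm0 hm1 ?_ ?_
    · have : E * (b - K / E) < E * t := by gcongr; exact ht.1
      simp only [hz]
      linarith
    · have : E * t < E * (b + K / E) := by gcongr; exact ht.2
      simp only [hz]
      linarith
  set y : ℝ → ℝ := fun t => e₃ + E ^ 2 * (jacobiSn m (z t) ^ 2)⁻¹ with hy
  set y' : ℝ → ℝ := fun t =>
    -2 * E ^ 3 * (jacobiCn m (z t) * jacobiDn m (z t)) * (jacobiSn m (z t) ^ 3)⁻¹ with hy'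
  have hyd : ∀ t ∈ Ioo (b - K / E) (b + K / E), HasDerivAt y (y' t) t := by
    intro t ht
    have hs := hzmem ht
    have h1 := ((hasDerivAt_jacobiSn hm0 hm1 (z t)).comp t (hzd t)).pow 2
    have h2 := ((h1.inv (pow_ne_zero 2 hs.ne')).const_mul (E ^ 2)).const_add e₃
    refine h2.congr_deriv ?_
    simp only [hy', Function.comp_apply, Pi.pow_apply]
    field_simp
    push_cast
    ring
  have hyd' : ∀ t ∈ Ioo (b - K / E) (b + K / E), HasDerivAt y' (6 * y t ^ 2 - g₂ / 2) t := by
    intro t ht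
    have hs := hzmem ht
    have h1 := ((hasDerivAt_jacobiSn hm0 hm1 (z t)).comp t (hzd t)).pow 3
    have hc := (hasDerivAt_jacobiCn hm0 hm1 (z t)).comp t (hzd t)
    have hd := (hasDerivAt_jacobiDn hm0 hm1 (z t)).comp t (hzd t)
    have h2 := ((hc.mul hd).const_mul (-2 * E ^ 3)).mul (h1.inv (pow_ne_zero 3 hs.ne'))
    refine h2.congr_deriv ?_
    have hd2 := jacobiDn_sq hm0 hm1 (z t)
    have hc2 := jacobiCn_sq m (z t)
    rw [hg2, he3]
    simp only [hy, Function.comp_apply, Pi.pow_apply, Pi.mul_apply, Pi.inv_apply]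
    rw [he3]
    generalize jacobiSn m (z t) = s at *
    generalize jacobiCn m (z t) = c at *
    generalize jacobiDn m (z t) = d at *
    have hs0 := hs.ne'
    field_simp
    push_cast
    linear_combination (18 * s ^ 4 + 54 * c ^ 2 * s ^ 2) * hd2 +
      (18 * m * s ^ 4 + 54 * s ^ 2 * (1 - m * s ^ 2)) * hc2
  have hzb : z b = K := by simp [hz]
  have hyb : y b = f b := by
    simp only [hy, hzb, hK, jacobiSn_ellipticK hm0 hm1, hE2]
    ring
  have hy'b : y' b = 0 := by
    simp [hy', hzb, hK, jacobiCn_ellipticK hm0 hm1]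
  have hKE : 0 < K / E := by positivity
  set δ := min b (K / E) with hδ
  have hδ0 : 0 < δ := lt_min h.pos hKE
  have hsub1 : ∀ t ∈ Ioo (b - δ) (b + δ), t ∈ Ioo 0 (2 * b) := fun t ht =>
    ⟨by linarith [ht.1, min_le_left b (K / E)], by linarith [ht.2, min_le_left b (K / E)]⟩
  have hsub2 : ∀ t ∈ Ioo (b - δ) (b + δ), t ∈ Ioo (b - K / E) (b + K / E) := fun t ht =>
    ⟨by linarith [ht.1, min_le_right b (K / E)], by linarith [ht.2, min_le_right b (K / E)]⟩
  have key := weierstrass_ode_unique (s := Ioo (b - δ) (b + δ)) ordConnected_Ioo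
    (fun t ht => h.hasDerivAt t (hsub1 t ht)) (fun t ht => h.hasDerivAt' t (hsub1 t ht))
    (fun t ht => hyd t (hsub2 t ht)) (fun t ht => hyd' t (hsub2 t ht)) (t := b)
    ⟨by linarith, by linarith⟩ hyb.symm (by rw [h.deriv_mid, hy'b])
  -- The two solutions agree near `b` as long as both exist, and going left they blow up at `0` and
  -- at `b - K/E`. If these points differed, one solution would be regular where the other is
  -- infinite.
  rcases lt_trichotomy b (K / E) with hlt | heq | hlt
  · exfalso
    have hδb : δ = b := min_eq_left hlt.le
    refine h.false_of_tendsto (g := y)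
      (hyd 0 ⟨by linarith, by linarith [h.pos]⟩).continuousAt ?_
    filter_upwards [Ioo_mem_nhdsGT (by linarith [h.pos] : 0 < 2 * b)] with x hx
    exact key x ⟨by rw [hδb]; linarith [hx.1], by rw [hδb]; linarith [hx.2]⟩
  · rw [heq]
    field_simp
  · exfalso
    have hδK : δ = K / E := min_eq_right hlt.le
    set t₀ := b - K / E with ht₀
    have hc : ContinuousAt f t₀ := (h.hasDerivAt t₀ ⟨by linarith, by linarith⟩).continuousAt
    have hsn : Tendsto (fun t => jacobiSn m (z t) ^ 2) (𝓝[>] t₀) (𝓝[>] 0) := by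
      rw [tendsto_nhdsWithin_iff]
      constructor
      · have hcont : Continuous fun t => jacobiSn m (z t) ^ 2 := by
          have := (continuous_jacobiSn hm0 hm1).comp
            (continuous_iff_continuousAt.mpr fun t => (hzd t).continuousAt)
          exact this.pow 2
        have h1 := hcont.continuousAt (x := t₀) |>.tendsto.mono_left
          (nhdsWithin_le_nhds (s := Ioi t₀))
        have h2 : z t₀ = 0 := by
          simp only [hz, ht₀]
          field_simp
          ring
        simpa [h2, jacobiSn_zero hm0 hm1] using h1
      · filter_upwards [Ioo_mem_nhdsGT (by linarith : t₀ < b + K / E)] with t ht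
        have := hzmem ht
        exact Set.mem_Ioi.mpr (by positivity)
    have hyt : Tendsto y (𝓝[>] t₀) atTop :=
      tendsto_atTop_add_const_left _ _
        ((tendsto_inv_nhdsGT_zero.comp hsn).const_mul_atTop (by positivity))
    have hft : Tendsto f (𝓝[>] t₀) (𝓝 (f t₀)) := hc.tendsto.mono_left nhdsWithin_le_nhds
    refine not_tendsto_nhds_of_tendsto_atTop hyt _ (hft.congr' ?_)
    filter_upwards [Ioo_mem_nhdsGT (by linarith : t₀ < b + K / E)] with t ht
    exact key t (by rw [hδK]; exact ht)

end BlowUpSolution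

end RealWeierstrass

/-! ### The Weierstrass function on the sides of a rectangle -/

section Sides

open Complex Filter Topology PeriodPair Set
open scoped ComplexConjugate

theorem hasDerivAt_weierstrassP (L : PeriodPair) {z : ℂ} (hz : z ∉ L.lattice) :
    HasDerivAt L.weierstrassP (L.derivWeierstrassP z) z := by
  rw [← L.deriv_weierstrassP]
  exact (L.analyticOnNhd_weierstrassP z hz).differentiableAt.hasDerivAt

theorem tendsto_sq_mul_weierstrassP (L : PeriodPair) :
    Tendsto (fun z => z ^ 2 * L.weierstrassP z) (𝓝[≠] 0) (𝓝 1) := by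
  have h1 : ContinuousAt (fun z => z ^ 2 * L.weierstrassPExcept 0 z + 1) 0 := by
    have : ContinuousAt (L.weierstrassPExcept 0) 0 :=
      (L.analyticAt_weierstrassPExcept 0).continuousAt
    fun_prop
  have h2 : Tendsto (fun z => z ^ 2 * L.weierstrassPExcept 0 z + 1) (𝓝[≠] 0) (𝓝 1) := by
    simpa using h1.tendsto.mono_left nhdsWithin_le_nhds
  refine h2.congr' ?_
  filter_upwards [self_mem_nhdsWithin] with z (hz : z ≠ 0)
  have h := L.ite_eq_one_sub_sq_mul_weierstrassP 0 (zero_mem _) z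
  simpa [hz] using h.symm

theorem exists_derivWeierstrassP_ne_zero (L : PeriodPair) :
    ∃ z ∉ L.lattice, L.derivWeierstrassP z ≠ 0 := by
  by_contra! h
  obtain ⟨z₀, hz₀⟩ : ((L.lattice : Set ℂ)ᶜ).Nonempty := ⟨_, L.ω₁_div_two_notMem_lattice⟩
  have hconst : ∀ z ∉ L.lattice, L.weierstrassP z = L.weierstrassP z₀ := fun z hz =>
    (isOpen_compl_lattice L).is_const_of_deriv_eq_zero (isPreconnected_compl_lattice L)
      L.differentiableOn_weierstrassP (fun z hz => by simpa using h z hz) hz hz₀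
  have hev : ∀ᶠ z : ℂ in 𝓝[≠] 0, z ∉ L.lattice := by
    have := L.compl_lattice_sdiff_singleton_mem_nhds 0
    filter_upwards [self_mem_nhdsWithin, mem_nhdsWithin_of_mem_nhds this] with z hz hz'
    simp_all
  have h1 : Tendsto (fun z : ℂ => z ^ 2 * L.weierstrassP z₀) (𝓝[≠] 0) (𝓝 1) :=
    (tendsto_sq_mul_weierstrassP L).congr' (hev.mono fun z hz => by rw [hconst z hz])
  have h2 : Tendsto (fun z : ℂ => z ^ 2 * L.weierstrassP z₀) (𝓝[≠] 0) (𝓝 0) := by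
    have : Continuous fun z : ℂ => z ^ 2 * L.weierstrassP z₀ := by fun_prop
    simpa using (this.tendsto 0).mono_left nhdsWithin_le_nhds
  exact one_ne_zero (tendsto_nhds_unique h1 h2)

/-- Differentiating the cubic equation gives the claim multiplied by `℘'`. That factor can be
cancelled because analytic functions on a connected domain have no zero divisors and `℘' ≢ 0`. -/
theorem hasDerivAt_derivWeierstrassP (L : PeriodPair) {z : ℂ} (hz : z ∉ L.lattice) :
    HasDerivAt L.derivWeierstrassP (6 * L.weierstrassP z ^ 2 - L.g₂ / 2) z := by
  have hA := L.analyticOnNhd_derivWeierstrassP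
  have hP := L.analyticOnNhd_weierstrassP
  set G : ℂ → ℂ := fun z => deriv L.derivWeierstrassP z - (6 * L.weierstrassP z ^ 2 - L.g₂ / 2)
  have hG : AnalyticOnNhd ℂ G (L.lattice : Set ℂ)ᶜ :=
    hA.deriv.sub ((analyticOnNhd_const.mul (hP.pow 2)).sub analyticOnNhd_const)
  have hmul : ∀ z ∈ (L.lattice : Set ℂ)ᶜ, L.derivWeierstrassP z • G z = 0 := by
    intro z hz
    have h1 := (hasDerivAt_weierstrassP L hz)
    have h2 := ((h1.pow 3).const_mul 4 |>.sub (h1.const_mul L.g₂)).sub_const L.g₃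
    have h3 := (hA z hz).differentiableAt.hasDerivAt.pow 2
    have he : (L.derivWeierstrassP ^ 2) =ᶠ[𝓝 z]
        fun z => 4 * L.weierstrassP z ^ 3 - L.g₂ * L.weierstrassP z - L.g₃ := by
      filter_upwards [(isOpen_compl_lattice L).mem_nhds hz] with x hx
      exact L.derivWeierstrassP_sq x hx
    have h4 := h3.unique (h2.congr_of_eventuallyEq he)
    simp only [Nat.cast_ofNat, Nat.add_one_sub_one, pow_one] at h4
    simp only [G, smul_eq_mul]
    linear_combination h4 / 2
  obtain ⟨z₁, hz₁, hne⟩ := exists_derivWeierstrassP_ne_zero L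
  rcases AnalyticOnNhd.eq_zero_or_eq_zero_of_smul_eq_zero hA hG hmul
    (isPreconnected_compl_lattice L) with h | h
  · exact absurd (h z₁ hz₁) hne
  · rw [← sub_eq_zero.mp (h z hz)]
    exact (hA z hz).differentiableAt.hasDerivAt

variable {w w' : ℝ} (hw : 0 < w) (hw' : 0 < w')

local notation "L" => rectPair w w' hw hw'

theorem conj_G (n : ℕ) : conj (PeriodPair.G L n) = PeriodPair.G L n := by
  rw [PeriodPair.G, conj_tsum]
  conv_rhs => rw [← (conjLattice hw hw').tsum_eq]
  congr with l
  simp [conjLattice]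

theorem ofReal_re_g₂ : ((PeriodPair.g₂ L).re : ℂ) = PeriodPair.g₂ L := by
  rw [← conj_eq_iff_re, PeriodPair.g₂, map_mul, conj_G, map_ofNat]

theorem ofReal_re_g₃ : ((PeriodPair.g₃ L).re : ℂ) = PeriodPair.g₃ L := by
  rw [← conj_eq_iff_re, PeriodPair.g₃, map_mul, conj_G, map_ofNat]

/-- On a horizontal (`ε = 1`) or vertical (`ε = -1`) line where `℘` is real, the complex equation
becomes a real one; a vertical direction reverses the sign of the cubic. -/
theorem line_equation {z₀ d : ℂ} {ε : ℝ} (hd : d ^ 2 = ε)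
    (hr : ∀ t : ℝ, conj (PeriodPair.weierstrassP L (z₀ + t * d)) = PeriodPair.weierstrassP L (z₀ + t * d))
    {t : ℝ} (ht : z₀ + t * d ∉ PeriodPair.lattice L) :
    HasDerivAt (fun t : ℝ => (PeriodPair.weierstrassP L (z₀ + t * d)).re)
      (d * derivWeierstrassP L (z₀ + t * d)).re t ∧
    HasDerivAt (fun t : ℝ => (d * derivWeierstrassP L (z₀ + t * d)).re)
      (ε * (6 * (PeriodPair.weierstrassP L (z₀ + t * d)).re ^ 2 - (PeriodPair.g₂ L).re / 2)) t ∧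
    (d * derivWeierstrassP L (z₀ + t * d)).re ^ 2 =
      ε * (4 * (PeriodPair.weierstrassP L (z₀ + t * d)).re ^ 3 -
        (PeriodPair.g₂ L).re * (PeriodPair.weierstrassP L (z₀ + t * d)).re - (PeriodPair.g₃ L).re) := by
  have hl : HasDerivAt (fun s : ℂ => z₀ + s * d) d t := by
    simpa using ((hasDerivAt_id (t : ℂ)).mul_const d).const_add z₀
  have h1 : HasDerivAt (fun t : ℝ => PeriodPair.weierstrassP L (z₀ + t * d))
      (d * derivWeierstrassP L (z₀ + t * d)) t := by
    have := ((hasDerivAt_weierstrassP L ht).comp (t : ℂ) hl).comp_ofReal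
    rwa [mul_comm] at this
  have h2 : HasDerivAt (fun t : ℝ => d * derivWeierstrassP L (z₀ + t * d))
      (d * ((6 * PeriodPair.weierstrassP L (z₀ + t * d) ^ 2 - PeriodPair.g₂ L / 2) * d)) t := by
    have := ((hasDerivAt_derivWeierstrassP L ht).comp (t : ℂ) hl).comp_ofReal
    exact this.const_mul d
  have hre (t : ℝ) : (((PeriodPair.weierstrassP L (z₀ + t * d)).re : ℝ) : ℂ) = PeriodPair.weierstrassP L (z₀ + t * d) :=
    conj_eq_iff_re.mp (hr t)
  have h1' : HasDerivAt (fun t : ℝ => (PeriodPair.weierstrassP L (z₀ + t * d)).re)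
      (d * derivWeierstrassP L (z₀ + t * d)).re t :=
    (reCLM.hasFDerivAt.comp_hasDerivAt t h1)
  have hre' : (((d * derivWeierstrassP L (z₀ + t * d)).re : ℝ) : ℂ) =
      d * derivWeierstrassP L (z₀ + t * d) := by
    have h3 := h1'.ofReal_comp
    simp only [hre] at h3
    exact h3.unique h1
  refine ⟨h1', ?_, ?_⟩
  · refine (reCLM.hasFDerivAt.comp_hasDerivAt t h2).congr_deriv ?_
    rw [reCLM_apply, ← ofReal_re (_ * _ : ℝ)]
    congr 1
    push_cast
    rw [hre, ofReal_re_g₂, ← hd]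
    ring
  · apply ofReal_injective
    push_cast
    rw [hre', hre, ofReal_re_g₂, ofReal_re_g₃, ← hd, mul_pow, derivWeierstrassP_sq L _ ht]

/-! ### Real values of `℘` on the four lines through half-periods, and its behaviour at the origin
-/

theorem conj_wp_real (t : ℝ) :
    conj (PeriodPair.weierstrassP L (0 + t * 1)) = PeriodPair.weierstrassP L (0 + t * 1) := by
  rw [conj_weierstrassP]
  simp

theorem conj_wp_imag (t : ℝ) :
    conj (PeriodPair.weierstrassP L (0 + t * I)) = PeriodPair.weierstrassP L (0 + t * I) := by
  rw [conj_weierstrassP, ← weierstrassP_neg]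
  simp

theorem conj_wp_vertical (t : ℝ) :
    conj (PeriodPair.weierstrassP L (w + t * I)) = PeriodPair.weierstrassP L (w + t * I) := by
  rw [conj_weierstrassP, ← weierstrassP_neg, ← wp_add_period hw hw']
  congr 1
  simp
  ring

theorem conj_wp_horizontal (t : ℝ) :
    conj (PeriodPair.weierstrassP L (w' * I + t * 1)) = PeriodPair.weierstrassP L (w' * I + t * 1) := by
  rw [conj_weierstrassP, ← wp_add_period_I hw hw']
  congr 1
  simp
  ring

theorem tendsto_wp_line {d : ℂ} {ε : ℝ} (hd : d ^ 2 = ε) (hε : ε ^ 2 = 1) :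
    Tendsto (fun t : ℝ => ε * (PeriodPair.weierstrassP L (0 + t * d)).re) (𝓝[>] 0) atTop := by
  have hε0 : ε ≠ 0 := by rintro rfl; norm_num at hε
  have hd0 : d ≠ 0 := by
    rintro rfl
    exact hε0 (by simpa using hd.symm)
  have h1 : Tendsto (fun t : ℝ => 0 + t * d) (𝓝[>] 0) (𝓝[≠] 0) := by
    rw [tendsto_nhdsWithin_iff]
    constructor
    · have : Continuous fun t : ℝ => 0 + t * d := by fun_prop
      simpa using (this.tendsto 0).mono_left nhdsWithin_le_nhds
    · filter_upwards [self_mem_nhdsWithin] with t (ht : 0 < t)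
      simpa [hd0] using ht.ne'
  have h2 := (continuous_re.tendsto _).comp ((tendsto_sq_mul_weierstrassP L).comp h1)
  have h3 : Tendsto (fun t : ℝ => t ^ 2 * (ε * (PeriodPair.weierstrassP L (0 + t * d)).re)) (𝓝[>] 0) (𝓝 1) := by
    rw [one_re] at h2
    refine h2.congr fun t => ?_
    have e : (0 + (t : ℂ) * d) ^ 2 = ((t ^ 2 * ε : ℝ) : ℂ) := by
      push_cast
      rw [← hd]
      ring
    simp only [Function.comp_apply]
    rw [e, re_ofReal_mul]
    ring
  have h4 : Tendsto (fun t : ℝ => (t ^ 2)⁻¹) (𝓝[>] 0) atTop := by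
    refine tendsto_inv_nhdsGT_zero.comp ?_
    rw [tendsto_nhdsWithin_iff]
    constructor
    · have : Continuous fun t : ℝ => t ^ 2 := by fun_prop
      simpa using (this.tendsto 0).mono_left nhdsWithin_le_nhds
    · filter_upwards [self_mem_nhdsWithin] with t (ht : 0 < t)
      exact Set.mem_Ioi.mpr (by positivity)
  refine (h4.atTop_mul_pos one_pos h3).congr' ?_
  filter_upwards [self_mem_nhdsWithin] with t (ht : 0 < t)
  have := ht.ne'
  field_simp

theorem real_notMem {t : ℝ} (ht : t ∈ Ioo 0 (2 * w)) :
    (0 + t * 1 : ℂ) ∉ PeriodPair.lattice L :=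
  notMem_of_re hw hw' (by simpa using ht.1) (by simpa using ht.2)

theorem imag_notMem {t : ℝ} (ht : t ∈ Ioo 0 (2 * w')) :
    (0 + t * I : ℂ) ∉ PeriodPair.lattice L :=
  notMem_of_im hw hw' (by simpa using ht.1) (by simpa using ht.2)

theorem vertical_notMem (t : ℝ) : (w + t * I : ℂ) ∉ PeriodPair.lattice L :=
  notMem_of_re hw hw' (by simpa using hw) (by simp; linarith)

theorem horizontal_notMem (t : ℝ) : (w' * I + t * 1 : ℂ) ∉ PeriodPair.lattice L :=
  notMem_of_im hw hw' (by simpa using hw') (by simp; linarith)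

theorem blowUpSolution_real : BlowUpSolution (fun t : ℝ => (PeriodPair.weierstrassP L (0 + t * 1)).re)
    (fun t : ℝ => (1 * derivWeierstrassP L (0 + t * 1)).re) w
    (PeriodPair.g₂ L).re (PeriodPair.g₃ L).re where
  pos := hw
  hasDerivAt x hx :=
    (line_equation hw hw' (ε := 1) (by simp) (conj_wp_real hw hw') (real_notMem hw hw' hx)).1
  hasDerivAt' x hx := by
    simpa using
      (line_equation hw hw' (ε := 1) (by simp) (conj_wp_real hw hw') (real_notMem hw hw' hx)).2.1
  deriv_sq x hx := by
    simpa using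
      (line_equation hw hw' (ε := 1) (by simp) (conj_wp_real hw hw') (real_notMem hw hw' hx)).2.2
  symm x := by
    rw [← weierstrassP_neg, ← wp_add_period hw hw']
    congr 2
    push_cast
    ring
  tendsto := by simpa using tendsto_wp_line hw hw' (d := 1) (ε := 1) (by simp) (by simp)

/-- The rotation `z ↦ iz` replaces `℘` by `-℘`, keeps `g₂` and negates `g₃`, so the imaginary side
becomes another instance of the real problem. -/
theorem blowUpSolution_imag : BlowUpSolution (fun t : ℝ => -(PeriodPair.weierstrassP L (0 + t * I)).re)
    (fun t : ℝ => -(I * derivWeierstrassP L (0 + t * I)).re) w'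
    (PeriodPair.g₂ L).re (-(PeriodPair.g₃ L).re) where
  pos := hw'
  hasDerivAt x hx :=
    (line_equation hw hw' (ε := -1) (by simp) (conj_wp_imag hw hw') (imag_notMem hw hw' hx)).1.fun_neg
  hasDerivAt' x hx := by
    refine (line_equation hw hw' (ε := -1) (by simp) (conj_wp_imag hw hw')
      (imag_notMem hw hw' hx)).2.1.fun_neg.congr_deriv ?_
    ring
  deriv_sq x hx := by
    have := (line_equation hw hw' (ε := -1) (by simp) (conj_wp_imag hw hw')
      (imag_notMem hw hw' hx)).2.2
    rw [neg_sq, this]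
    ring
  symm x := by
    rw [← weierstrassP_neg, ← wp_add_period_I hw hw']
    congr 3
    push_cast
    ring
  tendsto := by simpa using tendsto_wp_line hw hw' (d := I) (ε := -1) (by simp) (by simp)

/-- The value of `℘` at the real half-period. -/
def wpReal : ℝ := (PeriodPair.weierstrassP L w).re

/-- The value of `℘` at the imaginary half-period. -/
def wpImag : ℝ := (PeriodPair.weierstrassP L (w' * I)).re

/-- The value of `℘` at the sum of the half-periods. -/
def wpSum : ℝ := (PeriodPair.weierstrassP L (w + w' * I)).re

local notation "ε₁" => wpReal hw hw'
local notation "ε₂" => wpSum hw hw'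
local notation "ε₃" => wpImag hw hw'
local notation "g₂" => Complex.re (PeriodPair.g₂ (rectPair w w' hw hw'))
local notation "g₃" => Complex.re (PeriodPair.g₃ (rectPair w w' hw hw'))

theorem cubic_pos_of_wpReal_lt {y : ℝ} (hy : ε₁ < y) : 0 < 4 * y ^ 3 - g₂ * y - g₃ :=
  (blowUpSolution_real hw hw').cubic_pos (by simpa [wpReal] using hy)

theorem cubic_wpReal : 4 * ε₁ ^ 3 - g₂ * ε₁ - g₃ = 0 := by
  simpa [wpReal] using (blowUpSolution_real hw hw').cubic_eq_zero

theorem cubic_deriv_wpReal : 12 * ε₁ ^ 2 - g₂ ≠ 0 := by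
  simpa [wpReal] using (blowUpSolution_real hw hw').cubic_simple

theorem cubic_neg_of_lt_wpImag {y : ℝ} (hy : y < ε₃) : 4 * y ^ 3 - g₂ * y - g₃ < 0 := by
  have := (blowUpSolution_imag hw hw').cubic_pos (y := -y) (by simpa [wpImag] using hy)
  nlinarith

theorem cubic_wpImag : 4 * ε₃ ^ 3 - g₂ * ε₃ - g₃ = 0 := by
  have := (blowUpSolution_imag hw hw').cubic_eq_zero
  simp only [zero_add] at this
  rw [wpImag]
  linarith

theorem cubic_deriv_wpImag : 12 * ε₃ ^ 2 - g₂ ≠ 0 := by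
  simpa [wpImag] using (blowUpSolution_imag hw hw').cubic_simple

/-- On this side the cubic is minus a square, while above `ε₁` it is positive. -/
theorem vertical_le (t : ℝ) : (PeriodPair.weierstrassP L (w + t * I)).re ≤ ε₁ := by
  have := (line_equation hw hw' (ε := -1) (by simp) (conj_wp_vertical hw hw')
      (vertical_notMem hw hw' t)).2.2
  by_contra! h
  nlinarith [cubic_pos_of_wpReal_lt hw hw' h, sq_nonneg (I * derivWeierstrassP L (w + t * I)).re]

theorem le_horizontal (t : ℝ) : ε₃ ≤ (PeriodPair.weierstrassP L (w' * I + t * 1)).re := by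
  have := (line_equation hw hw' (ε := 1) (by simp) (conj_wp_horizontal hw hw')
      (horizontal_notMem hw hw' t)).2.2
  by_contra! h
  nlinarith [cubic_neg_of_lt_wpImag hw hw' h,
    sq_nonneg (1 * derivWeierstrassP L (w' * I + t * 1)).re]

theorem wpSum_le : ε₂ ≤ ε₁ := vertical_le hw hw' w'

theorem le_wpSum : ε₃ ≤ ε₂ := by
  have := le_horizontal hw hw' w
  rwa [mul_one, add_comm] at this

/-- If both values agreed, an interior minimum of `℘` on the vertical side would be a critical
point, hence a root of the cubic, which is negative below the common value. So `℘` would be constant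
on that side and the root would be double. -/
theorem wpImag_lt_wpReal : ε₃ < ε₁ := by
  refine ((le_wpSum hw hw').trans (wpSum_le hw hw')).lt_of_ne fun heq => ?_
  set h : ℝ → ℝ := fun t => (PeriodPair.weierstrassP L (w + t * I)).re with hh
  have hd (t : ℝ) := line_equation hw hw' (ε := -1) (by simp) (conj_wp_vertical hw hw')
      (vertical_notMem hw hw' t)
  have hcont : Continuous h := continuous_iff_continuousAt.mpr fun t => (hd t).1.continuousAt
  obtain ⟨t₀, ht₀, hmin⟩ := isCompact_Icc.exists_isMinOn
    (nonempty_Icc.mpr (by linarith : (0 : ℝ) ≤ 2 * w')) hcont.continuousOn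
  have hend : h 0 = ε₁ := by simp [hh, wpReal]
  have hend' : h (2 * w') = ε₁ := by
    have := wp_add_period_I hw hw' w
    simp only [hh, wpReal]
    rw [this]
  have hval : h t₀ = ε₁ := by
    rcases eq_or_lt_of_le ht₀.1 with h0 | h0
    · rw [← h0, hend]
    rcases eq_or_lt_of_le ht₀.2 with h1 | h1
    · rw [h1, hend']
    have hz := (hmin.isLocalMin (Icc_mem_nhds h0 h1)).hasDerivAt_eq_zero (hd t₀).1
    have h2 := (hd t₀).2.2
    rw [hz] at h2
    refine le_antisymm (vertical_le hw hw' t₀) ?_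
    by_contra! hlt
    rw [← heq] at hlt
    linarith [cubic_neg_of_lt_wpImag hw hw' hlt]
  have hall : ∀ t ∈ Icc 0 (2 * w'), h t = ε₁ := fun t ht =>
    le_antisymm (vertical_le hw hw' t) (hval ▸ hmin ht)
  have hz : ∀ t ∈ Ioo 0 (2 * w'), (I * derivWeierstrassP L (w + t * I)).re = 0 := by
    intro t ht
    refine (hd t).1.unique ((hasDerivAt_const t ε₁).congr_of_eventuallyEq ?_)
    filter_upwards [Ioo_mem_nhds ht.1 ht.2] with s hs using hall s (Ioo_subset_Icc_self hs)
  have h3 := (hd w').2.1.unique ((hasDerivAt_const w' (0 : ℝ)).congr_of_eventuallyEq (by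
    filter_upwards [Ioo_mem_nhds hw' (by linarith : w' < 2 * w')] with s hs using hz s hs))
  have h4 := hall w' ⟨hw'.le, by linarith⟩
  simp only [hh] at h4
  rw [h4] at h3
  exact cubic_deriv_wpReal hw hw' (by linarith)

theorem g₂_eq : g₂ = 4 * (ε₁ ^ 2 + ε₁ * ε₃ + ε₃ ^ 2) := by
  have h := sub_ne_zero.mpr (wpImag_lt_wpReal hw hw').ne'
  apply mul_left_cancel₀ h
  linear_combination cubic_wpImag hw hw' - cubic_wpReal hw hw'

/-- The third root of the cubic, found from the vanishing sum of roots. It lies between the other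
two because the cubic is positive above `ε₁` and negative below `ε₃`, and strictly so because these
roots are simple. -/
theorem wpReal_add_wpImag : ε₃ < -(ε₁ + ε₃) ∧ -(ε₁ + ε₃) < ε₁ := by
  have hlt := wpImag_lt_wpReal hw hw'
  have hg := g₂_eq hw hw'
  have hq (y : ℝ) : 4 * y ^ 3 - g₂ * y - g₃ = 4 * (y - ε₁) * (y - ε₃) * (y + (ε₁ + ε₃)) := by
    linear_combination cubic_wpReal hw hw' + (ε₁ - y) * hg
  constructor
  · refine lt_of_le_of_ne ?_ fun h => cubic_deriv_wpImag hw hw' ?_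
    · by_contra! h
      have := cubic_neg_of_lt_wpImag hw hw' (y := (-(ε₁ + ε₃) + ε₃) / 2) (by linarith)
      rw [hq] at this
      have h1 : (-(ε₁ + ε₃) + ε₃) / 2 - ε₁ < 0 := by linarith
      have h2 : (-(ε₁ + ε₃) + ε₃) / 2 - ε₃ < 0 := by linarith
      have h3 : 0 < (-(ε₁ + ε₃) + ε₃) / 2 + (ε₁ + ε₃) := by linarith
      have := mul_pos (mul_pos_of_neg_of_neg h1 h2) h3
      linarith
    · rw [hg]
      have : ε₁ = -2 * ε₃ := by linarith
      rw [this]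
      ring
  · refine lt_of_le_of_ne ?_ fun h => cubic_deriv_wpReal hw hw' ?_
    · by_contra! h
      have := cubic_pos_of_wpReal_lt hw hw' (y := (-(ε₁ + ε₃) + ε₁) / 2) (by linarith)
      rw [hq] at this
      have h1 : 0 < (-(ε₁ + ε₃) + ε₁) / 2 - ε₁ := by linarith
      have h2 : 0 < (-(ε₁ + ε₃) + ε₁) / 2 - ε₃ := by linarith
      have h3 : (-(ε₁ + ε₃) + ε₁) / 2 + (ε₁ + ε₃) < 0 := by linarith
      have := mul_neg_of_pos_of_neg (mul_pos h1 h2) h3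
      linarith
    · rw [hg]
      have : ε₃ = -2 * ε₁ := by linarith
      rw [this]
      ring

theorem sqrt_mul_half_period_real :
    Real.sqrt (ε₁ - ε₃) * w = ellipticK ((-(ε₁ + ε₃) - ε₃) / (ε₁ - ε₃)) := by
  have h := wpReal_add_wpImag hw hw'
  have := (blowUpSolution_real hw hw').sqrt_mul_half_period (e₂ := -(ε₁ + ε₃)) (e₃ := ε₃) h.1
    (by simpa [wpReal] using h.2) (by simp [wpReal]) (by
      rw [g₂_eq]
      simp only [zero_add, mul_one]
      rw [← wpReal]
      ring)
  simpa [wpReal] using this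

/-- For the rotated problem the roots change sign and hence order, which replaces the modulus by its
complement. -/
theorem sqrt_mul_half_period_imag :
    Real.sqrt (ε₁ - ε₃) * w' = ellipticK ((ε₁ + (ε₁ + ε₃)) / (ε₁ - ε₃)) := by
  have h := wpReal_add_wpImag hw hw'
  have := (blowUpSolution_imag hw hw').sqrt_mul_half_period (e₂ := ε₁ + ε₃) (e₃ := -ε₁)
    (by linarith)
    (by simp only [zero_add]; rw [← wpImag]; linarith)
    (by simp only [zero_add]; rw [← wpImag]; ring) (by
      rw [g₂_eq]
      simp only [zero_add]
      rw [← wpImag]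
      ring)
  simp only [zero_add] at this
  rw [← wpImag] at this
  rw [show ε₁ - ε₃ = -ε₃ - -ε₁ by ring, this]
  congr 1
  ring

/-- Along the boundary of the rectangle, starting at the pole `0`, the real function `℘` runs from
`+∞` through `ε₁`, `ε₂`, `ε₃` to `-∞`; the four cases are the four sides. -/
theorem exists_wp_eq (V : ℝ) : ∃ a : ℂ, a ∉ PeriodPair.lattice L ∧ PeriodPair.weierstrassP L a = V ∧
    0 ≤ a.re ∧ a.re ≤ w ∧ 0 ≤ a.im ∧ a.im ≤ w' := by
  rcases le_total ε₁ V with h | h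
  · obtain ⟨t, ht, htV⟩ := (blowUpSolution_real hw hw').exists_eq (y := V) (by simpa [wpReal] using h)
    have hm : t ∈ Ioo 0 (2 * w) := ⟨ht.1, by linarith [ht.2]⟩
    refine ⟨0 + t * 1, real_notMem hw hw' hm, ?_, by simpa using ht.1.le, by simpa using ht.2,
      by simp, by simpa using hw'.le⟩
    rw [← htV, conj_eq_iff_re.mp (conj_wp_real hw hw' t)]
  rcases le_total V ε₃ with h' | h'
  · obtain ⟨t, ht, htV⟩ := (blowUpSolution_imag hw hw').exists_eq (y := -V)
      (by simpa [wpImag] using h')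
    have hm : t ∈ Ioo 0 (2 * w') := ⟨ht.1, by linarith [ht.2]⟩
    refine ⟨0 + t * I, imag_notMem hw hw' hm, ?_, by simp, by simpa using hw.le,
      by simpa using ht.1.le, by simpa using ht.2⟩
    rw [← neg_inj.mp htV, conj_eq_iff_re.mp (conj_wp_imag hw hw' t)]
  rcases le_total ε₂ V with h'' | h''
  · have hc : ContinuousOn (fun t : ℝ => (PeriodPair.weierstrassP L (w + t * I)).re) (Icc 0 w') := fun t _ =>
      (line_equation hw hw' (ε := -1) (by simp) (conj_wp_vertical hw hw')
        (vertical_notMem hw hw' t)).1.continuousAt.continuousWithinAt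
    obtain ⟨t, ht, htV⟩ := intermediate_value_Icc' hw'.le hc
      (show V ∈ Icc _ _ from ⟨h'', by simpa [wpReal] using h⟩)
    refine ⟨w + t * I, vertical_notMem hw hw' t, ?_, by simpa using hw.le, by simp,
      by simpa using ht.1, by simpa using ht.2⟩
    rw [← htV, conj_eq_iff_re.mp (conj_wp_vertical hw hw' t)]
  · have hc : ContinuousOn (fun t : ℝ => (PeriodPair.weierstrassP L (w' * I + t * 1)).re) (Icc 0 w) := fun t _ =>
      (line_equation hw hw' (ε := 1) (by simp) (conj_wp_horizontal hw hw')
        (horizontal_notMem hw hw' t)).1.continuousAt.continuousWithinAt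
    obtain ⟨t, ht, htV⟩ := intermediate_value_Icc hw.le hc
      (show V ∈ Icc _ _ from ⟨by simpa [wpImag] using h',
        by rw [mul_one, add_comm]; exact h''⟩)
    refine ⟨w' * I + t * 1, horizontal_notMem hw hw' t, ?_, by simpa using ht.1, by simpa using ht.2,
      by simpa using hw'.le, by simp⟩
    rw [← htV, conj_eq_iff_re.mp (conj_wp_horizontal hw hw' t)]

end Sides

/-! ### Reduction of `℘` to the Jacobi sine -/

section Reduction

open Complex PeriodPair Set

variable {m : ℝ} (h0 : 0 < m) (h1 : m < 1)

theorem ellipticK_compl_pos (h0 : 0 < m) (h1 : m < 1) : 0 < ellipticK (1 - m) :=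
  ellipticK_pos (by linarith) (by linarith)

/-- The lattice with half-periods `K(m)` and `i K(1 - m)`. -/
def ellipticPair : PeriodPair :=
  rectPair (ellipticK m) (ellipticK (1 - m)) (ellipticK_pos h0.le h1) (ellipticK_compl_pos h0 h1)

theorem lattice_eq : lattice m = (ellipticPair h0 h1).lattice := if_neg h0.ne'

/-- With `E = √(e₁ - e₃)` and `μ` the modulus of the cubic, `E K(m) = K(μ)` and `E K(1 - m) = K(1 -
μ)`. If `μ < m`, monotonicity of `K` makes `E < 1` by the first relation and `E > 1` by the second,
and symmetrically if `μ > m`. So `μ = m` and `E = 1`, which together determine the roots. -/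
theorem wp_half_periods :
    wpReal (ellipticK_pos h0.le h1) (ellipticK_compl_pos h0 h1) = (2 - m) / 3 ∧
    wpImag (ellipticK_pos h0.le h1) (ellipticK_compl_pos h0 h1) = -(1 + m) / 3 := by
  have hlt := wpImag_lt_wpReal (ellipticK_pos h0.le h1) (ellipticK_compl_pos h0 h1)
  have hr := wpReal_add_wpImag (ellipticK_pos h0.le h1) (ellipticK_compl_pos h0 h1)
  have hA := sqrt_mul_half_period_real (ellipticK_pos h0.le h1) (ellipticK_compl_pos h0 h1)
  have hB := sqrt_mul_half_period_imag (ellipticK_pos h0.le h1) (ellipticK_compl_pos h0 h1)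
  generalize wpReal (ellipticK_pos h0.le h1) (ellipticK_compl_pos h0 h1) = e₁ at *
  generalize wpImag (ellipticK_pos h0.le h1) (ellipticK_compl_pos h0 h1) = e₃ at *
  have hd : 0 < e₁ - e₃ := by linarith
  set μ := (-(e₁ + e₃) - e₃) / (e₁ - e₃) with hμ
  have hμ0 : 0 < μ := div_pos (by linarith) hd
  have hμ1 : μ < 1 := (div_lt_one hd).mpr (by linarith)
  have hμ' : (e₁ + (e₁ + e₃)) / (e₁ - e₃) = 1 - μ := by
    rw [hμ]
    field_simp
    ring
  rw [hμ'] at hB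
  have hK := ellipticK_pos h0.le h1
  have hK' := ellipticK_compl_pos h0 h1
  have hmμ : μ = m := by
    rcases lt_trichotomy μ m with hlt | heq | hlt
    · have l1 := ellipticK_lt_ellipticK hμ0.le hlt h1
      have l2 := ellipticK_lt_ellipticK (m := 1 - m) (m' := 1 - μ) (by linarith) (by linarith)
        (by linarith)
      rw [← hA] at l1
      rw [← hB] at l2
      have : Real.sqrt (e₁ - e₃) < 1 := by
        by_contra! h
        nlinarith
      nlinarith
    · exact heq
    · have l1 := ellipticK_lt_ellipticK h0.le hlt hμ1
      have l2 := ellipticK_lt_ellipticK (m := 1 - μ) (m' := 1 - m) (by linarith) (by linarith)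
        (by linarith)
      rw [← hA] at l1
      rw [← hB] at l2
      have : Real.sqrt (e₁ - e₃) < 1 := by
        by_contra! h
        nlinarith
      nlinarith
  have hs : Real.sqrt (e₁ - e₃) = 1 := by
    rw [hmμ] at hA
    exact mul_right_cancel₀ hK.ne' (by rw [hA, one_mul])
  have hd1 : e₁ - e₃ = 1 := by
    rw [← Real.sq_sqrt hd.le, hs, one_pow]
  rw [hd1, div_one, hmμ] at hμ
  constructor <;> linarith

/-- On the horizontal line through the imaginary half-period, `℘` is given by the Jacobi sine. -/
theorem wp_shifted (u : ℝ) :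
    (ellipticPair h0 h1).weierstrassP (u + ellipticK (1 - m) * I) =
      ((m * jacobiSn m u ^ 2 - (m + 1) / 3 : ℝ) : ℂ) := by
  have hw := ellipticK_pos h0.le h1
  have hw' := ellipticK_compl_pos h0 h1
  have hd (t : ℝ) := line_equation hw hw' (ε := 1) (by simp) (conj_wp_horizontal hw hw')
      (horizontal_notMem hw hw' t)
  obtain ⟨he1, he3⟩ := wp_half_periods h0 h1
  have hg : (PeriodPair.g₂ (rectPair _ _ hw hw')).re / 2 = 2 * (m ^ 2 - m + 1) / 3 := by
    rw [g₂_eq, he1, he3]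
    ring
  have hz : (PeriodPair.weierstrassP (rectPair _ _ hw hw') (ellipticK (1 - m) * I + (0 : ℝ) * 1)).re =
      -(1 + m) / 3 := by
    rw [← he3, wpImag]
    simp
  -- The derivative vanishes at the half-period because its square is the cubic at one of its roots.
  have hz' : (1 * derivWeierstrassP (rectPair _ _ hw hw')
      (ellipticK (1 - m) * I + (0 : ℝ) * 1)).re = 0 := by
    have h2 := (hd 0).2.2
    rw [hz, ← he3, cubic_wpImag] at h2
    simpa using h2
  have key := weierstrass_ode_unique (s := univ) ordConnected_univ
    (fun t _ => (hd t).1)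
    (fun t _ => (hd t).2.1.congr_deriv (by rw [hg, one_mul]))
    (fun t _ => hasDerivAt_jacobiSn_sq h0.le h1 t) (fun t _ => hasDerivAt_jacobiSn_sq' h0.le h1 t)
    (mem_univ 0) (by rw [hz, jacobiSn_zero h0.le h1]; ring)
    (by rw [hz', jacobiSn_zero h0.le h1]; ring) u (mem_univ u)
  rw [← key, conj_eq_iff_re.mp (conj_wp_horizontal hw hw' u), mul_one, add_comm, ellipticPair]

end Reduction

/-! ### Hill's equation of a cnoidal wave -/

section Profile

variable {c m V : ℝ}

theorem continuous_profile (h0 : 0 ≤ m) (h1 : m < 1) : Continuous (profile c m V) := by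
  have := (continuous_jacobiSn h0 h1).comp (continuous_const_mul (ellipticK m / Real.pi))
  exact (((this.pow 2).const_mul m).const_add _).const_mul _

theorem profile_add_two_pi (h0 : 0 ≤ m) (h1 : m < 1) (x : ℝ) :
    profile c m V (x + 2 * Real.pi) = profile c m V x := by
  have e : ellipticK m / Real.pi * (x + 2 * Real.pi) =
      ellipticK m / Real.pi * x + 2 * ellipticK m := by
    field_simp [Real.pi_ne_zero]
  rw [profile, e, jacobiSn_sq_add_two_mul_ellipticK h0 h1, profile]

theorem exists_abs_profile_le (c m V : ℝ) : ∃ C, ∀ x, |profile c m V x| ≤ C := by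
  refine ⟨|c * ellipticK m ^ 2 / (3 * Real.pi ^ 2)| * (|V / 2 - (m + 1) / 3| + |m|), fun x => ?_⟩
  rw [profile, abs_mul]
  gcongr
  refine (abs_add_le _ _).trans ?_
  refine add_le_add_right ?_ _
  rw [abs_mul, abs_of_nonneg (sq_nonneg (jacobiSn _ _))]
  exact mul_le_of_le_one_right (abs_nonneg m) (Real.sin_sq_le_one _)

theorem six_div_mul_profile (hc : c ≠ 0) (x : ℝ) : 6 / c * profile c m V x =
    (ellipticK m / Real.pi) ^ 2 *
      (2 * (m * jacobiSn m (ellipticK m / Real.pi * x) ^ 2 - (m + 1) / 3) + V) := by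
  rw [profile]
  field_simp
  ring

end Profile

/-! ### Hermite's solution on the cnoidal line, for `0 < m < 1` -/

section Elliptic

open Complex PeriodPair

variable {c m V : ℝ} (h0 : 0 < m) (h1 : m < 1)

theorem shifted_notMem (u : ℝ) :
    (u : ℂ) + ellipticK (1 - m) * I ∉ (ellipticPair h0 h1).lattice :=
  notMem_of_im _ _ (by simpa using ellipticK_compl_pos h0 h1)
    (by simpa using by linarith [ellipticK_compl_pos h0 h1])

/-- Hermite's solution, as a solution of Hill's equation of the cnoidal wave. -/
def hillSolution (a : ℂ) (x : ℝ) : ℂ :=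
  lameSolution (ellipticPair h0 h1) a ((ellipticK m / Real.pi * x : ℝ) + ellipticK (1 - m) * I)

theorem solvesLinear_hillSolution (hc : c ≠ 0) {a : ℂ} (ha : a ∉ (ellipticPair h0 h1).lattice)
    (hV : (ellipticPair h0 h1).weierstrassP a = V) :
    SolvesLinear (fun x => 6 / c * profile c m V x) (hillSolution h0 h1 a)
      (fun x => deriv (lameSolution (ellipticPair h0 h1) a)
        ((ellipticK m / Real.pi * x : ℝ) + ellipticK (1 - m) * I) * (ellipticK m / Real.pi : ℝ)) := by
  have hl (x : ℝ) : HasDerivAt (fun x : ℝ => ((ellipticK m / Real.pi * x : ℝ) : ℂ) +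
      ellipticK (1 - m) * I) ((ellipticK m / Real.pi : ℝ) : ℂ) x := by
    have := ((hasDerivAt_id x).const_mul (ellipticK m / Real.pi)).ofReal_comp.add_const
      (ellipticK (1 - m) * I : ℂ)
    simpa using this
  constructor
  · intro x
    exact (differentiableAt_lameSolution _ (shifted_notMem h0 h1 _)).hasDerivAt.comp x (hl x)
  · intro x
    refine (((hasDerivAt_deriv_lameSolution _ ha (shifted_notMem h0 h1 _)).comp x
      (hl x)).mul_const _).congr_deriv ?_
    rw [wp_shifted, hV, six_div_mul_profile hc, hillSolution, real_smul]
    push_cast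
    ring

theorem hillSolution_add_two_pi (a : ℂ) (x : ℝ) :
    hillSolution h0 h1 a (x + 2 * Real.pi) = exp (2 * -floquetExponent (ellipticK m)
      (ellipticPair h0 h1).lattice a) * hillSolution h0 h1 a x := by
  have e : ellipticK m / Real.pi * (x + 2 * Real.pi) =
      ellipticK m / Real.pi * x + 2 * ellipticK m := by
    field_simp [Real.pi_ne_zero]
  have hK := ellipticK_pos h0.le h1
  have h := lameSolution_add (ellipticPair h0 h1) (a := a)
    (two_mul_half_period_mem hK (ellipticK_compl_pos h0 h1))
    (by simpa [ellipticPair] using half_period_notMem hK (ellipticK_compl_pos h0 h1))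
    (shifted_notMem h0 h1 (ellipticK m / Real.pi * x))
  rw [hillSolution, e, hillSolution, ofReal_add, add_right_comm, h, floquetExponent]
  congr 2
  push_cast
  rw [mul_div_cancel_left₀ _ two_ne_zero]
  ring

theorem hillSolution_eq_zero_iff {a : ℂ} {x : ℝ} : hillSolution h0 h1 a x = 0 ↔
    ((ellipticK m / Real.pi * x : ℝ) : ℂ) + ellipticK (1 - m) * I + a ∈
      (ellipticPair h0 h1).lattice :=
  lameSolution_eq_zero_iff _ (shifted_notMem h0 h1 _)

theorem mem_ellipticPair_lattice {z : ℂ} : z ∈ (ellipticPair h0 h1).lattice ↔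
    ∃ j k : ℤ, z.re = 2 * ellipticK m * j ∧ z.im = 2 * ellipticK (1 - m) * k :=
  mem_rectPair_lattice _ _

theorem exists_hillSolution_ne_zero (a : ℂ) : ∃ t, hillSolution h0 h1 a t ≠ 0 := by
  by_contra! h
  have hK := ellipticK_pos h0.le h1
  have hz (x : ℝ) := (hillSolution_eq_zero_iff h0 h1).mp (h x)
  have e1 := sub_mem (hz Real.pi) (hz 0)
  have e2 : ((ellipticK m / Real.pi * Real.pi : ℝ) : ℂ) + ellipticK (1 - m) * I + a -
      (((ellipticK m / Real.pi * 0 : ℝ) : ℂ) + ellipticK (1 - m) * I + a) = ellipticK m := by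
    rw [div_mul_cancel₀ _ Real.pi_ne_zero]
    push_cast
    ring
  rw [e2] at e1
  exact half_period_notMem hK (ellipticK_compl_pos h0 h1) e1

theorem trace_elliptic (h0 : 0 < m) (h1 : m < 1) (hc : c ≠ 0) {a : ℂ} (ha : IsInverseWp m V a) {ψ : Fin 2 → ℝ → ℝ}
    {M : Matrix.SpecialLinearGroup (Fin 2) ℝ} (hψ : IsFundamentalSystem c (profile c m V) ψ)
    (hM : IsMonodromy ψ M) :
    ((M : Matrix (Fin 2) (Fin 2) ℝ).trace : ℂ) =
      2 * cosh (2 * floquetExponent (ellipticK m) (lattice m) a) := by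
  rw [IsInverseWp, wp, lattice_eq h0 h1, weierstrassP_lattice] at ha
  obtain ⟨t, ht⟩ := exists_hillSolution_ne_zero h0 h1 a
  rw [lattice_eq h0 h1, hM.trace_eq hc (continuous_profile h0.le h1) hψ
    (solvesLinear_hillSolution h0 h1 hc ha.1 ha.2) ht (hillSolution_add_two_pi h0 h1 a), mul_neg,
    cosh_neg]

/-- Two zeros differ by a lattice vector that is real, a multiple of `2K` in `u` and hence of `2π`
in `x`. -/
theorem hillSolution_zero_unique {a : ℂ} {x₀ x : ℝ} (hx₀ : hillSolution h0 h1 a x₀ = 0)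
    (hx : hillSolution h0 h1 a x = 0) : ∃ n : ℤ, x = x₀ + n * (2 * Real.pi) := by
  have hK := ellipticK_pos h0.le h1
  rw [hillSolution_eq_zero_iff] at hx hx₀
  obtain ⟨j, k, hj, -⟩ := (mem_ellipticPair_lattice h0 h1).mp (sub_mem hx hx₀)
  refine ⟨j, ?_⟩
  simp at hj
  have hpi := Real.pi_pos
  field_simp at hj
  linarith

/-- For `Im a = ±K(1 - m)` the shifted line passes through lattice points, at height `2K(1 - m)` or
`0`. -/
theorem exists_hillSolution_eq_zero {a : ℂ} (h : |a.im| = ellipticK (1 - m)) :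
    ∃ x, hillSolution h0 h1 a x = 0 := by
  have hK := ellipticK_pos h0.le h1
  refine ⟨-a.re * Real.pi / ellipticK m, ?_⟩
  rw [hillSolution_eq_zero_iff, mem_ellipticPair_lattice]
  have e : ellipticK m / Real.pi * (-a.re * Real.pi / ellipticK m) = -a.re := by
    field_simp [Real.pi_ne_zero]
  rw [e]
  rcases eq_or_eq_neg_of_abs_eq h with h | h
  · exact ⟨0, 1, by simp, by simp [h]; ring⟩
  · exact ⟨0, 0, by simp, by simp [h]⟩

theorem uniform_value_elliptic (h0 : 0 < m) (h1 : m < 1) (hc : c ≠ 0) {k : ℝ}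
    (hk : IsUniformRepresentative c (profile c m V) k) {a : ℂ} (ha : IsInverseWp m V a)
    (him : |a.im| ≤ ellipticK (1 - m)) :
    (k : ℂ) = c / (6 * Real.pi ^ 2) * floquetExponent (ellipticK m) (lattice m) a ^ 2 := by
  rw [IsInverseWp, wp, lattice_eq h0 h1, weierstrassP_lattice] at ha
  have hK := ellipticK_pos h0.le h1
  have hK' := ellipticK_compl_pos h0 h1
  have hsol := solvesLinear_hillSolution h0 h1 hc ha.1 ha.2
  rw [lattice_eq h0 h1]
  -- On the edge of the strip there is one zero per period; inside it there is a logarithm. The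
  -- multiplier involves `-s`, harmless after squaring.
  rcases him.eq_or_lt with h | h
  · obtain ⟨x₀, hx₀⟩ := exists_hillSolution_eq_zero h0 h1 h
    obtain ⟨t, ht⟩ := exists_hillSolution_ne_zero h0 h1 a
    rw [← neg_sq (floquetExponent _ _ _)]
    refine uniform_value_of_one_zero hc hk hsol hx₀ ht
      (fun x hx => hillSolution_zero_unique h0 h1 hx₀ hx) (hillSolution_add_two_pi h0 h1 a) ?_
    have := floquetExponent_im_of_abs_im_eq hK hK' ha.1 h
    rw [neg_im, neg_inj, neg_eq_iff_eq_neg]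
    exact this.symm
  · obtain ⟨g, hg, hexp, hadd⟩ := exists_log_lameSolution hK hK' h
    rw [← neg_sq (floquetExponent _ _ _)]
    have he : hillSolution h0 h1 a = fun x => exp (g (ellipticK m / Real.pi * x)) :=
      funext fun x => (hexp _).symm
    rw [he] at hsol
    refine uniform_value_of_exp (g := fun x => g (ellipticK m / Real.pi * x)) hc hk hsol
      (hg.comp (by fun_prop)) fun x => ?_
    have e : ellipticK m / Real.pi * (x + 2 * Real.pi) =
        ellipticK m / Real.pi * x + 2 * ellipticK m := by
      field_simp [Real.pi_ne_zero]
    rw [e, hadd]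
    simp only [ellipticPair]
    ring

theorem exists_isInverseWp_elliptic (h0 : 0 < m) (h1 : m < 1) (V : ℝ) : ∃ a : ℂ, IsInverseWp m V a ∧ 0 ≤ a.re ∧
    a.re ≤ ellipticK m ∧ 0 ≤ a.im ∧ a.im ≤ ellipticK (1 - m) := by
  obtain ⟨a, h2, h3, h4⟩ := exists_wp_eq (ellipticK_pos h0.le h1) (ellipticK_compl_pos h0 h1) V
  refine ⟨a, ?_, h4⟩
  rw [IsInverseWp, wp, lattice_eq h0 h1]
  exact ⟨h2, h3⟩

end Elliptic

/-! ### The degenerate lattice `π ℤ` -/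

section Degenerate

open Complex Filter Topology

theorem ellipticK_zero : ellipticK 0 = Real.pi / 2 := by
  simp [ellipticK, ellipticF]

theorem lattice_zero : lattice 0 = Submodule.span ℤ {(Real.pi : ℂ)} := by
  rw [lattice, if_pos rfl, ellipticK_zero, mul_div_cancel₀ _ (two_ne_zero)]

theorem mem_lattice_zero {z : ℂ} : z ∈ lattice 0 ↔ ∃ n : ℤ, z = n * Real.pi := by
  rw [lattice_zero, Submodule.mem_span_singleton]
  simp [eq_comm]

theorem notMem_lattice_zero {z : ℂ} : z ∉ lattice 0 ↔ sin z ≠ 0 := by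
  rw [mem_lattice_zero, Ne, sin_eq_zero_iff]

/-- The lattice points `n π`. -/
def intEquivLattice : ℤ ≃ lattice 0 :=
  Equiv.ofBijective (fun n => ⟨n * Real.pi, mem_lattice_zero.mpr ⟨n, rfl⟩⟩) <| by
    constructor
    · intro m n h
      have h1 : (m : ℂ) * Real.pi = n * Real.pi := congrArg Subtype.val h
      exact_mod_cast mul_right_cancel₀ (ofReal_ne_zero.mpr Real.pi_ne_zero) h1
    · rintro ⟨z, hz⟩
      obtain ⟨n, rfl⟩ := mem_lattice_zero.mp hz
      exact ⟨n, rfl⟩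

theorem weierstrassP_lattice_zero (z : ℂ) : weierstrassP (lattice 0) z =
    ∑' n : ℤ, (1 / (z - n * Real.pi) ^ 2 - 1 / (n * Real.pi : ℂ) ^ 2) :=
  (intEquivLattice.tsum_eq _).symm

theorem weierstrassZeta_lattice_zero (z : ℂ) : weierstrassZeta (lattice 0) z =
    ∑' n : ℤ, (1 / (z - n * Real.pi) + 1 / (n * Real.pi : ℂ) + z / (n * Real.pi : ℂ) ^ 2) :=
  (intEquivLattice.tsum_eq _).symm

theorem isOpen_compl_lattice_zero : IsOpen {z : ℂ | sin z ≠ 0} :=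
  isOpen_ne_fun continuous_sin continuous_const

/-- Uniform distance bound to the lattice points, on a neighbourhood of a regular point. -/
theorem exists_dist_lattice_zero {z₀ : ℂ} (h : sin z₀ ≠ 0) :
    ∃ r > 0, ∃ C > 0, ∀ z ∈ Metric.ball z₀ r, ∀ n : ℤ, 1 + ‖(n : ℂ)‖ ≤ C * ‖z - n * Real.pi‖ := by
  obtain ⟨δ, hδ, hball⟩ := Metric.isOpen_iff.mp isOpen_compl_lattice_zero z₀ h
  refine ⟨δ / 2, by positivity, 2 * (1 + (1 + ‖z₀‖) / δ), by positivity, fun z hz n => ?_⟩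
  have h1 : δ ≤ ‖z₀ - n * Real.pi‖ := by
    by_contra! hlt
    have := hball (a := n * Real.pi) (by rwa [mem_ball_iff_norm'])
    exact this (sin_int_mul_pi n)
  have h2 : ‖z₀ - n * Real.pi‖ ≤ 2 * ‖z - n * Real.pi‖ := by
    have h3 : ‖z₀ - n * Real.pi‖ ≤ ‖z₀ - z‖ + ‖z - n * Real.pi‖ := by
      simpa using norm_add_le (z₀ - z) (z - n * Real.pi)
    rw [mem_ball_iff_norm'] at hz
    linarith
  have h3 : ‖(n : ℂ)‖ ≤ ‖z₀ - n * Real.pi‖ + ‖z₀‖ := by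
    have h4 : ‖(n : ℂ)‖ ≤ ‖(n : ℂ) * Real.pi‖ := by
      rw [norm_mul, norm_real, Real.norm_of_nonneg Real.pi_pos.le]
      exact le_mul_of_one_le_right (norm_nonneg _) (by linarith [Real.pi_gt_three])
    have h5 : ‖(n : ℂ) * Real.pi‖ ≤ ‖z₀ - n * Real.pi‖ + ‖z₀‖ := by
      have := norm_sub_le z₀ (z₀ - n * Real.pi)
      rw [sub_sub_cancel] at this
      linarith
    exact h4.trans h5
  have h4 : 1 + ‖z₀‖ ≤ (1 + ‖z₀‖) / δ * ‖z₀ - n * Real.pi‖ := by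
    rw [div_mul_eq_mul_div, le_div_iff₀ hδ]
    gcongr
  calc 1 + ‖(n : ℂ)‖ ≤ (1 + (1 + ‖z₀‖) / δ) * ‖z₀ - n * Real.pi‖ := by linarith
    _ ≤ (1 + (1 + ‖z₀‖) / δ) * (2 * ‖z - n * Real.pi‖) := by gcongr
    _ = _ := by ring

theorem summable_int_bound : Summable fun n : ℤ => ((1 + ‖(n : ℂ)‖) ^ 2)⁻¹ := by
  refine Summable.of_norm_bounded_eventually (g := fun n : ℤ => 1 / (n : ℝ) ^ 2)
    (Real.summable_one_div_int_pow.mpr one_lt_two) ?_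
  filter_upwards [(Set.finite_singleton (0 : ℤ)).compl_mem_cofinite] with n hn
  have hn' : (n : ℝ) ≠ 0 := by simpa using hn
  rw [Real.norm_of_nonneg (by positivity), one_div, norm_intCast, ← sq_abs (n : ℝ)]
  have := abs_pos.mpr hn'
  gcongr
  linarith

theorem inv_sq_le_bound (n : ℤ) : ‖1 / (n * Real.pi : ℂ) ^ 2‖ ≤ 4 * ((1 + ‖(n : ℂ)‖) ^ 2)⁻¹ := by
  rcases eq_or_ne n 0 with rfl | hn
  · simp
  have h1 : (1 : ℝ) ≤ ‖(n : ℂ)‖ := by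
    rw [norm_intCast]
    exact_mod_cast Int.one_le_abs hn
  have h2 : 1 + ‖(n : ℂ)‖ ≤ 2 * ‖(n * Real.pi : ℂ)‖ := by
    rw [norm_mul, norm_real, Real.norm_of_nonneg Real.pi_pos.le]
    nlinarith [Real.pi_gt_three]
  have h3 : 0 < ‖(n * Real.pi : ℂ)‖ := by linarith
  rw [norm_div, norm_one, norm_pow, ← div_eq_mul_inv, div_le_div_iff₀ (by positivity) (by positivity)]
  nlinarith

theorem summable_zeta_zero {z : ℂ} (hz : sin z ≠ 0) : Summable fun n : ℤ =>
    1 / (z - n * Real.pi) + 1 / (n * Real.pi : ℂ) + z / (n * Real.pi : ℂ) ^ 2 := by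
  obtain ⟨r, hr, C, hC, hb⟩ := exists_dist_lattice_zero hz
  refine Summable.of_norm_bounded_eventually
    (g := fun n : ℤ => ‖z‖ ^ 2 * C * 4 * ((1 + ‖(n : ℂ)‖) ^ 2)⁻¹) (summable_int_bound.mul_left _) ?_
  filter_upwards [(Set.finite_singleton (0 : ℤ)).compl_mem_cofinite] with n hn
  have hn' : (n : ℂ) * Real.pi ≠ 0 :=
    mul_ne_zero (by simpa using hn) (ofReal_ne_zero.mpr Real.pi_ne_zero)
  have hd := hb z (Metric.mem_ball_self hr) n
  have hd1 : 1 ≤ C * ‖z - n * Real.pi‖ := by linarith [norm_nonneg (n : ℂ)]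
  have hne : z - n * Real.pi ≠ 0 := by
    intro h
    rw [h, norm_zero, mul_zero] at hd1
    linarith
  have e : 1 / (z - n * Real.pi) + 1 / (n * Real.pi : ℂ) + z / (n * Real.pi : ℂ) ^ 2 =
      z ^ 2 * (1 / (z - n * Real.pi)) * (1 / (n * Real.pi : ℂ) ^ 2) := by
    generalize (n : ℂ) * Real.pi = l at *
    field_simp
    ring
  have hinv : ‖1 / (z - n * Real.pi)‖ ≤ C := by
    rw [norm_div, norm_one, div_le_iff₀ (norm_pos_iff.mpr hne)]
    exact hd1
  rw [e, norm_mul, norm_mul, norm_pow, mul_assoc (‖z‖ ^ 2 * C)]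
  gcongr
  exact inv_sq_le_bound n

theorem hasDerivAt_zeta_zero {z : ℂ} (hz : sin z ≠ 0) :
    HasDerivAt (weierstrassZeta (lattice 0)) (-weierstrassP (lattice 0) z) z := by
  obtain ⟨r, hr, C, hC, hb⟩ := exists_dist_lattice_zero hz
  have hpos {y : ℂ} (hy : y ∈ Metric.ball z r) (n : ℤ) : 0 < ‖y - n * Real.pi‖ := by
    by_contra! h
    nlinarith [hb y hy n, norm_nonneg (n : ℂ)]
  have key := hasDerivAt_tsum_of_isPreconnected (𝕜 := ℂ) (F := ℂ)
    (u := fun n : ℤ => (C ^ 2 + 4) * ((1 + ‖(n : ℂ)‖) ^ 2)⁻¹)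
    (g := fun (n : ℤ) (z : ℂ) =>
      1 / (z - n * Real.pi) + 1 / (n * Real.pi : ℂ) + z / (n * Real.pi : ℂ) ^ 2)
    (g' := fun (n : ℤ) (z : ℂ) => -(1 / (z - n * Real.pi) ^ 2 - 1 / (n * Real.pi : ℂ) ^ 2))
    (t := Metric.ball z r) (y₀ := z) (y := z)
    (summable_int_bound.mul_left _) Metric.isOpen_ball (convex_ball z r).isPreconnected
    (fun n y hy => ?_) (fun n y hy => ?_) (Metric.mem_ball_self hr) (summable_zeta_zero hz)
    (Metric.mem_ball_self hr)
  · rw [weierstrassP_lattice_zero, ← tsum_neg]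
    exact key.congr_of_eventuallyEq (.of_forall weierstrassZeta_lattice_zero)
  · have hne : y - n * Real.pi ≠ 0 := norm_pos_iff.mp (hpos hy n)
    have h1 := ((hasDerivAt_id y).sub_const (n * Real.pi : ℂ)).fun_inv hne
    have h2 := (h1.add_const (1 / (n * Real.pi : ℂ))).add
      ((hasDerivAt_id y).div_const ((n * Real.pi : ℂ) ^ 2))
    simp only [id, ← one_div] at h2
    refine h2.congr_deriv ?_
    ring
  · rw [norm_neg]
    refine (norm_sub_le _ _).trans ?_
    rw [add_mul]
    refine add_le_add ?_ (inv_sq_le_bound n)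
    have h1 := hb y hy n
    rw [norm_div, norm_one, norm_pow, ← div_eq_mul_inv, div_le_div_iff₀ (pow_pos (hpos hy n) 2)
      (by positivity), one_mul, ← mul_pow]
    gcongr

theorem tsum_pnat_inv_sq : ∑' n : ℕ+, 1 / (n : ℂ) ^ 2 = (Real.pi : ℂ) ^ 2 / 6 := by
  have h := hasSum_zeta_two.tsum_eq
  rw [← tsum_pnat_eq_tsum_of_eq_zero (f := fun n : ℕ => 1 / (n : ℝ) ^ 2) (by simp)] at h
  have := congrArg ((↑) : ℝ → ℂ) h
  push_cast at this
  exact this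

/-- Pairing `n` with `-n` cancels the terms `1/(nπ)` and leaves the partial fractions of the
cotangent, plus `(2z/π²) ∑ 1/n² = z/3`. -/
theorem zeta_zero_eq {z : ℂ} (hz : sin z ≠ 0) :
    weierstrassZeta (lattice 0) z = cot z + z / 3 := by
  have hpi : (Real.pi : ℂ) ≠ 0 := ofReal_ne_zero.mpr Real.pi_ne_zero
  have hx : z / Real.pi ∈ integerComplement := by
    rintro ⟨n, hn⟩
    refine hz (sin_eq_zero_iff.mpr ⟨n, ?_⟩)
    rw [hn]
    field_simp
  have hcot := cot_series_rep hx
  rw [mul_div_cancel₀ _ hpi] at hcot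
  have hs := summable_zeta_zero hz
  rw [weierstrassZeta_lattice_zero]
  set f : ℤ → ℂ := fun n =>
    1 / (z - n * Real.pi) + 1 / (n * Real.pi : ℂ) + z / (n * Real.pi : ℂ) ^ 2 with hf
  have hterm (n : ℕ+) : f (n : ℤ) + f (-(n : ℤ)) =
      (1 / Real.pi) * (1 / (z / Real.pi - n) + 1 / (z / Real.pi + n)) +
        2 * z / Real.pi ^ 2 * (1 / (n : ℂ) ^ 2) := by
    have hn : (n : ℂ) ≠ 0 := by exact_mod_cast n.ne_zero
    have h1 : z / Real.pi - n = (z - n * Real.pi) / Real.pi := by field_simp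
    have h2 : z / Real.pi + n = (z + n * Real.pi) / Real.pi := by field_simp
    rw [h1, h2]
    simp only [hf]
    push_cast
    rw [one_div_div, one_div_div]
    field_simp
    ring
  have s1 : Summable fun n : ℕ+ => f (n : ℤ) := hs.comp_injective (i := fun n : ℕ+ => (n : ℤ)) fun a b h => by simpa using h
  have s2 : Summable fun n : ℕ+ => f (-(n : ℤ)) := hs.comp_injective (i := fun n : ℕ+ => -(n : ℤ)) fun a b h => by simpa using h
  have s3 : Summable fun n : ℕ+ => 2 * z / (Real.pi : ℂ) ^ 2 * (1 / (n : ℂ) ^ 2) := by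
    have : Summable fun n : ℕ => 1 / (n : ℂ) ^ 2 := by
      refine (Complex.ofRealCLM.summable (Real.summable_one_div_nat_pow.mpr one_lt_two)).congr
        fun n => ?_
      simp
    exact (this.comp_injective PNat.coe_injective).mul_left _
  have s4 : Summable fun n : ℕ+ =>
      (1 / (Real.pi : ℂ)) * (1 / (z / Real.pi - n) + 1 / (z / Real.pi + n)) :=
    ((s1.add s2).sub s3).congr fun n => by rw [hterm, add_sub_cancel_right]
  rw [tsum_int_eq_zero_add_tsum_pnat hs, add_assoc,
    ← s1.tsum_add s2, tsum_congr hterm, s4.tsum_add s3, tsum_mul_left, tsum_mul_left,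
    tsum_pnat_inv_sq]
  have hz0 : z ≠ 0 := by
    rintro rfl
    simp at hz
  generalize ∑' n : ℕ+, (1 / (z / Real.pi - n) + 1 / (z / Real.pi + n)) = S at *
  have hS : cot z = (Real.pi / z + S) / Real.pi := by
    rw [eq_div_iff hpi, mul_comm, hcot, one_div_div]
  rw [hS]
  simp only [hf, Int.cast_zero, zero_mul, sub_zero, div_zero, ne_eq, OfNat.ofNat_ne_zero,
    not_false_eq_true, zero_pow, add_zero]
  field_simp
  ring

theorem hasDerivAt_cot {z : ℂ} (hz : sin z ≠ 0) : HasDerivAt cot (-(1 + cot z ^ 2)) z := by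
  have := (hasDerivAt_cos z).div (hasDerivAt_sin z) hz
  refine (this.congr_of_eventuallyEq (.of_forall fun z => cot_eq_cos_div_sin z)).congr_deriv ?_
  rw [cot_eq_cos_div_sin]
  field_simp
  ring

theorem wp_zero_eq {z : ℂ} (hz : sin z ≠ 0) : wp 0 z = cot z ^ 2 + 2 / 3 := by
  have h1 := (hasDerivAt_cot hz).add ((hasDerivAt_id z).div_const 3)
  have h2 := (hasDerivAt_zeta_zero hz).unique (h1.congr_of_eventuallyEq (by
    filter_upwards [isOpen_compl_lattice_zero.mem_nhds hz] with y hy using zeta_zero_eq hy))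
  rw [wp]
  linear_combination -h2

/-- The linear parts of `ζ` cancel, and `cot (π/2) = 0`. -/
theorem floquetExponent_zero {a : ℂ} (ha : sin a ≠ 0) :
    floquetExponent (ellipticK 0) (lattice 0) a = Real.pi * (cot a / 2) := by
  have h : sin (Real.pi / 2 : ℂ) ≠ 0 := by simp
  rw [floquetExponent, zeta_zero_eq ha, ellipticK_zero]
  push_cast
  rw [zeta_zero_eq h, cot_eq_cos_div_sin (Real.pi / 2 : ℂ), cos_pi_div_two]
  ring

theorem IsInverseWp.cot_sq {V : ℝ} {a : ℂ} (ha : IsInverseWp 0 V a) :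
    sin a ≠ 0 ∧ (cot a / 2) ^ 2 = (V - 2 / 3) / 4 := by
  have h := notMem_lattice_zero.mp ha.1
  have h2 := ha.2
  rw [wp_zero_eq h] at h2
  exact ⟨h, by rw [← h2]; ring⟩

variable {c V : ℝ}

/-- At `m = 0` the profile is constant. The exponent is `cot a / 2` when `℘(a) = V`, but working
with any root `lam` also covers `V = -1/3`, where no such `a` exists. An exponential never vanishes,
so no strip condition arises. -/
theorem solvesLinear_exp (hc : c ≠ 0) {lam : ℂ} (h : lam ^ 2 = (V - 2 / 3) / 4) :
    SolvesLinear (fun x => 6 / c * profile c 0 V x) (fun x : ℝ => exp (lam * x))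
      (fun x : ℝ => lam * exp (lam * x)) := by
  have hd (x : ℝ) : HasDerivAt (fun x : ℝ => exp (lam * x)) (lam * exp (lam * x)) x := by
    have := ((hasDerivAt_id (x : ℂ)).const_mul lam).cexp.comp_ofReal
    simpa [mul_comm] using this
  refine ⟨hd, fun x => ((hd x).const_mul lam).congr_deriv ?_⟩
  rw [six_div_mul_profile hc, ellipticK_zero, real_smul]
  have hpi : (Real.pi : ℂ) ≠ 0 := ofReal_ne_zero.mpr Real.pi_ne_zero
  push_cast
  rw [← mul_assoc, ← sq, h]
  field_simp
  ring

theorem trace_degenerate (hc : c ≠ 0) {lam : ℂ} (h : lam ^ 2 = (V - 2 / 3) / 4)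
    {ψ : Fin 2 → ℝ → ℝ} {M : Matrix.SpecialLinearGroup (Fin 2) ℝ}
    (hψ : IsFundamentalSystem c (profile c 0 V) ψ) (hM : IsMonodromy ψ M) :
    ((M : Matrix (Fin 2) (Fin 2) ℝ).trace : ℂ) = 2 * cosh (2 * (Real.pi * lam)) := by
  refine hM.trace_eq hc (continuous_profile le_rfl one_pos) hψ (solvesLinear_exp hc h)
    (t := 0) (exp_ne_zero _) fun x => ?_
  rw [← exp_add]
  push_cast
  ring_nf

theorem uniform_value_degenerate (hc : c ≠ 0) {lam : ℂ} (h : lam ^ 2 = (V - 2 / 3) / 4) {k : ℝ}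
    (hk : IsUniformRepresentative c (profile c 0 V) k) :
    (k : ℂ) = c / (6 * Real.pi ^ 2) * (Real.pi * lam) ^ 2 := by
  refine uniform_value_of_exp (g := fun x => lam * x) hc hk (solvesLinear_exp hc h) ?_ fun x => ?_
  · exact ((differentiable_id.const_mul lam).comp ofRealCLM.differentiable : _)
  · push_cast
    ring

theorem exists_isInverseWp_zero (hV : V ≠ -1 / 3) : ∃ a : ℂ, IsInverseWp 0 V a ∧ 0 ≤ a.re ∧
    a.re ≤ ellipticK 0 ∧ 0 ≤ a.im := by
  have hV' : V + 1 / 3 ≠ 0 := fun h => hV (by linarith)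
  have hpi := Real.pi_pos
  -- Since `cot² + 2/3 = 1/sin² - 1/3`, the equation `℘(a) = V` amounts to `sin² a = 1/(V + 1/3)`.
  -- The right side `q` is reached on the imaginary axis for `q ≤ 0`, on `[0, π/2]` for `0 ≤ q ≤ 1`,
  -- and on the line `Re a = π/2` for `q ≥ 1`.
  suffices h : ∃ a : ℂ, sin a ^ 2 = ((1 / (V + 1 / 3) : ℝ) : ℂ) ∧ 0 ≤ a.re ∧
      a.re ≤ Real.pi / 2 ∧ 0 ≤ a.im by
    obtain ⟨a, ha, h1, h2, h3⟩ := h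
    have h0 : sin a ≠ 0 := by
      intro h0
      rw [h0, zero_pow two_ne_zero] at ha
      exact one_div_ne_zero hV' (by exact_mod_cast ha.symm)
    refine ⟨a, ⟨notMem_lattice_zero.mpr h0, ?_⟩, h1, by rwa [ellipticK_zero], h3⟩
    have h4 : ((V + 1 / 3 : ℝ) : ℂ) ≠ 0 := ofReal_ne_zero.mpr hV'
    have h5 : (V : ℂ) = ((V + 1 / 3 : ℝ) : ℂ) - 1 / 3 := by push_cast; ring
    rw [h5]
    rw [wp_zero_eq h0, cot_eq_cos_div_sin, div_pow, cos_sq', ha, ofReal_div, ofReal_one]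
    generalize ((V + 1 / 3 : ℝ) : ℂ) = y at *
    field_simp
    ring
  generalize 1 / (V + 1 / 3) = q
  rcases le_total q 0 with hq | hq
  · refine ⟨(Real.arsinh (Real.sqrt (-q)) : ℝ) * I, ?_, by simp, by simp; positivity,
      by simp⟩
    rw [sin_mul_I, ← ofReal_sinh, Real.sinh_arsinh, mul_pow, I_sq, ← ofReal_pow,
      Real.sq_sqrt (by linarith)]
    push_cast
    ring
  rcases le_total q 1 with hq1 | hq1
  · refine ⟨(Real.arcsin (Real.sqrt q) : ℝ), ?_, by simp,
      by simpa using Real.arcsin_le_pi_div_two _, by simp⟩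
    rw [← ofReal_sin, Real.sin_arcsin (by linarith [Real.sqrt_nonneg q]) (Real.sqrt_le_one.mpr hq1),
      ← ofReal_pow, Real.sq_sqrt hq]
  · refine ⟨(Real.pi / 2 : ℝ) + (Real.arsinh (Real.sqrt (q - 1)) : ℝ) * I, ?_,
      by simp; positivity, by simp, by simp⟩
    rw [add_comm, ofReal_div, ofReal_ofNat, sin_add_pi_div_two, cos_mul_I, ← ofReal_cosh,
      ← ofReal_pow, Real.cosh_sq, Real.sinh_arsinh, Real.sq_sqrt (by linarith)]
    push_cast
    ring

/-- The cotangent is a rational function of `exp (2iz)`, which tends to `0` as `Im z → ∞`. -/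
theorem tendsto_cot : Tendsto cot (comap im atTop) (𝓝 (-I)) := by
  have h1 : Tendsto (fun z : ℂ => exp (2 * I * z)) (comap im atTop) (𝓝 0) := by
    rw [tendsto_zero_iff_norm_tendsto_zero]
    have e (z : ℂ) : ‖exp (2 * I * z)‖ = Real.exp (-(2 * z.im)) := by
      rw [norm_exp]
      simp
    simp only [e]
    exact (Real.tendsto_exp_neg_atTop_nhds_zero.comp
      (tendsto_id.const_mul_atTop two_pos)).comp tendsto_comap
  have h2 : Tendsto (fun z : ℂ => (exp (2 * I * z) + 1) / (I * (1 - exp (2 * I * z))))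
      (comap im atTop) (𝓝 ((0 + 1) / (I * (1 - 0)))) :=
    (h1.add_const 1).div ((h1.const_sub 1).const_mul I) (by simp)
  simp only [zero_add, sub_zero, mul_one, one_div, inv_I] at h2
  exact h2.congr fun z => (cot_eq_exp_ratio z).symm

theorem eventually_sin_ne_zero : ∀ᶠ z in comap im atTop, sin z ≠ 0 := by
  have : ∀ᶠ z in comap im atTop, 0 < z.im := (eventually_gt_atTop 0).comap im
  filter_upwards [this] with z hz h
  obtain ⟨n, rfl⟩ := sin_eq_zero_iff.mp h
  simp at hz

theorem tendsto_wp_zero : Tendsto (wp 0) (comap im atTop) (𝓝 (-1 / 3)) := by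
  have h := (tendsto_cot.pow 2).add_const (2 / 3 : ℂ)
  rw [neg_sq, I_sq, show (-1 : ℂ) + 2 / 3 = -1 / 3 by norm_num] at h
  exact h.congr' (eventually_sin_ne_zero.mono fun z hz => (wp_zero_eq hz).symm)

theorem tendsto_floquetExponent_zero : Tendsto (floquetExponent (ellipticK 0) (lattice 0))
    (comap im atTop) (𝓝 (Real.pi * (-I / 2))) :=
  ((tendsto_cot.div_const 2).const_mul (Real.pi : ℂ)).congr'
    (eventually_sin_ne_zero.mono fun _ hz => (floquetExponent_zero hz).symm)

end Degenerate

end Cnoidal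

end

/-! ### The main theorem, from the elliptic and degenerate cases -/

theorem mainTheorem1 (c m V : ℝ) (hc : c ≠ 0) (hm0 : 0 ≤ m) (hm1 : m < 1) :
    -- Hill's equation has fundamental systems, each with a unique monodromy matrix in `SL(2, ℝ)`
    ((∃ ψ, Cnoidal.IsFundamentalSystem c (Cnoidal.profile c m V) ψ) ∧
      ∀ ψ, Cnoidal.IsFundamentalSystem c (Cnoidal.profile c m V) ψ →
        ∃! M, Cnoidal.IsMonodromy ψ M) ∧
    -- `℘⁻¹(V)` has a value in the fundamental rectangle, except at `(m, V) = (0, -1/3)`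
    (¬ (m = 0 ∧ V = -1 / 3) →
      ∃ a : ℂ, Cnoidal.IsInverseWp m V a ∧ 0 ≤ a.re ∧ a.re ≤ Cnoidal.ellipticK m ∧
        0 ≤ a.im ∧ (m ≠ 0 → a.im ≤ Cnoidal.ellipticK (1 - m))) ∧
    -- the trace formula, for every value `a` of `℘⁻¹(V)`
    (∀ ψ M, Cnoidal.IsFundamentalSystem c (Cnoidal.profile c m V) ψ → Cnoidal.IsMonodromy ψ M →
      ∀ a : ℂ, Cnoidal.IsInverseWp m V a →
        ((M : Matrix (Fin 2) (Fin 2) ℝ).trace : ℂ) =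
          2 * Complex.cosh (2 * Cnoidal.ellipticK m * Cnoidal.zeta m a -
            2 * Cnoidal.zeta m (Cnoidal.ellipticK m) * a)) ∧
    -- reality
    (∀ a : ℂ, Cnoidal.IsInverseWp m V a →
      (2 * Complex.cosh (2 * Cnoidal.ellipticK m * Cnoidal.zeta m a -
        2 * Cnoidal.zeta m (Cnoidal.ellipticK m) * a)).im = 0) ∧
    -- independence of the branch
    (∀ a b : ℂ, Cnoidal.IsInverseWp m V a → Cnoidal.IsInverseWp m V b →
      2 * Complex.cosh (2 * Cnoidal.ellipticK m * Cnoidal.zeta m a -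
        2 * Cnoidal.zeta m (Cnoidal.ellipticK m) * a) =
      2 * Complex.cosh (2 * Cnoidal.ellipticK m * Cnoidal.zeta m b -
        2 * Cnoidal.zeta m (Cnoidal.ellipticK m) * b)) ∧
    -- the uniform representative, for every value `a` of `℘⁻¹(V)` with `|Im a| ≤ K(1 - m)`
    (∀ k : ℝ, Cnoidal.IsUniformRepresentative c (Cnoidal.profile c m V) k →
      ∀ a : ℂ, Cnoidal.IsInverseWp m V a → (m ≠ 0 → |a.im| ≤ Cnoidal.ellipticK (1 - m)) →
        (k : ℂ) = c / (6 * Real.pi ^ 2) *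
          (Cnoidal.ellipticK m * Cnoidal.zeta m a -
            Cnoidal.zeta m (Cnoidal.ellipticK m) * a) ^ 2) ∧
    -- at `(m, V) = (0, -1/3)`, where `℘⁻¹(V) = i ∞`, the same formulas hold in the limit
    (m = 0 → V = -1 / 3 →
      Filter.Tendsto (Cnoidal.wp m) (Filter.comap Complex.im Filter.atTop) (nhds (V : ℂ)) ∧
      (∀ ψ M, Cnoidal.IsFundamentalSystem c (Cnoidal.profile c m V) ψ → Cnoidal.IsMonodromy ψ M →
        (M : Matrix (Fin 2) (Fin 2) ℝ).trace = -2 ∧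
        Filter.Tendsto
          (fun a : ℂ => 2 * Complex.cosh (2 * Cnoidal.ellipticK m * Cnoidal.zeta m a -
            2 * Cnoidal.zeta m (Cnoidal.ellipticK m) * a))
          (Filter.comap Complex.im Filter.atTop)
          (nhds ((M : Matrix (Fin 2) (Fin 2) ℝ).trace : ℂ))) ∧
      (∀ k : ℝ, Cnoidal.IsUniformRepresentative c (Cnoidal.profile c m V) k →
        k = -c / 24 ∧
        Filter.Tendsto
          (fun a : ℂ => (c : ℂ) / (6 * Real.pi ^ 2) *
            (Cnoidal.ellipticK m * Cnoidal.zeta m a -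
              Cnoidal.zeta m (Cnoidal.ellipticK m) * a) ^ 2)
          (Filter.comap Complex.im Filter.atTop) (nhds (k : ℂ)))) := by
  have hcont := Cnoidal.continuous_profile (c := c) (V := V) hm0 hm1
  have hX (a : ℂ) : 2 * (Cnoidal.ellipticK m : ℂ) * Cnoidal.zeta m a -
      2 * Cnoidal.zeta m (Cnoidal.ellipticK m) * a =
      2 * Cnoidal.floquetExponent (Cnoidal.ellipticK m) (Cnoidal.lattice m) a := by
    rw [Cnoidal.floquetExponent, Cnoidal.zeta, Cnoidal.zeta]
    ring
  have hX' (a : ℂ) : (Cnoidal.ellipticK m : ℂ) * Cnoidal.zeta m a -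
      Cnoidal.zeta m (Cnoidal.ellipticK m) * a =
      Cnoidal.floquetExponent (Cnoidal.ellipticK m) (Cnoidal.lattice m) a := rfl
  simp only [hX, hX']
  have hex : ∃ ψ, Cnoidal.IsFundamentalSystem c (Cnoidal.profile c m V) ψ := by
    obtain ⟨C, hC⟩ := Cnoidal.exists_abs_profile_le c m V
    exact Cnoidal.exists_isFundamentalSystem hc hcont hC
  have huniq : ∀ ψ, Cnoidal.IsFundamentalSystem c (Cnoidal.profile c m V) ψ →
      ∃! M, Cnoidal.IsMonodromy ψ M := fun ψ hψ =>
    Cnoidal.existsUnique_isMonodromy hc hcont (Cnoidal.profile_add_two_pi hm0 hm1) hψ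
  have htrace : ∀ ψ M, Cnoidal.IsFundamentalSystem c (Cnoidal.profile c m V) ψ →
      Cnoidal.IsMonodromy ψ M → ∀ a : ℂ, Cnoidal.IsInverseWp m V a →
        ((M : Matrix (Fin 2) (Fin 2) ℝ).trace : ℂ) =
          2 * Complex.cosh
            (2 * Cnoidal.floquetExponent (Cnoidal.ellipticK m) (Cnoidal.lattice m) a) := by
    intro ψ M hψ hM a ha
    rcases hm0.eq_or_lt with rfl | h0
    · rw [Cnoidal.floquetExponent_zero ha.cot_sq.1]
      exact Cnoidal.trace_degenerate hc ha.cot_sq.2 hψ hM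
    · exact Cnoidal.trace_elliptic h0 hm1 hc ha hψ hM
  -- A fixed fundamental system: its trace is real and does not involve `a`, which gives reality and
  -- independence of the branch.
  obtain ⟨ψ₀, hψ₀⟩ := hex
  obtain ⟨M₀, hM₀, -⟩ := huniq ψ₀ hψ₀
  refine ⟨⟨⟨ψ₀, hψ₀⟩, huniq⟩, ?_, htrace, ?_, ?_, ?_, ?_⟩
  · intro hne
    rcases hm0.eq_or_lt with rfl | h0
    · obtain ⟨a, ha, h1, h2, h3⟩ := Cnoidal.exists_isInverseWp_zero fun hV => hne ⟨rfl, hV⟩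
      exact ⟨a, ha, h1, h2, h3, fun h => absurd rfl h⟩
    · obtain ⟨a, ha, h1, h2, h3, h4⟩ := Cnoidal.exists_isInverseWp_elliptic h0 hm1 V
      exact ⟨a, ha, h1, h2, h3, fun _ => h4⟩
  · intro a ha
    rw [← htrace ψ₀ M₀ hψ₀ hM₀ a ha, Complex.ofReal_im]
  · intro a b ha hb
    rw [← htrace ψ₀ M₀ hψ₀ hM₀ a ha, ← htrace ψ₀ M₀ hψ₀ hM₀ b hb]
  · intro k hk a ha him
    rcases hm0.eq_or_lt with rfl | h0
    · rw [Cnoidal.floquetExponent_zero ha.cot_sq.1]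
      exact Cnoidal.uniform_value_degenerate hc ha.cot_sq.2 hk
    · exact Cnoidal.uniform_value_elliptic h0 hm1 hc hk ha (him h0.ne')
  · rintro rfl rfl
    -- The exponent `-i/2` is the limit of `cot a / 2` as `Im a → ∞`, and is itself an exact root
    -- for `V = -1/3`. The exact values and the limits therefore agree.
    have hlam : (-Complex.I / 2) ^ 2 = (((-1 / 3 : ℝ) : ℂ) - 2 / 3) / 4 := by
      rw [div_pow, neg_sq, Complex.I_sq]
      push_cast
      norm_num
    have hlim := Cnoidal.tendsto_floquetExponent_zero
    refine ⟨by simpa using Cnoidal.tendsto_wp_zero, fun ψ M hψ hM => ?_, fun k hk => ?_⟩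
    · have h := Cnoidal.trace_degenerate hc hlam hψ hM
      refine ⟨?_, ?_⟩
      · have e : 2 * ((Real.pi : ℂ) * (-Complex.I / 2)) = -(Real.pi * Complex.I) := by ring
        rw [e, Complex.cosh_neg, Complex.cosh_mul_I, Complex.cos_pi] at h
        have h' : ((M : Matrix (Fin 2) (Fin 2) ℝ).trace : ℂ) = ((-2 : ℝ) : ℂ) := by
          rw [h]
          norm_num
        exact_mod_cast h'
      · rw [h]
        exact ((Complex.continuous_cosh.tendsto _).comp (hlim.const_mul 2)).const_mul 2
    · have h := Cnoidal.uniform_value_degenerate hc hlam hk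
      refine ⟨?_, ?_⟩
      · have hpi : (Real.pi : ℂ) ≠ 0 := Complex.ofReal_ne_zero.mpr Real.pi_ne_zero
        have h' : (k : ℂ) = ((-c / 24 : ℝ) : ℂ) := by
          rw [h, mul_pow, div_pow, neg_sq, Complex.I_sq]
          push_cast
          field_simp
          ring
        exact_mod_cast h'
      · rw [h]
        exact (hlim.pow 2).const_mul _
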